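/- \textbf{Setting.} Let $0<\beta\le 1$. Let $\Sigma_1,\Sigma_2,\Sigma_3\subset\mathbb R^3$ be nonempty sets such that for each $i=1,2,3$ there are a set $\Sigma_i^*\subset\mathbb R^3$, an open convex set $U_i\subset\mathbb R^3$, a function $\Phi_i\in C^{1,\beta}(U_i)$ (continuously differentiable with locally $\beta$-Hölder continuous gradient) and a unit normal vector field $\mathfrak n_i$ on $\Sigma_i^*$ with the following properties. (0) $\Sigma_i$ is a bounded, relatively open subset of $\Sigma_i^*$, and $\operatorname{diam}\Sigma_i\le 1$. (1) $\Sigma_i^*=\{\sigma\in U_i : \Phi_i(\sigma)=0\}$, $\nabla\Phi_i\neq 0$ on $\Sigma_i^*$, and $\operatorname{dist}(\Sigma_i,U_i^c)\ge \operatorname{diam}(\Sigma_i)$. (2) For all $\sigma\ne\tilde\sigma$ in $\Sigma_i^*$, $$\frac{|\mathfrak n_i(\sigma)-\mathfrak n_i(\tilde\sigma)|}{|\sigma-\tilde\sigma|^{\beta}}+\frac{|\mathfrak n_i(\sigma)\cdot(\sigma-\tilde\sigma)|}{|\sigma-\tilde\sigma|^{1+\beta}}\le 1 .$$ (3) $\tfrac12\le\det\big(\mathfrak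 n_1(\sigma_1),\mathfrak n_2(\sigma_2),\mathfrak n_3(\sigma_3)\big)\le 1$ for all $(\sigma_1,\sigma_2,\sigma_3)\in\Sigma_1^*\times\Sigma_2^*\times\Sigma_3^*$. Let $T:\mathbb R^3\to\mathbb R^3$ be an invertible linear map, and let $\Sigma_i'=T\Sigma_i$ be equipped with its surface measure $\mu_i'$. Put $$d=\inf_{\sigma_i'\in\Sigma_i'}\big|\det N'(\sigma_1',\sigma_2',\sigma_3')\big| ,$$ where the columns of $N'(\sigma_1',\sigma_2',\sigma_3')$ are unit normals to $\Sigma_i'$ at $\sigma_i'$, $i=1,2,3$. The convolution of $f'\in C_c(\Sigma_1')$ and $g'\in C_c(\Sigma_2')$ is the distribution $$(f'*g')(\psi)=\int_{\Sigma_1'}\int_{\Sigma_2'}f'(x)g'(y)\psi(x+y)\,d\mu_2'(y)\,d\mu_1'(x),\qquad \psi\in C_c^\infty(\mathbb R^3).$$ \textbf{Claim.} There is a constant $C$ depending only on $\beta$ such that, for all such $\Sigma_1,\Sigma_2,\Sigma_3$ and $T$, the restriction of $f'*g'$ to $\Sigma_3'$ is a well-defined element of $L^2(\Sigma_3')$ for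 all $f'\in L^2(\Sigma_1')$, $g'\in L^2(\Sigma_2')$, and $$\|f'*g'\|_{L^2(\Sigma_3')}\le \frac{C}{\sqrt d}\,\|f'\|_{L^2(\Sigma_1')}\|g'\|_{L^2(\Sigma_2')} .$$ Here well-defined means: for $f'\in C_c(\Sigma_1')$ and $g'\in C_c(\Sigma_2')$ the distribution $f'*g'$ is given by a continuous, compactly supported function on $\mathbb R^3$, whose trace on $\Sigma_3'$ lies in $L^2(\Sigma_3')$; and the map sending $(f',g')$ to this trace has a unique extension to a continuous bilinear map $L^2(\Sigma_1')\times L^2(\Sigma_2')\to L^2(\Sigma_3')$, whose value at $(f',g')$ is what is meant by $f'*g'$ on $\Sigma_3'$. -/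

import Mathlib

open MeasureTheory Topology

/-- Euclidean three-space. -/
abbrev E3 := EuclideanSpace ℝ (Fin 3)

/-- `Φ` is of class `C^{1,β}` on the (open) set `U`: it is continuously differentiable on `U` and
its derivative is locally `β`-Hölder continuous there. -/
def IsC1Holder (β : ℝ) (U : Set E3) (Φ : E3 → ℝ) : Prop :=
  ContDiffOn ℝ 1 Φ U ∧
    ∀ x ∈ U, ∃ V ∈ 𝓝 x, ∃ K : ℝ, ∀ y ∈ V ∩ U, ∀ z ∈ V ∩ U,
      ‖fderiv ℝ Φ y - fderiv ℝ Φ z‖ ≤ K * ‖y - z‖ ^ β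

/-- `v` is a unit normal vector to `S` at `p`: it has length one and is orthogonal to all tangent
vectors of `S` at `p`. For a `C^1` surface the tangent cone is the tangent plane, so there are
exactly two unit normals at each point, `v` and `-v`. -/
def IsUnitNormalAt (S : Set E3) (p v : E3) : Prop :=
  ‖v‖ = 1 ∧ ∀ w ∈ tangentConeAt ℝ S p, inner ℝ v w = 0

/-- The matrix `(v₁, v₂, v₃)` whose columns are the given vectors. -/
def columnMatrix (v : Fin 3 → E3) : Matrix (Fin 3) (Fin 3) ℝ :=
  Matrix.of fun k j => v j k

/-- The standing assumption on three surfaces `S i` with parameters `β`, `b`, `θ`, relative to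
given larger surfaces `Sstar i`, domains `U i`, defining functions `Φ i`, and unit normal
fields `n i` (which orient `Sstar i`). -/
structure SurfaceAssumptionWith (β b θ : ℝ) (S Sstar U : Fin 3 → Set E3)
    (Φ : Fin 3 → E3 → ℝ) (n : Fin 3 → E3 → E3) : Prop where
  /-- `S i` is bounded. -/
  isBounded : ∀ i, Bornology.IsBounded (S i)
  /-- `S i` is a relatively open subset of `Sstar i`. -/
  relOpen : ∀ i, ∃ O : Set E3, IsOpen O ∧ S i = Sstar i ∩ O
  isOpen_domain : ∀ i, IsOpen (U i)
  convex_domain : ∀ i, Convex ℝ (U i)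
  /-- The distance from `S i` to the complement of `U i` is at least the diameter of `S i`. -/
  diam_le_dist : ∀ i, ∀ x ∈ S i, ∀ y ∉ U i, Metric.diam (S i) ≤ dist x y
  regular : ∀ i, IsC1Holder β (U i) (Φ i)
  /-- `Sstar i` is the zero set of `Φ i` in `U i`. -/
  star_eq : ∀ i, Sstar i = {σ | σ ∈ U i ∧ Φ i σ = 0}
  /-- The gradient of `Φ i` does not vanish on `Sstar i`. -/
  gradient_ne_zero : ∀ i, ∀ σ ∈ Sstar i, fderiv ℝ (Φ i) σ ≠ 0
  /-- `n i` is a unit normal field on `Sstar i`. -/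
  normal : ∀ i, ∀ σ ∈ Sstar i, IsUnitNormalAt (Sstar i) σ (n i σ)
  /-- The Hölder condition. -/
  holder : ∀ i, ∀ σ ∈ Sstar i, ∀ τ ∈ Sstar i, σ ≠ τ →
    ‖n i σ - n i τ‖ / ‖σ - τ‖ ^ β + |inner ℝ (n i σ) (σ - τ)| / ‖σ - τ‖ ^ (1 + β) ≤ b
  /-- The transversality condition. -/
  transversal : ∀ σ : Fin 3 → E3, (∀ i, σ i ∈ Sstar i) →
    θ ≤ (columnMatrix fun i => n i (σ i)).det ∧ (columnMatrix fun i => n i (σ i)).det ≤ 1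

/-- The standing assumption on three surfaces with parameters `β`, `b`, `θ`. -/
def SurfaceAssumption (β b θ : ℝ) (S : Fin 3 → Set E3) : Prop :=
  ∃ (Sstar U : Fin 3 → Set E3) (Φ : Fin 3 → E3 → ℝ) (n : Fin 3 → E3 → E3),
    SurfaceAssumptionWith β b θ S Sstar U Φ n

/-- The transversality constant
`d = inf |det N(σ₁, σ₂, σ₃)|` over all `σ i ∈ S i`, where the columns of `N` are unit normals to
`S i` at `σ i`. (The choice of signs of the normals does not matter.) -/
noncomputable def transversalityInf (S : Fin 3 → Set E3) : ℝ :=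
  sInf {r | ∃ σ v : Fin 3 → E3, (∀ i, σ i ∈ S i ∧ IsUnitNormalAt (S i) (σ i) (v i)) ∧
    r = |(columnMatrix v).det|}

/-- The surface measure on a surface `S ⊆ ℝ³`: two-dimensional Hausdorff measure, normalized so as
to agree with the Lebesgue measure on planes, restricted to `S`. -/
noncomputable def surfaceMeasure (S : Set E3) : Measure E3 :=
  (μHE[2] : Measure E3).restrict S

/-- The Hilbert space `L²(S)` of complex functions with respect to surface measure. -/
noncomputable abbrev SurfaceL2 (S : Set E3) := Lp ℂ 2 (surfaceMeasure S)

/-- `f` is a continuous function with compact support on the surface `S`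
(its values off `S` are set to zero). -/
def IsCompactlySupportedOn (S : Set E3) (f : E3 → ℂ) : Prop :=
  ContinuousOn f S ∧ ∃ K ⊆ S, IsCompact K ∧ ∀ x ∉ K, f x = 0

/-- The function `F` on `ℝ³` represents the convolution `f ∗ g`, which is the distribution
`(f ∗ g)(ψ) = ∫_{S₁} ∫_{S₂} f(x) g(y) ψ(x + y) dμ₂(y) dμ₁(x)`. -/
def RepresentsConvolution (S₁ S₂ : Set E3) (f g F : E3 → ℂ) : Prop :=
  ∀ ψ : E3 → ℂ, ContDiff ℝ (⊤ : ℕ∞) ψ → HasCompactSupport ψ →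
    ∫ x, ∫ y, f x * g y * ψ (x + y) ∂(surfaceMeasure S₂) ∂(surfaceMeasure S₁) = ∫ z, F z * ψ z

/-- The continuous bilinear map `B : L²(S₁) × L²(S₂) → L²(S₃)` is
`(f, g) ↦ (f ∗ g)|_{S₃}`: for continuous compactly supported `f` and `g` the convolution is
a continuous compactly supported function on `ℝ³`, and `B` sends `(f, g)` to its trace on `S₃`.
(A continuous bilinear map extends the trace to all `f` and `g` by density.) -/
def IsConvolutionRestriction (S₁ S₂ S₃ : Set E3)
    (B : SurfaceL2 S₁ →L[ℂ] SurfaceL2 S₂ →L[ℂ] SurfaceL2 S₃) : Prop :=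
  ∀ f g : E3 → ℂ, IsCompactlySupportedOn S₁ f → IsCompactlySupportedOn S₂ g →
    ∃ (hf : MemLp f 2 (surfaceMeasure S₁)) (hg : MemLp g 2 (surfaceMeasure S₂)) (F : E3 → ℂ),
      Continuous F ∧ HasCompactSupport F ∧ RepresentsConvolution S₁ S₂ f g F ∧
        B (hf.toLp f) (hg.toLp g) =ᵐ[surfaceMeasure S₃] F

/-! The estimate is a nonlinear Loomis-Whitney inequality, proved by thickening the surfaces. For
nonnegative weights `T₀`, `T₁`, `T₂` on three-space, Cauchy-Schwarz with respect to `T₀ u * T₁ (z -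
u)` and Tonelli's theorem bound the `T₂`-weighted `L²` norm of a weighted convolution by the square
root of κ, where κ dominates `∫ T₂ z * T₁ (z - u) * T₀ (z - v)` for all `u`, `v`
(`lintegral_conv_sq_le`). If each weight lives in a thin layer around a surface, the three distances
to the translated surfaces serve as coordinates in this last integral. Their Jacobian is the
determinant of the conormals, so transversality gives a κ independent of the thickness
(`lintegral_thickWeight_triple_le`). Letting the thickness tend to zero yields the estimate for the
traces (`lintegral_density_sq_le`). Only first-order flatness of the surfaces enters, no curvature.

That the convolution is a continuous function is a separate point. On two transversal graphs the map
`(x, y) ↦ (x 2, x + y)` is a homeomorphism onto an open set with Jacobian bounded away from zero.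
Integrating out the first coordinate leaves a continuous compactly supported density in `x + y`
(`integral_conv_eq`).

Both arguments need coordinates in which the three surfaces are graphs over the three coordinate
planes with small slope. For the original surfaces the normals at three base points provide such a
frame, with bounds that come from the determinant being at least 1/2; the Hölder condition makes
pieces of a fixed small size flat in it (`HolderSurface.graphPatch`). The map `T` is not used for
choosing the frame: it is absorbed into the linear map `A` from the frame coordinates to the space
of the image surfaces. The area formula (`FlatGraph.volume_sweep`) expresses the surface measure of
an image as an explicit weight times the graph measure. In the product of the three weights all
factors cancel except `det A` and the determinant of the image normals, and `det A` disappears after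
rescaling the density. Each triple of pieces thus contributes exactly `1 / √d`, whatever `T` is
(`exists_density_image`).

Since the diameters are at most 1, the number of pieces depends only on β. A partition of unity sums
the pieces (`exists_density`), and density of `C_c` in `L²` gives the unique bilinear extension
(`exists_isConvolutionRestriction`). -/

/-- Coordinate three-space with the supremum norm. -/
abbrev V3 := Fin 3 → ℝ

/-- The linear functional `x ↦ a ⬝ x`. -/
noncomputable def dotCLM (a : V3) : V3 →L[ℝ] ℝ := ∑ j, a j • ContinuousLinearMap.proj j

theorem dotCLM_apply (a x : V3) : dotCLM a x = a ⬝ᵥ x := by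
  simp [dotCLM, dotProduct]

/-! ### Graphs over coordinate planes: tubes, heights and feet -/

/-- The union of the lines in direction `e i` through `M`. -/
def tube (i : Fin 3) (M : Set V3) : Set V3 := {u | ∃ t : ℝ, u - t • Pi.single i 1 ∈ M}

open Classical in
/-- The signed distance, along `e i`, of `u` from `M`. -/
noncomputable def height (i : Fin 3) (M : Set V3) (u : V3) : ℝ :=
  if h : u ∈ tube i M then h.choose else 0

/-- The projection to `M` along `e i`. -/
noncomputable def foot (i : Fin 3) (M : Set V3) (u : V3) : V3 :=
  u - height i M u • Pi.single i 1

/-- `M` is a `C¹` graph `x i = φ (x j, x k)` over an open set, where `φ` has small Lipschitz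
constant, and `m` is its conormal field, normalized by `m i = 1`. -/
structure GraphPatch (i : Fin 3) (M : Set V3) (m : V3 → V3) : Prop where
  cone : ∀ x ∈ M, ∀ y ∈ M, |x i - y i| ≤ 1 / 8 * ‖x - y‖
  conormal_self : ∀ x ∈ M, m x i = 1
  conormal_le : ∀ x ∈ M, ∀ j, j ≠ i → |m x j| ≤ 1 / 4
  cont : ContinuousOn m M
  flat : ∀ p ∈ M, (fun x => m p ⬝ᵥ (x - p)) =o[𝓝[M] p] (fun x => x - p)
  isOpen_tube : IsOpen (tube i M)

theorem norm_smul_single (i : Fin 3) (s : ℝ) : ‖s • (Pi.single i 1 : V3)‖ = |s| := by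
  rw [norm_smul, Pi.norm_single]; simp

theorem tube_add_smul {i : Fin 3} {M : Set V3} {u : V3} (s : ℝ) :
    u + s • Pi.single i 1 ∈ tube i M ↔ u ∈ tube i M := by
  constructor
  · rintro ⟨t, ht⟩
    refine ⟨t - s, ?_⟩
    convert ht using 1
    rw [sub_smul]; abel
  · rintro ⟨t, ht⟩
    refine ⟨t + s, ?_⟩
    convert ht using 1
    rw [add_smul]; abel

theorem foot_add_height (i : Fin 3) (M : Set V3) (u : V3) :
    foot i M u + height i M u • Pi.single i 1 = u := by
  simp [foot]

theorem foot_mem {i : Fin 3} {M : Set V3} {u : V3} (h : u ∈ tube i M) : foot i M u ∈ M := by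
  unfold foot height
  rw [dif_pos h]
  exact h.choose_spec

namespace GraphPatch

variable {i : Fin 3} {M : Set V3} {m : V3 → V3}

/-- By the cone condition the `i`-th coordinate of `x - y` is never the one that attains a nonzero
supremum norm, and adding a multiple of `e i` changes only that coordinate. -/
theorem norm_sub_le (h : GraphPatch i M m) {x y : V3} (hx : x ∈ M) (hy : y ∈ M) (s : ℝ) :
    ‖x - y‖ ≤ ‖x - y + s • Pi.single i 1‖ := by
  have h1 : ‖x - y‖ ≤ max (‖x - y + s • Pi.single i 1‖) (1 / 8 * ‖x - y‖) := by
    refine (pi_norm_le_iff_of_nonneg (by positivity)).2 fun j => ?_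
    by_cases hj : j = i
    · subst hj
      exact le_max_of_le_right (by simpa using h.cone x hx y hy)
    · refine le_max_of_le_left ?_
      have := norm_le_pi_norm (x - y + s • (Pi.single i 1 : V3)) j
      simpa [hj] using this
  rcases le_max_iff.1 h1 with h1 | h1
  · exact h1
  · have : 0 ≤ ‖x - y‖ := norm_nonneg _
    have : ‖x - y‖ = 0 := by linarith
    rw [this]; positivity

theorem eq_zero_of_add_mem (h : GraphPatch i M m) {x : V3} {s : ℝ} (hx : x ∈ M)
    (hs : x + s • Pi.single i 1 ∈ M) : s = 0 := by
  have h1 := h.norm_sub_le hs hx (-s)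
  have h2 : x + s • Pi.single i 1 - x = s • (Pi.single i 1 : V3) := by abel
  rw [h2, neg_smul, add_neg_cancel, norm_zero, norm_smul_single] at h1
  exact abs_nonpos_iff.1 h1

theorem height_eq (h : GraphPatch i M m) {u : V3} {t : ℝ} (ht : u - t • Pi.single i 1 ∈ M) :
    height i M u = t := by
  have h1 : foot i M u ∈ M := foot_mem ⟨t, ht⟩
  have h2 : u - t • Pi.single i 1 + (t - height i M u) • Pi.single i 1 = foot i M u := by
    rw [foot, sub_smul]; abel
  rw [← h2] at h1
  linarith [h.eq_zero_of_add_mem ht h1]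

theorem foot_eq (h : GraphPatch i M m) {u : V3} {t : ℝ} (ht : u - t • Pi.single i 1 ∈ M) :
    foot i M u = u - t • Pi.single i 1 := by
  rw [foot, h.height_eq ht]

theorem height_add (h : GraphPatch i M m) {u : V3} (hu : u ∈ tube i M) (s : ℝ) :
    height i M (u + s • Pi.single i 1) = height i M u + s := by
  apply h.height_eq
  convert foot_mem hu using 1
  rw [foot, add_smul]; abel

theorem foot_add (h : GraphPatch i M m) {u : V3} (hu : u ∈ tube i M) (s : ℝ) :
    foot i M (u + s • Pi.single i 1) = foot i M u := by
  rw [foot, h.height_add hu, foot, add_smul]; abel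

theorem mem_tube {x : V3} (hx : x ∈ M) : x ∈ tube i M := ⟨0, by simpa using hx⟩

theorem height_of_mem (h : GraphPatch i M m) {x : V3} (hx : x ∈ M) : height i M x = 0 :=
  h.height_eq (by simpa using hx)

theorem foot_of_mem (h : GraphPatch i M m) {x : V3} (hx : x ∈ M) : foot i M x = x := by
  rw [foot, h.height_of_mem hx]; simp

theorem norm_foot_sub_le (h : GraphPatch i M m) {u v : V3} (hu : u ∈ tube i M)
    (hv : v ∈ tube i M) : ‖foot i M u - foot i M v‖ ≤ ‖u - v‖ := by
  convert h.norm_sub_le (foot_mem hu) (foot_mem hv) (height i M u - height i M v) using 2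
  rw [foot, foot, sub_smul]; abel

theorem abs_height_sub_le (h : GraphPatch i M m) {u v : V3} (hu : u ∈ tube i M)
    (hv : v ∈ tube i M) : |height i M u - height i M v| ≤ 2 * ‖u - v‖ := by
  rw [← norm_smul_single i]
  have : (height i M u - height i M v) • (Pi.single i 1 : V3) =
      (u - v) - (foot i M u - foot i M v) := by
    rw [foot, foot, sub_smul]; abel
  rw [this]
  linarith [_root_.norm_sub_le (u - v) (foot i M u - foot i M v), h.norm_foot_sub_le hu hv]

theorem continuousOn_foot (h : GraphPatch i M m) : ContinuousOn (foot i M) (tube i M) := by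
  have : LipschitzOnWith 1 (foot i M) (tube i M) :=
    LipschitzOnWith.of_dist_le_mul fun u hu v hv => by
      simpa [dist_eq_norm] using h.norm_foot_sub_le hu hv
  exact this.continuousOn

theorem continuousOn_height (h : GraphPatch i M m) : ContinuousOn (height i M) (tube i M) := by
  have : LipschitzOnWith 2 (height i M) (tube i M) :=
    LipschitzOnWith.of_dist_le_mul fun u hu v hv => by
      simpa [dist_eq_norm] using h.abs_height_sub_le hu hv
  exact this.continuousOn

theorem measurable_height (h : GraphPatch i M m) : Measurable (height i M) := by
  classical
  have h0 : height i M = (tube i M).piecewise (height i M) 0 := by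
    ext u
    by_cases hu : u ∈ tube i M
    · simp [hu]
    · simp [hu, height]
  rw [h0]
  exact h.continuousOn_height.measurable_piecewise continuousOn_const
    h.isOpen_tube.measurableSet

theorem measurable_foot (h : GraphPatch i M m) : Measurable (foot i M) :=
  measurable_id.sub (h.measurable_height.smul_const _)

theorem measurableSet (h : GraphPatch i M m) : MeasurableSet M := by
  have : M = tube i M ∩ height i M ⁻¹' {0} := by
    ext x
    refine ⟨fun hx => ⟨mem_tube hx, h.height_of_mem hx⟩, fun ⟨hx, hx0⟩ => ?_⟩
    have := foot_mem hx
    rw [Set.mem_preimage, Set.mem_singleton_iff] at hx0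
    simpa [foot, hx0] using this
  rw [this]
  exact h.isOpen_tube.measurableSet.inter (h.measurable_height (measurableSet_singleton 0))

/-- A displacement of `u` splits into the displacement of the foot and the change of height times `e
i`. Pairing with the conormal, whose `i`-th entry is 1, returns the change of height up to the term
from the foot, which is negligible by flatness of `M`. -/
theorem hasFDerivAt_height (h : GraphPatch i M m) {u : V3} (hu : u ∈ tube i M) :
    HasFDerivAt (height i M) (dotCLM (m (foot i M u))) u := by
  have hp := foot_mem hu
  have hn := h.isOpen_tube.mem_nhds hu
  have ht : Filter.Tendsto (foot i M) (𝓝 u) (𝓝[M] (foot i M u)) := by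
    refine tendsto_nhdsWithin_iff.2 ⟨(h.continuousOn_foot.continuousAt hn), ?_⟩
    filter_upwards [hn] with v hv using foot_mem hv
  have h1 := (h.flat _ hp).comp_tendsto ht
  have h2 : (fun v => foot i M v - foot i M u) =O[𝓝 u] (fun v => v - u) := by
    refine Asymptotics.IsBigO.of_bound 1 ?_
    filter_upwards [hn] with v hv
    simpa using h.norm_foot_sub_le hv hu
  rw [hasFDerivAt_iff_isLittleO]
  refine ((h1.neg_left).trans_isBigO h2).congr' ?_ (by rfl)
  filter_upwards [hn] with v hv
  have h3 : v - u = (foot i M v - foot i M u) +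
      (height i M v - height i M u) • Pi.single i 1 := by
    rw [foot, foot, sub_smul]; abel
  rw [dotCLM_apply, h3, dotProduct_add, dotProduct_smul, dotProduct_single,
    h.conormal_self _ hp]
  simp [Function.comp]

end GraphPatch

/-! ### Integration over a graph by thickening it -/

/-- The surface measure `λ` of a graph `x i = φ` relative to Lebesgue measure in the other two
coordinates. -/
noncomputable def graphMeasure (i : Fin 3) (M : Set V3) : Measure V3 :=
  (volume.restrict (tube i M ∩ height i M ⁻¹' Set.Ico 0 1)).map (foot i M)

instance (i : Fin 3) (M : Set V3) : SFinite (graphMeasure i M) := by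
  unfold graphMeasure; infer_instance

namespace GraphPatch

variable {i : Fin 3} {M : Set V3} {m : V3 → V3}

theorem measurableSet_slab (h : GraphPatch i M m) :
    MeasurableSet (tube i M ∩ height i M ⁻¹' Set.Ico 0 1) :=
  h.isOpen_tube.measurableSet.inter (h.measurable_height measurableSet_Ico)

theorem lintegral_graphMeasure (h : GraphPatch i M m) {f : V3 → ENNReal} (hf : Measurable f) :
    ∫⁻ x, f x ∂(graphMeasure i M) =
      ∫⁻ u in tube i M, (Set.Ico (0 : ℝ) 1).indicator 1 (height i M u) * f (foot i M u) := by
  rw [graphMeasure, lintegral_map hf h.measurable_foot, ← lintegral_indicator h.measurableSet_slab,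
    ← lintegral_indicator h.isOpen_tube.measurableSet]
  refine lintegral_congr fun u => ?_
  by_cases h1 : u ∈ tube i M <;> by_cases h2 : height i M u ∈ Set.Ico (0 : ℝ) 1
  · rw [Set.indicator_of_mem (Set.mem_inter h1 h2), Set.indicator_of_mem h1, Set.indicator_of_mem h2]; simp
  · rw [Set.indicator_of_notMem (fun h => h2 h.2), Set.indicator_of_mem h1,
      Set.indicator_of_notMem h2]; simp
  · rw [Set.indicator_of_notMem (fun h => h1 h.1), Set.indicator_of_notMem h1]
  · rw [Set.indicator_of_notMem (fun h => h1 h.1), Set.indicator_of_notMem h1]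

theorem ae_mem (h : GraphPatch i M m) : ∀ᵐ x ∂(graphMeasure i M), x ∈ M := by
  refine (ae_map_iff h.measurable_foot.aemeasurable h.measurableSet).2 ?_
  filter_upwards [ae_restrict_mem h.measurableSet_slab] with u hu using foot_mem hu.1

theorem setLIntegral_shift (s : ℝ) (f : V3 → ENNReal) :
    ∫⁻ u in tube i M, f (u + s • Pi.single i 1) = ∫⁻ u in tube i M, f u := by
  have e := measurePreserving_add_right (volume : Measure V3) (s • Pi.single i 1)
  have he := (Homeomorph.addRight (s • (Pi.single i 1 : V3))).measurableEmbedding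
  rw [← e.setLIntegral_comp_preimage_emb he f (tube i M)]
  congr 2
  ext u
  exact (tube_add_smul s).symm

/-- Integration over the thickened graph, in the coordinates `(height, foot)`. -/
theorem setLIntegral_height_foot (h : GraphPatch i M m) {G : ℝ → ENNReal} {f : V3 → ENNReal}
    (hG : Measurable G) (hf : Measurable f) :
    ∫⁻ u in tube i M, G (height i M u) * f (foot i M u) =
      (∫⁻ s, G s) * ∫⁻ x, f x ∂(graphMeasure i M) := by
  have hh := h.measurable_height
  have hff := hf.comp h.measurable_foot
  set I : ℝ → ENNReal := (Set.Ico (0 : ℝ) 1).indicator 1 with hI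
  have hIm : Measurable I := measurable_one.indicator measurableSet_Ico
  have hIi (t : ℝ) : ∫⁻ s, I (t + -s) = 1 := by
    have h1 : (fun s : ℝ => I (t + -s)) = (Set.Ioc (t - 1) t).indicator 1 := by
      ext s
      simp only [hI, Set.indicator_apply, Set.mem_Ico, Set.mem_Ioc]
      congr 1
      apply propext
      constructor <;> rintro ⟨h1, h2⟩ <;> constructor <;> linarith
    rw [h1, lintegral_indicator_one measurableSet_Ioc]
    simp
  -- Insert `1 = ∫ I (height u - s) ds`, exchange the integrals, and translate `u` by `s` along `e
  -- i`. This leaves the foot unchanged and raises the height by `s`, so the integral over `s`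
  -- decouples.
  calc ∫⁻ u in tube i M, G (height i M u) * f (foot i M u)
      = ∫⁻ u in tube i M, ∫⁻ s, G (height i M u) * f (foot i M u) * I (height i M u + -s) := by
        refine lintegral_congr fun u => ?_
        rw [lintegral_const_mul _ (by fun_prop), hIi, mul_one]
    _ = ∫⁻ s, ∫⁻ u in tube i M,
          G (height i M u) * f (foot i M u) * I (height i M u + -s) := by
        rw [lintegral_lintegral_swap]
        have : Measurable (Function.uncurry fun (u : V3) (s : ℝ) =>
            G (height i M u) * f (foot i M u) * I (height i M u + -s)) := by
          apply Measurable.mul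
          · exact ((hG.comp hh).mul hff).comp measurable_fst
          · exact hIm.comp ((hh.comp measurable_fst).add measurable_snd.neg)
        exact this.aemeasurable
    _ = ∫⁻ s, ∫⁻ u in tube i M, G (height i M u + s) * f (foot i M u) * I (height i M u) := by
        refine lintegral_congr fun s => ?_
        rw [← setLIntegral_shift s]
        refine setLIntegral_congr_fun h.isOpen_tube.measurableSet fun u hu => ?_
        simp only [h.height_add hu, h.foot_add hu]
        congr 2; ring
    _ = ∫⁻ u in tube i M, ∫⁻ s, G (height i M u + s) * f (foot i M u) * I (height i M u) := by
        rw [lintegral_lintegral_swap]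
        have : Measurable (Function.uncurry fun (s : ℝ) (u : V3) =>
            G (height i M u + s) * f (foot i M u) * I (height i M u)) := by
          refine (Measurable.mul ?_ (hff.comp measurable_snd)).mul
            ((hIm.comp hh).comp measurable_snd)
          exact hG.comp ((hh.comp measurable_snd).add measurable_fst)
        exact this.aemeasurable
    _ = ∫⁻ u in tube i M, (∫⁻ s, G s) * (I (height i M u) * f (foot i M u)) := by
        refine lintegral_congr fun u => ?_
        simp_rw [mul_assoc]
        rw [lintegral_mul_const _ (by fun_prop), lintegral_add_left_eq_self G, mul_comm (f _)]
    _ = _ := by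
        rw [lintegral_const_mul _ (by exact (hIm.comp hh).mul hff), ← h.lintegral_graphMeasure hf]

end GraphPatch

/-! ### Tonelli and change of variables in three-space -/

/-- Tonelli's theorem in coordinates. -/
theorem lintegral_fin_three {f : V3 → ENNReal} (hf : Measurable f) :
    ∫⁻ p, f p = ∫⁻ a, ∫⁻ b, ∫⁻ c, f ![a, b, c] := by
  have h1 := (volume_preserving_piFinSuccAbove (fun _ : Fin 3 => ℝ) 0).symm
  have h2 := (volume_preserving_finTwoArrow ℝ).symm
  rw [← h1.lintegral_comp hf, Measure.volume_eq_prod, lintegral_prod _ (by fun_prop)]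
  refine lintegral_congr fun a => ?_
  rw [← h2.lintegral_comp (by fun_prop), Measure.volume_eq_prod, lintegral_prod _ (by fun_prop)]
  refine lintegral_congr fun b => lintegral_congr fun c => ?_
  congr 1
  ext j
  fin_cases j <;> rfl

theorem det_pi_dotCLM (r : Fin 3 → V3) :
    (ContinuousLinearMap.pi fun j => dotCLM (r j)).det = (Matrix.of r).det := by
  rw [← LinearMap.det_toLin', ContinuousLinearMap.det]
  congr 1

/-- The change of variables formula for a map of three-space whose components have the rows of
`r` as gradients. -/
theorem lintegral_image_rows {s : Set V3} (hs : MeasurableSet s) {Ψ : V3 → V3}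
    {r : V3 → Fin 3 → V3}
    (hΨ : ∀ u ∈ s, ∀ j, HasFDerivAt (fun u => Ψ u j) (dotCLM (r u j)) u) (hi : Set.InjOn Ψ s)
    (f : V3 → ENNReal) :
    ∫⁻ p in Ψ '' s, f p = ∫⁻ u in s, ENNReal.ofReal |(Matrix.of (r u)).det| * f (Ψ u) := by
  have h (u) (hu : u ∈ s) : HasFDerivWithinAt Ψ
      (ContinuousLinearMap.pi fun j => dotCLM (r u j)) s u :=
    (hasFDerivAt_pi.2 (hΨ u hu)).hasFDerivWithinAt
  rw [lintegral_image_eq_lintegral_abs_det_fderiv_mul _ hs h hi]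
  simp_rw [det_pi_dotCLM]

theorem measurableSet_image_rows {s : Set V3} (hs : MeasurableSet s) {Ψ : V3 → V3}
    {r : V3 → Fin 3 → V3}
    (hΨ : ∀ u ∈ s, ∀ j, HasFDerivAt (fun u => Ψ u j) (dotCLM (r u j)) u) (hi : Set.InjOn Ψ s) :
    MeasurableSet (Ψ '' s) := by
  have h (u) (hu : u ∈ s) : HasFDerivWithinAt Ψ
      (ContinuousLinearMap.pi fun j => dotCLM (r u j)) s u :=
    (hasFDerivAt_pi.2 (hΨ u hu)).hasFDerivWithinAt
  exact measurable_image_of_fderivWithin hs h hi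

/-! ### The sum map on a pair of transversal graphs -/

/-- The Jacobian determinant of `(x, y) ↦ (x 2, x + y)` on a pair of graphs. -/
def pairJacobian (m₀ m₁ : V3 → V3) (p : V3 × V3) : ℝ := 1 - m₀ p.1 1 * m₁ p.2 0

/-- The image of `M₀ ×ˢ M₁` under `(x, y) ↦ (x 2, x + y)`. -/
def pairRegion (M₀ M₁ : Set V3) : Set (ℝ × V3) :=
  {p | ∃ x, x ∈ M₀ ∧ p.2 - x ∈ M₁ ∧ x 2 = p.1}

open Classical in
/-- The inverse of `(x, y) ↦ (x 2, x + y)` on `M₀ ×ˢ M₁`. -/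
noncomputable def pairInv (M₀ M₁ : Set V3) (p : ℝ × V3) : V3 × V3 :=
  if h : p ∈ pairRegion M₀ M₁ then (h.choose, p.2 - h.choose) else 0

section pair

variable {M₀ M₁ : Set V3} {m₀ m₁ : V3 → V3}

theorem pairInv_mem {p : ℝ × V3} (hp : p ∈ pairRegion M₀ M₁) :
    (pairInv M₀ M₁ p).1 ∈ M₀ ∧ (pairInv M₀ M₁ p).2 ∈ M₁ := by
  rw [pairInv, dif_pos hp]
  exact ⟨hp.choose_spec.1, hp.choose_spec.2.1⟩

theorem pairInv_spec {p : ℝ × V3} (hp : p ∈ pairRegion M₀ M₁) :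
    (pairInv M₀ M₁ p).1 2 = p.1 ∧ (pairInv M₀ M₁ p).1 + (pairInv M₀ M₁ p).2 = p.2 := by
  rw [pairInv, dif_pos hp]
  exact ⟨hp.choose_spec.2.2, by simp⟩

theorem mem_pairRegion {x y : V3} (hx : x ∈ M₀) (hy : y ∈ M₁) :
    (x 2, x + y) ∈ pairRegion M₀ M₁ := ⟨x, hx, by simpa using hy, rfl⟩

theorem abs_one_sub_pairJacobian_le (h₀ : GraphPatch 0 M₀ m₀) (h₁ : GraphPatch 1 M₁ m₁)
    {p : V3 × V3} (hp : p ∈ M₀ ×ˢ M₁) : 15 / 16 ≤ pairJacobian m₀ m₁ p := by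
  have a := h₀.conormal_le _ hp.1 1 (by decide)
  have b := h₁.conormal_le _ hp.2 0 (by decide)
  have c : |m₀ p.1 1 * m₁ p.2 0| ≤ 1 / 4 * (1 / 4) := by
    rw [abs_mul]; gcongr
  have := (abs_le.1 c).2
  unfold pairJacobian
  linarith

/-- Quantitative injectivity of `(x, y) ↦ (x 2, x + y)`. For `x - x'`, coordinate 0 is controlled by
the cone condition on `M₀`, coordinate 1 by that on `M₁` applied to `y - y'`, and coordinate 2 is
given; the multiple of `‖x - x'‖` that arises has factor 1/8 and is absorbed. -/
theorem norm_sub_le_of_pair (h₀ : GraphPatch 0 M₀ m₀) (h₁ : GraphPatch 1 M₁ m₁)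
    {x x' y y' : V3} (hx : x ∈ M₀) (hx' : x' ∈ M₀) (hy : y ∈ M₁) (hy' : y' ∈ M₁) :
    ‖x - x'‖ ≤ 2 * ‖x + y - (x' + y')‖ + 2 * |x 2 - x' 2| := by
  have a := h₀.cone x hx x' hx'
  have b := h₁.cone y hy y' hy'
  have e : y - y' = (x + y - (x' + y')) - (x - x') := by abel
  have c : ‖y - y'‖ ≤ ‖x + y - (x' + y')‖ + ‖x - x'‖ := by rw [e]; exact norm_sub_le _ _
  have d := norm_le_pi_norm (x + y - (x' + y')) 1
  set Z := ‖x + y - (x' + y')‖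
  have key : ‖x - x'‖ ≤ 9 / 8 * Z + |x 2 - x' 2| + 1 / 8 * ‖x - x'‖ := by
    refine (pi_norm_le_iff_of_nonneg (by positivity)).2 fun j => ?_
    have hZ : 0 ≤ Z := norm_nonneg _
    have h2 := abs_nonneg (x 2 - x' 2)
    have h3 := norm_nonneg (x - x')
    fin_cases j
    · simp only [Fin.zero_eta, Pi.sub_apply, Real.norm_eq_abs]
      linarith
    · simp only [Fin.mk_one, Pi.sub_apply, Pi.add_apply, Real.norm_eq_abs] at d ⊢
      have : |x 1 - x' 1| ≤ |x 1 + y 1 - (x' 1 + y' 1)| + |y 1 - y' 1| := by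
        have e : x 1 - x' 1 = (x 1 + y 1 - (x' 1 + y' 1)) - (y 1 - y' 1) := by ring
        rw [e]
        exact abs_sub _ _
      linarith
    · simp only [Fin.reduceFinMk, Pi.sub_apply, Real.norm_eq_abs]
      linarith
  have hZ : 0 ≤ Z := norm_nonneg _
  have h2 := abs_nonneg (x 2 - x' 2)
  linarith

theorem pairInv_eq (h₀ : GraphPatch 0 M₀ m₀) (h₁ : GraphPatch 1 M₁ m₁) {x y : V3}
    (hx : x ∈ M₀) (hy : y ∈ M₁) : pairInv M₀ M₁ (x 2, x + y) = (x, y) := by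
  have hp := mem_pairRegion hx hy
  obtain ⟨a, b⟩ := pairInv_mem hp
  obtain ⟨c, d⟩ := pairInv_spec hp
  have := norm_sub_le_of_pair h₀ h₁ a hx b hy
  rw [d, c] at this
  have e : (pairInv M₀ M₁ (x 2, x + y)).1 = x := by
    simpa [sub_eq_zero] using this
  refine Prod.ext e ?_
  rw [e] at d
  simpa using d

theorem continuousOn_pairInv (h₀ : GraphPatch 0 M₀ m₀) (h₁ : GraphPatch 1 M₁ m₁) :
    ContinuousOn (pairInv M₀ M₁) (pairRegion M₀ M₁) := by
  have h1 : ContinuousOn (fun p => (pairInv M₀ M₁ p).1) (pairRegion M₀ M₁) := by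
    have : LipschitzOnWith 4 (fun p => (pairInv M₀ M₁ p).1) (pairRegion M₀ M₁) := by
      refine LipschitzOnWith.of_dist_le_mul fun p hp q hq => ?_
      have := norm_sub_le_of_pair h₀ h₁ (pairInv_mem hp).1 (pairInv_mem hq).1
        (pairInv_mem hp).2 (pairInv_mem hq).2
      rw [(pairInv_spec hp).1, (pairInv_spec hp).2, (pairInv_spec hq).1, (pairInv_spec hq).2]
        at this
      rw [dist_eq_norm, dist_eq_norm]
      have a : ‖p.2 - q.2‖ ≤ ‖p - q‖ := norm_snd_le (p - q)
      have b : |p.1 - q.1| ≤ ‖p - q‖ := norm_fst_le (p - q)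
      have c : ((4 : NNReal) : ℝ) = 4 := rfl
      rw [c]
      linarith
    exact this.continuousOn
  have h2 : ContinuousOn (fun p : ℝ × V3 => ((pairInv M₀ M₁ p).1, p.2 - (pairInv M₀ M₁ p).1))
      (pairRegion M₀ M₁) := h1.prodMk (continuousOn_snd.sub h1)
  refine h2.congr fun p hp => Prod.ext rfl ?_
  simp only
  rw [eq_sub_iff_add_eq', (pairInv_spec hp).2]

theorem GraphPatch.hasStrictFDerivAt_height {i : Fin 3} {M : Set V3} {m : V3 → V3}
    (h : GraphPatch i M m) {x : V3} (hx : x ∈ M) :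
    HasStrictFDerivAt (height i M) (dotCLM (m x)) x := by
  have hn := h.isOpen_tube.mem_nhds (GraphPatch.mem_tube hx)
  have e : dotCLM (m x) = dotCLM (m (foot i M x)) := by rw [h.foot_of_mem hx]
  rw [e]
  refine hasStrictFDerivAt_of_hasFDerivAt_of_continuousAt
    (f' := fun u => dotCLM (m (foot i M u))) ?_ ?_
  · filter_upwards [hn] with u hu using h.hasFDerivAt_height hu
  · have hc : ContinuousOn (fun u => m (foot i M u)) (tube i M) :=
      h.cont.comp h.continuousOn_foot fun u hu => foot_mem hu
    have hd : Continuous dotCLM := by unfold dotCLM; fun_prop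
    exact (hd.comp_continuousOn hc).continuousAt hn

/-- The region is a slice, at both heights equal to zero, of the image of the map `Θ` below. Its
strict derivative is onto, so `Θ` maps neighbourhoods to neighbourhoods, and the nearby values with
both heights zero are attained. -/
theorem isOpen_pairRegion (h₀ : GraphPatch 0 M₀ m₀) (h₁ : GraphPatch 1 M₁ m₁) :
    IsOpen (pairRegion M₀ M₁) := by
  rw [isOpen_iff_mem_nhds]
  intro p hp
  obtain ⟨x, hx, hy, hs⟩ := hp
  set y := p.2 - x with hy'
  let Θ : V3 × V3 → ℝ × ℝ × ℝ × V3 := fun q =>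
    (height 0 M₀ q.1, height 1 M₁ (q.2 - q.1), q.1 2, q.2)
  have d0 : HasStrictFDerivAt (fun q : V3 × V3 => height 0 M₀ q.1)
      ((dotCLM (m₀ x)).comp (ContinuousLinearMap.fst ℝ V3 V3)) (x, p.2) :=
    (h₀.hasStrictFDerivAt_height hx).comp (x, p.2) hasStrictFDerivAt_fst
  have d1 : HasStrictFDerivAt (fun q : V3 × V3 => height 1 M₁ (q.2 - q.1))
      ((dotCLM (m₁ y)).comp (ContinuousLinearMap.snd ℝ V3 V3 - ContinuousLinearMap.fst ℝ V3 V3))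
      (x, p.2) :=
    HasStrictFDerivAt.comp (x, p.2) (f := fun q : V3 × V3 => q.2 - q.1)
      (h₁.hasStrictFDerivAt_height hy) (hasStrictFDerivAt_snd.sub hasStrictFDerivAt_fst)
  have d2 : HasStrictFDerivAt (fun q : V3 × V3 => q.1 2)
      ((ContinuousLinearMap.proj (R := ℝ) (φ := fun _ : Fin 3 => ℝ) 2).comp
        (ContinuousLinearMap.fst ℝ V3 V3)) (x, p.2) :=
    ((ContinuousLinearMap.proj (R := ℝ) (φ := fun _ : Fin 3 => ℝ) 2).comp
        (ContinuousLinearMap.fst ℝ V3 V3)).hasStrictFDerivAt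
  have d3 : HasStrictFDerivAt (fun q : V3 × V3 => q.2)
      (ContinuousLinearMap.snd ℝ V3 V3) (x, p.2) := hasStrictFDerivAt_snd
  have d : HasStrictFDerivAt Θ _ (x, p.2) := d0.prodMk (d1.prodMk (d2.prodMk d3))
  have hD := abs_one_sub_pairJacobian_le h₀ h₁ (p := (x, y)) ⟨hx, hy⟩
  have hsurj : Function.Surjective
      (((dotCLM (m₀ x)).comp (ContinuousLinearMap.fst ℝ V3 V3)).prod
      (((dotCLM (m₁ y)).comp
        (ContinuousLinearMap.snd ℝ V3 V3 - ContinuousLinearMap.fst ℝ V3 V3)).prod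
      (((ContinuousLinearMap.proj (R := ℝ) (φ := fun _ : Fin 3 => ℝ) 2).comp
        (ContinuousLinearMap.fst ℝ V3 V3)).prod (ContinuousLinearMap.snd ℝ V3 V3)))) := by
    rintro ⟨α, β, σ, ζ⟩
    have hD0 : 1 - m₀ x 1 * m₁ y 0 ≠ 0 := by
      unfold pairJacobian at hD; simp only at hD; linarith
    -- With the coordinate `σ` and the sum `ζ` prescribed, two unknown coordinates of `x` remain.
    -- They solve a two-by-two linear system whose determinant is the pair Jacobian; the witness is
    -- Cramer's rule.
    set A := α - m₀ x 2 * σ with hA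
    set B := m₁ y ⬝ᵥ ζ - β - m₁ y 2 * σ with hB
    refine ⟨(![(A - m₀ x 1 * B) / (1 - m₀ x 1 * m₁ y 0),
      (B - m₁ y 0 * A) / (1 - m₀ x 1 * m₁ y 0), σ], ζ), ?_⟩
    have e0 := h₀.conormal_self x hx
    have e1 := h₁.conormal_self y hy
    simp only [ContinuousLinearMap.prod_apply, ContinuousLinearMap.comp_apply,
      sub_apply, ContinuousLinearMap.coe_fst', ContinuousLinearMap.coe_snd',
      dotCLM_apply, ContinuousLinearMap.proj_apply, dotProduct_sub, Prod.mk.injEq]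
    refine ⟨?_, ?_, rfl, trivial⟩
    · have hα : α = A + m₀ x 2 * σ := by rw [hA]; ring
      rw [hα]
      simp only [dotProduct, Fin.sum_univ_three, e0, Matrix.cons_val_zero, Matrix.cons_val_one,
        Matrix.cons_val]
      generalize hE : 1 - m₀ x 1 * m₁ y 0 = D at *
      field_simp
      linear_combination A * hE
    · have hB' : m₁ y ⬝ᵥ ζ = B + β + m₁ y 2 * σ := by rw [hB]; ring
      rw [hB']
      simp only [dotProduct, Fin.sum_univ_three, e1, Matrix.cons_val_zero, Matrix.cons_val_one,
        Matrix.cons_val]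
      generalize hE : 1 - m₀ x 1 * m₁ y 0 = D at *
      field_simp
      linear_combination -B * hE
  have hmap := d.map_nhds_eq_of_surj (LinearMap.range_eq_top.2 hsurj)
  have hΘ : Θ (x, p.2) = (0, 0, p.1, p.2) := by
    simp only [Θ]
    rw [h₀.height_of_mem hx, ← hy', h₁.height_of_mem hy, hs]
  have hN : {q : V3 × V3 | q.1 ∈ tube 0 M₀ ∧ q.2 - q.1 ∈ tube 1 M₁} ∈ 𝓝 (x, p.2) := by
    refine IsOpen.mem_nhds ?_ ⟨GraphPatch.mem_tube hx, GraphPatch.mem_tube hy⟩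
    exact (h₀.isOpen_tube.preimage continuous_fst).inter
      (h₁.isOpen_tube.preimage (continuous_snd.sub continuous_fst))
  have hI := Filter.image_mem_map (m := Θ) hN
  rw [hmap, hΘ] at hI
  have hc : Filter.Tendsto (fun r : ℝ × V3 => ((0 : ℝ), (0 : ℝ), r.1, r.2)) (𝓝 p)
      (𝓝 (0, 0, p.1, p.2)) := Continuous.tendsto (by fun_prop) p
  filter_upwards [hc hI] with r hr
  obtain ⟨q, ⟨hq0, hq1⟩, hq⟩ := hr
  simp only [Θ, Prod.mk.injEq] at hq
  obtain ⟨a, b, c, d⟩ := hq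
  refine ⟨q.1, ?_, ?_, c⟩
  · have := foot_mem hq0
    simpa [foot, a] using this
  · have := foot_mem hq1
    rw [← d]
    simpa [foot, b] using this

end pair

section pair

variable {M₀ M₁ : Set V3} {m₀ m₁ : V3 → V3}

/-- The points `u` for which `(u, z - u)` lies in the product of the two tubes. -/
def pairFiber (M₀ M₁ : Set V3) (z : V3) : Set V3 := {u | u ∈ tube 0 M₀ ∧ z - u ∈ tube 1 M₁}

/-- The composition of `K` with the inverse of `(x, y) ↦ (x 2, x + y)`, extended by zero. -/
noncomputable def pairPush {R : Type*} [Zero R] (M₀ M₁ : Set V3) (K : V3 × V3 → R) (p : ℝ × V3) :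
    R :=
  (pairRegion M₀ M₁).indicator (K ∘ pairInv M₀ M₁) p

theorem measurableSet_pairFiber (h₀ : GraphPatch 0 M₀ m₀) (h₁ : GraphPatch 1 M₁ m₁) (z : V3) :
    MeasurableSet (pairFiber M₀ M₁ z) :=
  (h₀.isOpen_tube.inter (h₁.isOpen_tube.preimage (continuous_const.sub continuous_id))).measurableSet

theorem det_rows_two (a b : V3) (ha : a 0 = 1) (hb : b 1 = 1) :
    (Matrix.of ![a, -b, Pi.single 2 1]).det = -(1 - a 1 * b 0) := by
  rw [Matrix.det_fin_three]
  simp [ha, hb]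
  ring

/-- The map `u ↦ (height u, height (z - u), u 2)`. -/
noncomputable def pairCoord (M₀ M₁ : Set V3) (z u : V3) : V3 :=
  ![height 0 M₀ u, height 1 M₁ (z - u), u 2]

theorem hasFDerivAt_pairCoord (h₀ : GraphPatch 0 M₀ m₀) (h₁ : GraphPatch 1 M₁ m₁) {z u : V3}
    (hu : u ∈ pairFiber M₀ M₁ z) (j : Fin 3) :
    HasFDerivAt (fun u => pairCoord M₀ M₁ z u j)
      (dotCLM (![m₀ (foot 0 M₀ u), -m₁ (foot 1 M₁ (z - u)), Pi.single 2 1] j)) u := by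
  fin_cases j
  · exact h₀.hasFDerivAt_height hu.1
  · have h2 : HasFDerivAt (fun u : V3 => z - u) (-ContinuousLinearMap.id ℝ V3) u :=
      (hasFDerivAt_id u).const_sub z
    exact ((h₁.hasFDerivAt_height hu.2).comp u h2).congr_fderiv
      (ContinuousLinearMap.ext fun x => by simp [dotCLM_apply])
  · exact (ContinuousLinearMap.proj (R := ℝ) (φ := fun _ : Fin 3 => ℝ) 2).hasFDerivAt.congr_fderiv
      (ContinuousLinearMap.ext fun x => by simp [dotCLM_apply])

theorem foot_pairCoord {z u : V3} :
    foot 0 M₀ u + foot 1 M₁ (z - u) =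
      z - pairCoord M₀ M₁ z u 0 • Pi.single 0 1 - pairCoord M₀ M₁ z u 1 • Pi.single 1 1 := by
  simp only [foot, pairCoord, Matrix.cons_val_zero, Matrix.cons_val_one]
  abel

theorem foot_pairCoord_two {z u : V3} : foot 0 M₀ u 2 = pairCoord M₀ M₁ z u 2 := by
  simp [foot, pairCoord]

theorem injOn_pairCoord (h₀ : GraphPatch 0 M₀ m₀) (h₁ : GraphPatch 1 M₁ m₁) (z : V3) :
    Set.InjOn (pairCoord M₀ M₁ z) (pairFiber M₀ M₁ z) := by
  intro u hu v hv huv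
  have := norm_sub_le_of_pair h₀ h₁ (foot_mem hu.1) (foot_mem hv.1) (foot_mem hu.2) (foot_mem hv.2)
  rw [foot_pairCoord, foot_pairCoord, foot_pairCoord_two (M₁ := M₁) (z := z),
    foot_pairCoord_two (M₁ := M₁) (z := z), huv] at this
  have e : foot 0 M₀ u = foot 0 M₀ v := by simpa [sub_eq_zero] using this
  have e0 : height 0 M₀ u = height 0 M₀ v := congrFun huv 0
  rw [← foot_add_height 0 M₀ u, e, e0, foot_add_height]

theorem mem_image_pairCoord (h₀ : GraphPatch 0 M₀ m₀) (h₁ : GraphPatch 1 M₁ m₁) (z p : V3) :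
    p ∈ pairCoord M₀ M₁ z '' pairFiber M₀ M₁ z ↔
      (p 2, z - p 0 • Pi.single 0 1 - p 1 • Pi.single 1 1) ∈ pairRegion M₀ M₁ := by
  constructor
  · rintro ⟨u, hu, rfl⟩
    have := mem_pairRegion (foot_mem hu.1) (foot_mem hu.2)
    rwa [foot_pairCoord, foot_pairCoord_two (M₁ := M₁) (z := z)] at this
  · rintro ⟨x, hx, hy, hs⟩
    have hx' : x + p 0 • Pi.single 0 1 - p 0 • Pi.single 0 1 ∈ M₀ := by simpa using hx
    have hy' : z - (x + p 0 • Pi.single 0 1) - p 1 • Pi.single 1 1 ∈ M₁ := by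
      convert hy using 1
      simp only
      abel
    refine ⟨x + p 0 • Pi.single 0 1, ⟨⟨_, hx'⟩, ⟨_, hy'⟩⟩, ?_⟩
    ext j
    fin_cases j
    · exact h₀.height_eq hx'
    · exact h₁.height_eq hy'
    · simpa [pairCoord] using hs

/-- The change of variables `u ↦ (height u, height (z - u), u 2)`. -/
theorem setLIntegral_pairFiber (h₀ : GraphPatch 0 M₀ m₀) (h₁ : GraphPatch 1 M₁ m₁) (z : V3)
    (G : ℝ → ℝ → ENNReal) (K : V3 × V3 → ENNReal) :
    ∫⁻ u in pairFiber M₀ M₁ z, G (height 0 M₀ u) (height 1 M₁ (z - u)) *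
        (ENNReal.ofReal (pairJacobian m₀ m₁ (foot 0 M₀ u, foot 1 M₁ (z - u))) *
          K (foot 0 M₀ u, foot 1 M₁ (z - u))) =
      ∫⁻ p : V3, G (p 0) (p 1) *
        pairPush M₀ M₁ K (p 2, z - p 0 • Pi.single 0 1 - p 1 • Pi.single 1 1) := by
  have hs := measurableSet_pairFiber h₀ h₁ z
  have hΨ := fun u (hu : u ∈ pairFiber M₀ M₁ z) => hasFDerivAt_pairCoord h₀ h₁ hu
  have hi := injOn_pairCoord h₀ h₁ z
  have h1 := lintegral_image_rows hs hΨ hi fun p => G (p 0) (p 1) *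
        pairPush M₀ M₁ K (p 2, z - p 0 • Pi.single 0 1 - p 1 • Pi.single 1 1)
  rw [← lintegral_indicator (measurableSet_image_rows hs hΨ hi)] at h1
  have h2 : ∀ p : V3, (pairCoord M₀ M₁ z '' pairFiber M₀ M₁ z).indicator
      (fun p => G (p 0) (p 1) *
        pairPush M₀ M₁ K (p 2, z - p 0 • Pi.single 0 1 - p 1 • Pi.single 1 1)) p =
      G (p 0) (p 1) * pairPush M₀ M₁ K (p 2, z - p 0 • Pi.single 0 1 - p 1 • Pi.single 1 1) := by
    intro p
    by_cases hp : p ∈ pairCoord M₀ M₁ z '' pairFiber M₀ M₁ z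
    · rw [Set.indicator_of_mem hp]
    · rw [Set.indicator_of_notMem hp, pairPush, Set.indicator_of_notMem, mul_zero]
      rwa [← mem_image_pairCoord h₀ h₁]
  simp_rw [h2] at h1
  rw [h1]
  refine setLIntegral_congr_fun hs fun u hu => ?_
  have hx := foot_mem hu.1
  have hy := foot_mem hu.2
  have h3 : pairPush M₀ M₁ K (pairCoord M₀ M₁ z u 2,
      z - pairCoord M₀ M₁ z u 0 • Pi.single 0 1 - pairCoord M₀ M₁ z u 1 • Pi.single 1 1) =
      K (foot 0 M₀ u, foot 1 M₁ (z - u)) := by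
    rw [← foot_pairCoord, ← foot_pairCoord_two, pairPush,
      Set.indicator_of_mem (mem_pairRegion hx hy), Function.comp, pairInv_eq h₀ h₁ hx hy]
  rw [h3, det_rows_two _ _ (h₀.conormal_self _ hx) (h₁.conormal_self _ hy), abs_neg,
    abs_of_nonneg (a := 1 - _)]
  · simp only [pairJacobian, pairCoord, Matrix.cons_val_zero, Matrix.cons_val_one]
    ring
  · have := abs_one_sub_pairJacobian_le h₀ h₁ (p := (foot 0 M₀ u, foot 1 M₁ (z - u))) ⟨hx, hy⟩
    unfold pairJacobian at this
    simp only at this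
    linarith

theorem measurable_pairPush (h₀ : GraphPatch 0 M₀ m₀) (h₁ : GraphPatch 1 M₁ m₁)
    {K : V3 × V3 → ENNReal} (hK : Measurable K) : Measurable (pairPush M₀ M₁ K) := by
  classical
  have hE := (isOpen_pairRegion h₀ h₁).measurableSet
  have h1 : pairInv M₀ M₁ = (pairRegion M₀ M₁).piecewise (pairInv M₀ M₁) 0 := by
    ext1 p
    by_cases hp : p ∈ pairRegion M₀ M₁
    · simp [hp]
    · rw [Set.piecewise_eq_of_notMem _ _ _ hp, pairInv, dif_neg hp]; rfl
  have h2 : Measurable (pairInv M₀ M₁) := by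
    rw [h1]
    exact (continuousOn_pairInv h₀ h₁).measurable_piecewise continuousOn_const hE
  exact (hK.comp h2).indicator hE

/-- Integration over a product of two graphs, in the coordinates `(x 2, x + y)`. -/
theorem lintegral_prod_graphMeasure (h₀ : GraphPatch 0 M₀ m₀) (h₁ : GraphPatch 1 M₁ m₁)
    {K : V3 × V3 → ENNReal} (hK : Measurable K) {J : V3 × V3 → ENNReal} (hJ : Measurable J)
    (hJ' : ∀ p ∈ M₀ ×ˢ M₁, J p = ENNReal.ofReal (pairJacobian m₀ m₁ p)) :
    ∫⁻ p, J p * K p ∂((graphMeasure 0 M₀).prod (graphMeasure 1 M₁)) =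
      ∫⁻ q : ℝ × V3, pairPush M₀ M₁ K q := by
  have hf₀ := h₀.measurable_foot
  have hf₁ := h₁.measurable_foot
  have ht₀ := h₀.measurable_height
  have ht₁ := h₁.measurable_height
  set I : ℝ → ENNReal := (Set.Ico (0 : ℝ) 1).indicator 1 with hI
  have hIm : Measurable I := measurable_one.indicator measurableSet_Ico
  have hI1 : ∫⁻ s, I s = 1 := by
    rw [hI, lintegral_indicator_one measurableSet_Ico]; simp
  have hKJ : Measurable fun p => J p * K p := hJ.mul hK
  have hP := measurable_pairPush h₀ h₁ hK
  -- Both graph measures are written as Lebesgue measure on slabs. With `z` the sum of the two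
  -- variables, the change of variables at fixed `z` produces the two heights and `u 2`; translating
  -- `z` afterwards removes the heights, whose indicators have integral one.
  have step1 : ∫⁻ p, J p * K p ∂((graphMeasure 0 M₀).prod (graphMeasure 1 M₁)) =
      ∫⁻ u in tube 0 M₀, ∫⁻ v in tube 1 M₁, I (height 0 M₀ u) * (I (height 1 M₁ v) *
        (J (foot 0 M₀ u, foot 1 M₁ v) * K (foot 0 M₀ u, foot 1 M₁ v))) := by
    rw [lintegral_prod _ hKJ.aemeasurable,
      h₀.lintegral_graphMeasure (f := fun x => ∫⁻ y, J (x, y) * K (x, y) ∂(graphMeasure 1 M₁))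
        hKJ.lintegral_prod_right']
    refine lintegral_congr fun u => ?_
    have hm := hKJ.comp (measurable_prodMk_left (x := foot 0 M₀ u))
    have h2 := h₁.lintegral_graphMeasure (f := fun y => J (foot 0 M₀ u, y) * K (foot 0 M₀ u, y)) hm
    rw [h2, ← lintegral_const_mul]
    exact (hIm.comp ht₁).mul (hm.comp hf₁)
  let Φ : V3 → V3 → ENNReal := fun u v => (tube 0 M₀).indicator 1 u * ((tube 1 M₁).indicator 1 v *
    (I (height 0 M₀ u) * (I (height 1 M₁ v) *
        (J (foot 0 M₀ u, foot 1 M₁ v) * K (foot 0 M₀ u, foot 1 M₁ v)))))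
  have hΦ : Measurable (Function.uncurry Φ) := by
    have a0 : Measurable ((tube 0 M₀).indicator (1 : V3 → ENNReal)) :=
      measurable_one.indicator h₀.isOpen_tube.measurableSet
    have a1 : Measurable ((tube 1 M₁).indicator (1 : V3 → ENNReal)) :=
      measurable_one.indicator h₁.isOpen_tube.measurableSet
    refine (a0.comp measurable_fst).mul ((a1.comp measurable_snd).mul
      (((hIm.comp ht₀).comp measurable_fst).mul (((hIm.comp ht₁).comp measurable_snd).mul ?_)))
    exact hKJ.comp ((hf₀.comp measurable_fst).prodMk (hf₁.comp measurable_snd))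
  have step2 : ∫⁻ u in tube 0 M₀, ∫⁻ v in tube 1 M₁, I (height 0 M₀ u) * (I (height 1 M₁ v) *
        (J (foot 0 M₀ u, foot 1 M₁ v) * K (foot 0 M₀ u, foot 1 M₁ v))) =
      ∫⁻ u, ∫⁻ v, Φ u v := by
    rw [← lintegral_indicator h₀.isOpen_tube.measurableSet]
    refine lintegral_congr fun u => ?_
    by_cases hu : u ∈ tube 0 M₀
    · rw [Set.indicator_of_mem hu, ← lintegral_indicator h₁.isOpen_tube.measurableSet]
      refine lintegral_congr fun v => ?_
      by_cases hv : v ∈ tube 1 M₁ <;> simp [Φ, hu, hv]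
    · simp [Φ, hu]
  have step3 : ∫⁻ u, ∫⁻ v, Φ u v = ∫⁻ z, ∫⁻ u, Φ u (z - u) := by
    rw [← lintegral_lintegral_swap (f := fun u z => Φ u (z - u))]
    · exact lintegral_congr fun u => (lintegral_sub_right_eq_self (Φ u) u).symm
    · exact (hΦ.comp (measurable_fst.prodMk (measurable_snd.sub measurable_fst))).aemeasurable
  have step4 (z : V3) : ∫⁻ u, Φ u (z - u) = ∫⁻ p : V3, I (p 0) * I (p 1) *
        pairPush M₀ M₁ K (p 2, z - p 0 • Pi.single 0 1 - p 1 • Pi.single 1 1) := by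
    rw [← setLIntegral_pairFiber h₀ h₁ z (fun a b => I a * I b) K,
      ← lintegral_indicator (measurableSet_pairFiber h₀ h₁ z)]
    refine lintegral_congr fun u => ?_
    by_cases hu : u ∈ pairFiber M₀ M₁ z
    · rw [Set.indicator_of_mem hu, ← hJ' _ ⟨foot_mem hu.1, foot_mem hu.2⟩]
      simp only [Φ]
      rw [Set.indicator_of_mem hu.1, Set.indicator_of_mem hu.2]
      simp [mul_assoc]
    · rw [Set.indicator_of_notMem hu]
      by_cases hu1 : u ∈ tube 0 M₀
      · have hu2 : z - u ∉ tube 1 M₁ := fun h => hu ⟨hu1, h⟩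
        simp [Φ, hu2]
      · simp [Φ, hu1]
  have key (Θ : ℝ → ENNReal) (hΘ : Measurable Θ) :
      ∫⁻ a, ∫⁻ b, ∫⁻ c, I a * I b * Θ c = ∫⁻ c, Θ c := by
    simp_rw [lintegral_const_mul _ hΘ, mul_assoc]
    have h2 (a) : ∫⁻ b, I a * (I b * ∫⁻ c, Θ c) = I a * ∫⁻ c, Θ c := by
      rw [lintegral_const_mul _ (hIm.mul_const _), lintegral_mul_const _ hIm, hI1, one_mul]
    simp_rw [h2]
    rw [lintegral_mul_const _ hIm, hI1, one_mul]
  calc _ = ∫⁻ z, ∫⁻ p : V3, I (p 0) * I (p 1) *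
        pairPush M₀ M₁ K (p 2, z - p 0 • Pi.single 0 1 - p 1 • Pi.single 1 1) := by
        rw [step1, step2, step3]; exact lintegral_congr step4
    _ = ∫⁻ p : V3, ∫⁻ z, I (p 0) * I (p 1) *
        pairPush M₀ M₁ K (p 2, z - p 0 • Pi.single 0 1 - p 1 • Pi.single 1 1) := by
        rw [lintegral_lintegral_swap]
        have h1 : Measurable fun q : V3 × V3 => I (q.2 0) * I (q.2 1) := by
          exact (hIm.comp (by fun_prop)).mul (hIm.comp (by fun_prop))
        have h2 : Measurable fun q : V3 × V3 => (q.2 2, q.1 - q.2 0 • (Pi.single 0 1 : V3) -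
            q.2 1 • (Pi.single 1 1 : V3)) := by
          fun_prop
        exact (h1.mul (hP.comp h2)).aemeasurable
    _ = ∫⁻ p : V3, I (p 0) * I (p 1) * ∫⁻ z, pairPush M₀ M₁ K (p 2, z) := by
        refine lintegral_congr fun p => ?_
        simp_rw [sub_sub]
        rw [lintegral_sub_right_eq_self (fun z => I (p 0) * I (p 1) * pairPush M₀ M₁ K (p 2, z)),
          lintegral_const_mul (f := fun z => pairPush M₀ M₁ K (p 2, z)) _
            (hP.comp measurable_prodMk_left)]
    _ = ∫⁻ a, ∫⁻ b, ∫⁻ c, I a * I b * ∫⁻ z, pairPush M₀ M₁ K (c, z) := by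
        rw [lintegral_fin_three]
        · rfl
        · exact ((hIm.comp (by fun_prop)).mul (hIm.comp (by fun_prop))).mul
            (hP.lintegral_prod_right'.comp (measurable_pi_apply 2))
    _ = ∫⁻ c, ∫⁻ z, pairPush M₀ M₁ K (c, z) := by
        exact key _ hP.lintegral_prod_right'
    _ = _ := by
        rw [Measure.volume_eq_prod, lintegral_prod _ hP.aemeasurable]

end pair

/-! ### Thickened graphs and the trilinear estimate -/

/-- The weight of the thickened graph: `G` of the height times `W` at the foot point. -/
noncomputable def thickWeight (i : Fin 3) (M : Set V3) (G : ℝ → ENNReal) (W : V3 → ENNReal)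
    (u : V3) : ENNReal :=
  (tube i M).indicator (fun u => G (height i M u) * W (foot i M u)) u

theorem GraphPatch.measurable_thickWeight {i : Fin 3} {M : Set V3} {m : V3 → V3}
    (h : GraphPatch i M m) {G : ℝ → ENNReal} {W : V3 → ENNReal} (hG : Measurable G)
    (hW : Measurable W) : Measurable (thickWeight i M G W) :=
  ((hG.comp h.measurable_height).mul (hW.comp h.measurable_foot)).indicator
    h.isOpen_tube.measurableSet

theorem GraphPatch.lintegral_thickWeight {i : Fin 3} {M : Set V3} {m : V3 → V3}
    (h : GraphPatch i M m) {G : ℝ → ENNReal} {W : V3 → ENNReal} (hG : Measurable G)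
    (hW : Measurable W) (hG1 : ∫⁻ s, G s = 1) {φ : V3 → ENNReal} (hφ : Measurable φ) :
    ∫⁻ u, thickWeight i M G W u * φ (foot i M u) = ∫⁻ x, W x * φ x ∂(graphMeasure i M) := by
  have h1 := h.setLIntegral_height_foot hG (hW.mul hφ)
  rw [hG1, one_mul] at h1
  simp only [Pi.mul_apply] at h1
  rw [← h1, ← lintegral_indicator h.isOpen_tube.measurableSet]
  refine lintegral_congr fun u => ?_
  by_cases hu : u ∈ tube i M <;> simp [thickWeight, hu, mul_assoc]

theorem sq_lintegral_mul_le {α : Type*} [MeasurableSpace α] (μ : Measure α) {w φ γ : α → ENNReal}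
    (hw : Measurable w) (hφ : Measurable φ) (hγ : Measurable γ) :
    (∫⁻ u, w u * (φ u * γ u) ∂μ) ^ 2 ≤
      (∫⁻ u, w u * φ u ^ 2 ∂μ) * ∫⁻ u, w u * γ u ^ 2 ∂μ := by
  have h1 := ENNReal.lintegral_mul_le_Lp_mul_Lq (μ.withDensity w) Real.HolderConjugate.two_two
    hφ.aemeasurable hγ.aemeasurable
  rw [lintegral_withDensity_eq_lintegral_mul _ hw (by fun_prop),
    lintegral_withDensity_eq_lintegral_mul _ hw (by fun_prop),
    lintegral_withDensity_eq_lintegral_mul _ hw (by fun_prop)] at h1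
  simp only [Pi.mul_apply, ENNReal.rpow_two] at h1
  refine (pow_le_pow_left' h1 2).trans_eq ?_
  rw [mul_pow, ← ENNReal.rpow_two, ← ENNReal.rpow_two, ← ENNReal.rpow_mul, ← ENNReal.rpow_mul]
  norm_num

/-- The Cauchy-Schwarz argument for trilinear forms of Loomis-Whitney type. -/
theorem lintegral_conv_sq_le {T₀ T₁ T₂ A B : V3 → ENNReal} {κ : ENNReal} (h₀ : Measurable T₀)
    (h₁ : Measurable T₁) (h₂ : Measurable T₂) (hA : Measurable A) (hB : Measurable B)
    (hκ : ∀ u v, ∫⁻ z, T₂ z * (T₁ (z - u) * T₀ (z - v)) ≤ κ) :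
    ∫⁻ z, T₂ z * (∫⁻ u, T₀ u * T₁ (z - u) * (A u * B (z - u))) ^ 2 ≤
      κ * ((∫⁻ u, T₀ u * A u ^ 2) * ∫⁻ v, T₁ v * B v ^ 2) := by
  let a : V3 → ENNReal := fun u => T₀ u * A u ^ 2
  let b : V3 → ENNReal := fun v => T₁ v * B v ^ 2
  have ha : Measurable a := h₀.mul (hA.pow_const 2)
  have hb : Measurable b := h₁.mul (hB.pow_const 2)
  have hm (z : V3) : Measurable fun u => z - u := measurable_const.sub measurable_id
  calc _ ≤ ∫⁻ z, ∫⁻ u, ∫⁻ v, a u * b v * (T₂ z * (T₁ (z - u) * T₀ (z - v))) := by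
        refine lintegral_mono fun z => ?_
        have h1 := sq_lintegral_mul_le volume (h₀.mul (h₁.comp (hm z))) hA (hB.comp (hm z))
        simp only [Pi.mul_apply, Function.comp] at h1
        -- Reflecting the second Cauchy-Schwarz factor by `v = z - u` makes `B` independent of `z`.
        -- In the product of the two factors, `z` then occurs only in `T₂ z * (T₁ (z - u) * T₀ (z -
        -- v))`.
        have h2 : ∫⁻ u, T₀ u * T₁ (z - u) * B (z - u) ^ 2 =
            ∫⁻ v, T₀ (z - v) * T₁ v * B v ^ 2 := by
          rw [← lintegral_sub_left_eq_self _ z]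
          simp
        rw [h2] at h1
        refine (mul_le_mul_right h1 _).trans_eq ?_
        have hc : Measurable fun v => T₀ (z - v) * T₁ v * B v ^ 2 := by fun_prop
        have hd : Measurable fun u => T₀ u * T₁ (z - u) * A u ^ 2 := by fun_prop
        rw [← lintegral_mul_const _ hd, ← lintegral_const_mul _ (hd.mul_const _)]
        refine lintegral_congr fun u => ?_
        rw [← lintegral_const_mul _ hc, ← lintegral_const_mul _ (hc.const_mul _)]
        refine lintegral_congr fun v => ?_
        ring
    _ = ∫⁻ u, ∫⁻ v, a u * b v * ∫⁻ z, T₂ z * (T₁ (z - u) * T₀ (z - v)) := by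
        rw [lintegral_lintegral_swap]
        · refine lintegral_congr fun u => ?_
          rw [lintegral_lintegral_swap]
          · refine lintegral_congr fun v => ?_
            rw [lintegral_const_mul]
            fun_prop
          · fun_prop
        · have : Measurable fun q : (V3 × V3) × V3 =>
              a q.1.2 * b q.2 * (T₂ q.1.1 * (T₁ (q.1.1 - q.1.2) * T₀ (q.1.1 - q.2))) := by
            fun_prop
          exact this.lintegral_prod_right'.aemeasurable
    _ ≤ ∫⁻ u, ∫⁻ v, a u * b v * κ := by
        gcongr with u v
        exact hκ u v
    _ = _ := by
        simp_rw [mul_assoc]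
        simp_rw [lintegral_const_mul (f := fun v => b v * κ) _ (hb.mul_const κ),
          lintegral_mul_const _ hb]
        rw [lintegral_mul_const _ ha]
        ring

section triple

variable {M₀ M₁ M₂ : Set V3} {m₀ m₁ m₂ : V3 → V3}

theorem eq_zero_of_abs_le {w : V3} (h : ∀ j, |w j| ≤ 1 / 8 * ‖w‖) : w = 0 := by
  have h1 : ‖w‖ ≤ 1 / 8 * ‖w‖ := (pi_norm_le_iff_of_nonneg (by positivity)).2 h
  have h2 := norm_nonneg w
  exact norm_le_zero_iff.1 (by linarith)

/-- Three transversal thickened graphs have a small common part. -/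
theorem lintegral_thickWeight_triple_le (h₀ : GraphPatch 0 M₀ m₀) (h₁ : GraphPatch 1 M₁ m₁)
    (h₂ : GraphPatch 2 M₂ m₂) {G : ℝ → ENNReal} (hG : Measurable G) (hG1 : ∫⁻ s, G s = 1)
    {W₀ W₁ W₂ : V3 → ENNReal} {κ : ENNReal}
    (hκ : ∀ x ∈ M₀, ∀ y ∈ M₁, ∀ z ∈ M₂,
      W₀ x * W₁ y * W₂ z ≤ κ * ENNReal.ofReal |(Matrix.of ![m₀ x, m₁ y, m₂ z]).det|)
    (u v : V3) :
    ∫⁻ z, thickWeight 2 M₂ G W₂ z * (thickWeight 1 M₁ G W₁ (z - u) *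
      thickWeight 0 M₀ G W₀ (z - v)) ≤ κ := by
  set s : Set V3 := {z | z ∈ tube 2 M₂ ∧ z - u ∈ tube 1 M₁ ∧ z - v ∈ tube 0 M₀} with hs
  have hsm : MeasurableSet s := by
    refine (h₂.isOpen_tube.inter (IsOpen.inter (h₁.isOpen_tube.preimage ?_)
      (h₀.isOpen_tube.preimage ?_))).measurableSet <;> fun_prop
  let Ψ : V3 → V3 := fun z => ![height 0 M₀ (z - v), height 1 M₁ (z - u), height 2 M₂ z]
  let r : V3 → Fin 3 → V3 := fun z =>
    ![m₀ (foot 0 M₀ (z - v)), m₁ (foot 1 M₁ (z - u)), m₂ (foot 2 M₂ z)]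
  have hΨ : ∀ z ∈ s, ∀ j, HasFDerivAt (fun z => Ψ z j) (dotCLM (r z j)) z := by
    intro z hz j
    fin_cases j
    · have := (h₀.hasFDerivAt_height hz.2.2).comp z ((hasFDerivAt_id z).sub_const v)
      exact this.congr_fderiv (ContinuousLinearMap.comp_id _)
    · have := (h₁.hasFDerivAt_height hz.2.1).comp z ((hasFDerivAt_id z).sub_const u)
      exact this.congr_fderiv (ContinuousLinearMap.comp_id _)
    · exact h₂.hasFDerivAt_height hz.1
  have hdiff {i : Fin 3} {M : Set V3} {m : V3 → V3} (h : GraphPatch i M m) {a b : V3}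
      (ha : a ∈ tube i M) (hb : b ∈ tube i M) (hab : height i M a = height i M b) :
      |(a - b) i| ≤ 1 / 8 * ‖a - b‖ := by
    have := h.cone _ (foot_mem ha) _ (foot_mem hb)
    have e : foot i M a - foot i M b = a - b := by rw [foot, foot, hab]; abel
    rw [e, ← Pi.sub_apply, e] at this
    exact this
  -- If all three heights agree at two points, each cone condition bounds one coordinate of their
  -- difference by 1/8 of its norm, so the difference vanishes.
  have hi : Set.InjOn Ψ s := by
    intro z hz z' hz' h
    rw [← sub_eq_zero]
    refine eq_zero_of_abs_le fun j => ?_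
    fin_cases j
    · simpa using hdiff h₀ hz.2.2 hz'.2.2 (congrFun h 0)
    · simpa using hdiff h₁ hz.2.1 hz'.2.1 (congrFun h 1)
    · simpa using hdiff h₂ hz.1 hz'.1 (congrFun h 2)
  calc ∫⁻ z, thickWeight 2 M₂ G W₂ z * (thickWeight 1 M₁ G W₁ (z - u) *
      thickWeight 0 M₀ G W₀ (z - v))
      ≤ ∫⁻ z in s, ENNReal.ofReal |(Matrix.of (r z)).det| *
          (κ * (G (Ψ z 0) * G (Ψ z 1) * G (Ψ z 2))) := by
        rw [← lintegral_indicator hsm]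
        refine lintegral_mono fun z => ?_
        by_cases hz : z ∈ s
        · rw [Set.indicator_of_mem hz, thickWeight, thickWeight, thickWeight,
            Set.indicator_of_mem hz.1, Set.indicator_of_mem hz.2.1, Set.indicator_of_mem hz.2.2]
          have := hκ _ (foot_mem hz.2.2) _ (foot_mem hz.2.1) _ (foot_mem hz.1)
          calc _ = W₀ (foot 0 M₀ (z - v)) * W₁ (foot 1 M₁ (z - u)) * W₂ (foot 2 M₂ z) *
                (G (Ψ z 0) * G (Ψ z 1) * G (Ψ z 2)) := by
                simp only [Ψ, Matrix.cons_val_zero, Matrix.cons_val_one, Matrix.cons_val]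
                ring
            _ ≤ _ := by
                refine (mul_le_mul_left this _).trans_eq ?_
                simp only [r]
                ring
        · rw [Set.indicator_of_notMem hz]
          simp only [hs, Set.mem_ofPred_eq, not_and_or] at hz
          rcases hz with hz | hz | hz <;> simp [thickWeight, hz]
    _ = ∫⁻ p in Ψ '' s, κ * (G (p 0) * G (p 1) * G (p 2)) :=
        (lintegral_image_rows hsm hΨ hi fun p => κ * (G (p 0) * G (p 1) * G (p 2))).symm
    _ ≤ ∫⁻ p : V3, κ * (G (p 0) * G (p 1) * G (p 2)) := setLIntegral_le_lintegral _ _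
    _ = κ := by
        rw [lintegral_fin_three]
        · simp only [Matrix.cons_val_zero, Matrix.cons_val_one, Matrix.cons_val, ← mul_assoc]
          simp_rw [lintegral_const_mul _ hG, hG1, mul_one]
          simp_rw [lintegral_const_mul _ hG, hG1, mul_one]
          simp_rw [lintegral_const_mul _ hG, hG1, mul_one]
        · exact (((hG.comp (measurable_pi_apply 0)).mul (hG.comp (measurable_pi_apply 1))).mul
            (hG.comp (measurable_pi_apply 2))).const_mul _

/-- The trilinear estimate for thickened graphs. -/
theorem lintegral_thick_conv_sq_le (h₀ : GraphPatch 0 M₀ m₀) (h₁ : GraphPatch 1 M₁ m₁)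
    (h₂ : GraphPatch 2 M₂ m₂) {G : ℝ → ENNReal} (hG : Measurable G) (hG1 : ∫⁻ s, G s = 1)
    {W₀ W₁ W₂ : V3 → ENNReal} (hW₀ : Measurable W₀) (hW₁ : Measurable W₁) (hW₂ : Measurable W₂)
    {κ : ENNReal} (hκ : ∀ x ∈ M₀, ∀ y ∈ M₁, ∀ z ∈ M₂,
      W₀ x * W₁ y * W₂ z ≤ κ * ENNReal.ofReal |(Matrix.of ![m₀ x, m₁ y, m₂ z]).det|)
    {φ γ : V3 → ENNReal} (hφ : Measurable φ) (hγ : Measurable γ) :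
    ∫⁻ z, thickWeight 2 M₂ G W₂ z * (∫⁻ u, thickWeight 0 M₀ G W₀ u *
      thickWeight 1 M₁ G W₁ (z - u) * (φ (foot 0 M₀ u) * γ (foot 1 M₁ (z - u)))) ^ 2 ≤
    κ * ((∫⁻ x, W₀ x * φ x ^ 2 ∂(graphMeasure 0 M₀)) *
      ∫⁻ y, W₁ y * γ y ^ 2 ∂(graphMeasure 1 M₁)) := by
  rw [← h₀.lintegral_thickWeight hG hW₀ hG1 (hφ.pow_const 2),
    ← h₁.lintegral_thickWeight hG hW₁ hG1 (hγ.pow_const 2)]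
  exact lintegral_conv_sq_le (h₀.measurable_thickWeight hG hW₀)
    (h₁.measurable_thickWeight hG hW₁) (h₂.measurable_thickWeight hG hW₂)
    (hφ.comp h₀.measurable_foot) (hγ.comp h₁.measurable_foot)
    (lintegral_thickWeight_triple_le h₀ h₁ h₂ hG hG1 hκ)

end triple

section triple

variable {M₀ M₁ M₂ : Set V3} {m₀ m₁ m₂ : V3 → V3}

/-- In the coordinates given by the two heights, the convolution of two thickened graphs is an
average of translates of the exact convolution density. It therefore approximates that density when
`G` is concentrated near zero. -/
theorem lintegral_thick_conv_eq (h₀ : GraphPatch 0 M₀ m₀) (h₁ : GraphPatch 1 M₁ m₁)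
    {G : ℝ → ENNReal} (hG : Measurable G) {W₀ W₁ φ γ : V3 → ENNReal} {k : V3 × V3 → ENNReal}
    (hk : Measurable k)
    (hk' : ∀ x ∈ M₀, ∀ y ∈ M₁,
      ENNReal.ofReal (pairJacobian m₀ m₁ (x, y)) * k (x, y) = W₀ x * W₁ y * (φ x * γ y))
    (z : V3) :
    ∫⁻ u, thickWeight 0 M₀ G W₀ u * thickWeight 1 M₁ G W₁ (z - u) *
      (φ (foot 0 M₀ u) * γ (foot 1 M₁ (z - u))) =
    ∫⁻ a, ∫⁻ b, G a * G b *
      ∫⁻ s, pairPush M₀ M₁ k (s, z - a • Pi.single 0 1 - b • Pi.single 1 1) := by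
  have hP := measurable_pairPush h₀ h₁ hk
  have h1 := setLIntegral_pairFiber h₀ h₁ z (fun a b => G a * G b) k
  rw [lintegral_fin_three] at h1
  · simp only [Matrix.cons_val_zero, Matrix.cons_val_one, Matrix.cons_val] at h1
    have h2 (a b : ℝ) : ∫⁻ c, G a * G b *
        pairPush M₀ M₁ k (c, z - a • Pi.single 0 1 - b • Pi.single 1 1) =
        G a * G b * ∫⁻ c, pairPush M₀ M₁ k (c, z - a • Pi.single 0 1 - b • Pi.single 1 1) :=
      lintegral_const_mul _ (hP.comp (measurable_id.prodMk measurable_const))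
    simp_rw [h2] at h1
    rw [← h1, ← lintegral_indicator (measurableSet_pairFiber h₀ h₁ z)]
    refine lintegral_congr fun u => ?_
    by_cases hu : u ∈ pairFiber M₀ M₁ z
    · rw [Set.indicator_of_mem hu, hk' _ (foot_mem hu.1) _ (foot_mem hu.2), thickWeight,
        thickWeight, Set.indicator_of_mem hu.1, Set.indicator_of_mem hu.2]
      ring
    · rw [Set.indicator_of_notMem hu, thickWeight, thickWeight]
      by_cases hu1 : u ∈ tube 0 M₀
      · have hu2 : z - u ∉ tube 1 M₁ := fun h => hu ⟨hu1, h⟩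
        simp [hu2]
      · simp [hu1]
  · have h3 : Measurable fun p : V3 => (p 2, z - p 0 • (Pi.single 0 1 : V3) -
            p 1 • (Pi.single 1 1 : V3)) := by
      fun_prop
    exact ((hG.comp (measurable_pi_apply 0)).mul (hG.comp (measurable_pi_apply 1))).mul
      (hP.comp h3)

/-- The trilinear estimate on graphs, for nonnegative functions whose convolution has a uniformly
continuous density. -/
theorem lintegral_density_sq_le (h₀ : GraphPatch 0 M₀ m₀) (h₁ : GraphPatch 1 M₁ m₁)
    (h₂ : GraphPatch 2 M₂ m₂) {W₀ W₁ W₂ : V3 → ENNReal} (hW₀ : Measurable W₀)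
    (hW₁ : Measurable W₁) (hW₂ : Measurable W₂)
    {κ : ENNReal} (hκ : ∀ x ∈ M₀, ∀ y ∈ M₁, ∀ z ∈ M₂,
      W₀ x * W₁ y * W₂ z ≤ κ * ENNReal.ofReal |(Matrix.of ![m₀ x, m₁ y, m₂ z]).det|)
    {φ γ : V3 → ENNReal} (hφ : Measurable φ) (hγ : Measurable γ) {k : V3 × V3 → ENNReal}
    (hk : Measurable k)
    (hk' : ∀ x ∈ M₀, ∀ y ∈ M₁,
      ENNReal.ofReal (pairJacobian m₀ m₁ (x, y)) * k (x, y) = W₀ x * W₁ y * (φ x * γ y))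
    {a : V3 → NNReal} (ha : UniformContinuous a)
    (hka : ∀ z, ∫⁻ s, pairPush M₀ M₁ k (s, z) = a z) :
    ∫⁻ z, W₂ z * (a z : ENNReal) ^ 2 ∂(graphMeasure 2 M₂) ≤
    κ * ((∫⁻ x, W₀ x * φ x ^ 2 ∂(graphMeasure 0 M₀)) *
      ∫⁻ y, W₁ y * γ y ^ 2 ∂(graphMeasure 1 M₁)) := by
  set R := κ * ((∫⁻ x, W₀ x * φ x ^ 2 ∂(graphMeasure 0 M₀)) *
      ∫⁻ y, W₁ y * γ y ^ 2 ∂(graphMeasure 1 M₁)) with hR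
  have ham : Measurable a := ha.continuous.measurable
  have main (ε : NNReal) (hε : 0 < ε) :
      ∫⁻ z, W₂ z * ((a z - ε : NNReal) : ENNReal) ^ 2 ∂(graphMeasure 2 M₂) ≤ R := by
    obtain ⟨δ, hδ, hδ'⟩ := Metric.uniformContinuous_iff.1 ha ε hε
    -- Three displacements enter below, two from averaging and one from the height over `M₂`. Each
    -- has length less than `r`, and their sum must stay below `δ`.
    set r := δ / 4 with hr
    have hr0 : 0 < r := by positivity
    set G : ℝ → ENNReal := (Set.Ico 0 r).indicator fun _ => (ENNReal.ofReal r)⁻¹ with hGdef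
    have hG : Measurable G := measurable_const.indicator measurableSet_Ico
    have hG1 : ∫⁻ s, G s = 1 := by
      rw [hGdef, lintegral_indicator_const measurableSet_Ico, Real.volume_Ico, sub_zero]
      exact ENNReal.inv_mul_cancel (by simpa using hr0) ENNReal.ofReal_ne_top
    have h1 := lintegral_thick_conv_sq_le h₀ h₁ h₂ hG hG1 hW₀ hW₁ hW₂ hκ hφ hγ
    rw [← hR] at h1
    refine le_trans ?_ h1
    rw [← h₂.lintegral_thickWeight hG hW₂ hG1 (by fun_prop)]
    refine lintegral_mono fun u => ?_
    by_cases hu : u ∈ tube 2 M₂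
    swap
    · simp [thickWeight, hu]
    by_cases ht : height 2 M₂ u ∈ Set.Ico 0 r
    swap
    · simp [thickWeight, hu, hGdef, ht]
    refine mul_le_mul_right (pow_le_pow_left' ?_ 2) _
    rw [lintegral_thick_conv_eq h₀ h₁ hG hk hk' u]
    simp_rw [hka]
    calc ((a (foot 2 M₂ u) - ε : NNReal) : ENNReal)
        = ∫⁻ x, ∫⁻ y, G x * G y * ((a (foot 2 M₂ u) - ε : NNReal) : ENNReal) := by
          have (x : ℝ) : ∫⁻ y, G x * G y * ((a (foot 2 M₂ u) - ε : NNReal) : ENNReal) =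
              G x * ((a (foot 2 M₂ u) - ε : NNReal) : ENNReal) := by
            rw [lintegral_mul_const _ (hG.const_mul _), lintegral_const_mul _ hG, hG1, mul_one]
          simp_rw [this]
          rw [lintegral_mul_const _ hG, hG1, one_mul]
      _ ≤ _ := by
          refine lintegral_mono fun x => lintegral_mono fun y => ?_
          by_cases hx : x ∈ Set.Ico 0 r
          swap
          · simp [hGdef, hx]
          by_cases hy : y ∈ Set.Ico 0 r
          swap
          · simp [hGdef, hy]
          refine mul_le_mul_right (ENNReal.coe_le_coe.2 ?_) _
          have hd : dist (foot 2 M₂ u) (u - x • Pi.single 0 1 - y • Pi.single 1 1) < δ := by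
            rw [dist_eq_norm]
            have e : foot 2 M₂ u - (u - x • (Pi.single 0 1 : V3) - y • (Pi.single 1 1 : V3)) =
                x • (Pi.single 0 1 : V3) + y • (Pi.single 1 1 : V3) -
                  height 2 M₂ u • (Pi.single 2 1 : V3) := by
              rw [foot]; abel
            rw [e]
            refine (norm_sub_le _ _).trans_lt ?_
            have := norm_add_le (x • (Pi.single 0 1 : V3)) (y • (Pi.single 1 1 : V3))
            rw [norm_smul_single, norm_smul_single, abs_of_nonneg hx.1, abs_of_nonneg hy.1] at this
            rw [norm_smul_single, abs_of_nonneg ht.1]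
            linarith [hx.2, hy.2, ht.2]
          have h3 := hδ' hd
          rw [NNReal.dist_eq] at h3
          rw [tsub_le_iff_right, ← NNReal.coe_le_coe, NNReal.coe_add]
          linarith [(abs_lt.1 h3).2]
  have hlim : ∀ z, Filter.Tendsto (fun n : ℕ =>
      W₂ z * ((a z - 1 / ((n : NNReal) + 1) : NNReal) : ENNReal) ^ 2) Filter.atTop
      (𝓝 (W₂ z * (a z : ENNReal) ^ 2)) := by
    intro z
    -- The weight may be infinite at `z`; multiplication by it preserves the limit only if the limit
    -- is nonzero. Where `a z = 0` truncated subtraction makes the sequence constantly zero.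
    by_cases hz : a z = 0
    · simp [hz]
    have h1 : Filter.Tendsto (fun n : ℕ => a z - 1 / ((n : NNReal) + 1)) Filter.atTop
        (𝓝 (a z)) := by
      have h2 : Filter.Tendsto (fun n : ℕ => 1 / ((n : NNReal) + 1)) Filter.atTop (𝓝 0) := by
        rw [← NNReal.tendsto_coe]
        simpa using tendsto_one_div_add_atTop_nhds_zero_nat (𝕜 := ℝ)
      simpa using (tendsto_const_nhds (x := a z)).sub h2
    refine ENNReal.Tendsto.const_mul ?_ (Or.inl (by simpa using hz))
    exact ENNReal.Tendsto.pow ((ENNReal.continuous_coe.tendsto _).comp h1)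
  calc _ = ∫⁻ z, Filter.liminf (fun n : ℕ =>
      W₂ z * ((a z - 1 / ((n : NNReal) + 1) : NNReal) : ENNReal) ^ 2) Filter.atTop
        ∂(graphMeasure 2 M₂) := lintegral_congr fun z => (hlim z).liminf_eq.symm
    _ ≤ Filter.liminf (fun n : ℕ => ∫⁻ z,
      W₂ z * ((a z - 1 / ((n : NNReal) + 1) : NNReal) : ENNReal) ^ 2
        ∂(graphMeasure 2 M₂)) Filter.atTop := lintegral_liminf_le fun n => by fun_prop
    _ ≤ R := by
        refine Filter.liminf_le_of_frequently_le' (Filter.Frequently.of_forall fun n => ?_)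
        exact main _ (by positivity)

end triple

/-! ### The continuous density of a convolution on graphs -/

section pair

variable {M₀ M₁ : Set V3} {m₀ m₁ : V3 → V3}

/-- The region is open and the kernel vanishes off a compact set inside the product, so the support
stays in a compact subset of the region and extension by zero creates no discontinuity at its
boundary. -/
theorem continuous_pairPush {F : Type*} [NormedAddCommGroup F] (h₀ : GraphPatch 0 M₀ m₀)
    (h₁ : GraphPatch 1 M₁ m₁) {K : V3 × V3 → F} {s : Set (V3 × V3)}
    (hK : ContinuousOn K (M₀ ×ˢ M₁)) (hs : IsCompact s) (hsM : s ⊆ M₀ ×ˢ M₁) (hK0 : ∀ p ∉ s, K p = 0) :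
    Continuous (pairPush M₀ M₁ K) ∧ HasCompactSupport (pairPush M₀ M₁ K) := by
  have hE := isOpen_pairRegion h₀ h₁
  set t : Set (ℝ × V3) := (fun p : V3 × V3 => (p.1 2, p.1 + p.2)) '' s with ht
  have htc : IsCompact t := hs.image (by fun_prop)
  have hz : ∀ q ∉ t, pairPush M₀ M₁ K q = 0 := by
    intro q hq
    by_cases hqE : q ∈ pairRegion M₀ M₁
    · rw [pairPush, Set.indicator_of_mem hqE, Function.comp]
      refine hK0 _ fun hmem => hq ⟨_, hmem, ?_⟩
      exact Prod.ext (pairInv_spec hqE).1 (pairInv_spec hqE).2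
    · rw [pairPush, Set.indicator_of_notMem hqE]
  refine ⟨continuous_iff_continuousAt.2 fun q => ?_, HasCompactSupport.intro htc hz⟩
  by_cases hqE : q ∈ pairRegion M₀ M₁
  · have hn := hE.mem_nhds hqE
    have hc : ContinuousOn (K ∘ pairInv M₀ M₁) (pairRegion M₀ M₁) :=
      hK.comp (continuousOn_pairInv h₀ h₁) fun q hq => pairInv_mem hq
    refine (hc.continuousAt hn).congr ?_
    filter_upwards [hn] with p hp
    rw [pairPush, Set.indicator_of_mem hp]
  · have hqt : q ∉ t := by
      rintro ⟨p, hp, rfl⟩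
      exact hqE (mem_pairRegion (hsM hp).1 (hsM hp).2)
    have hn : tᶜ ∈ 𝓝 q := htc.isClosed.isOpen_compl.mem_nhds hqt
    refine (continuousAt_const (y := (0 : F))).congr ?_
    filter_upwards [hn] with p hp using (hz p hp).symm

/-- The measure-theoretic form of the coordinates `(x 2, x + y)` on a product of graphs. -/
theorem map_prod_graphMeasure (h₀ : GraphPatch 0 M₀ m₀) (h₁ : GraphPatch 1 M₁ m₁) {J : V3 × V3 → ENNReal} (hJ : Measurable J)
    (hJ' : ∀ p ∈ M₀ ×ˢ M₁, J p = ENNReal.ofReal (pairJacobian m₀ m₁ p)) :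
    (((graphMeasure 0 M₀).prod (graphMeasure 1 M₁)).withDensity J).map
      (fun p => (p.1 2, p.1 + p.2)) = volume.restrict (pairRegion M₀ M₁) := by
  have hE := (isOpen_pairRegion h₀ h₁).measurableSet
  have hΞ : Measurable fun p : V3 × V3 => (p.1 2, p.1 + p.2) := by fun_prop
  ext B hB
  have hB' := hΞ hB
  rw [Measure.map_apply hΞ hB, withDensity_apply _ hB', Measure.restrict_apply hB,
    ← lintegral_indicator hB']
  have h1 := lintegral_prod_graphMeasure h₀ h₁
    (K := ((fun p : V3 × V3 => (p.1 2, p.1 + p.2)) ⁻¹' B).indicator 1)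
    (measurable_one.indicator hB') hJ hJ'
  rw [← lintegral_indicator_one (hB.inter hE)]
  convert h1 using 1
  · refine lintegral_congr fun p => ?_
    by_cases hp : p ∈ (fun p : V3 × V3 => (p.1 2, p.1 + p.2)) ⁻¹' B
    · rw [Set.indicator_of_mem hp, Set.indicator_of_mem hp]; simp
    · rw [Set.indicator_of_notMem hp, Set.indicator_of_notMem hp]; simp
  · refine lintegral_congr fun q => ?_
    by_cases hq : q ∈ pairRegion M₀ M₁
    · have e : ((pairInv M₀ M₁ q).1 2, (pairInv M₀ M₁ q).1 + (pairInv M₀ M₁ q).2) = q :=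
        Prod.ext (pairInv_spec hq).1 (pairInv_spec hq).2
      rw [pairPush, Set.indicator_of_mem hq, Function.comp]
      by_cases hqB : q ∈ B
      · rw [Set.indicator_of_mem (Set.mem_inter hqB hq), Set.indicator_of_mem]
        · rfl
        · rwa [Set.mem_preimage, e]
      · rw [Set.indicator_of_notMem fun h => hqB h.1, Set.indicator_of_notMem]
        rwa [Set.mem_preimage, e]
    · rw [pairPush, Set.indicator_of_notMem hq, Set.indicator_of_notMem fun h => hq h.2]

theorem ae_mem_prod (h₀ : GraphPatch 0 M₀ m₀) (h₁ : GraphPatch 1 M₁ m₁) :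
    ∀ᵐ p ∂((graphMeasure 0 M₀).prod (graphMeasure 1 M₁)), p ∈ M₀ ×ˢ M₁ := by
  filter_upwards [Measure.quasiMeasurePreserving_fst.ae h₀.ae_mem,
    Measure.quasiMeasurePreserving_snd.ae h₁.ae_mem] with p hp hq using ⟨hp, hq⟩

/-- The convolution density of the kernel `K` with respect to the two graph measures. -/
noncomputable def pairDensity {F : Type*} [NormedAddCommGroup F] [NormedSpace ℝ F]
    (M₀ M₁ : Set V3) (K : V3 × V3 → F) (z : V3) : F :=
  ∫ s : ℝ, pairPush M₀ M₁ K (s, z)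

theorem continuous_integral_left {F : Type*} [NormedAddCommGroup F] [NormedSpace ℝ F]
    {H : ℝ × V3 → F} (hH : Continuous H) (hc : HasCompactSupport H) :
    Continuous (fun z => ∫ s : ℝ, H (s, z)) ∧ HasCompactSupport (fun z => ∫ s : ℝ, H (s, z)) := by
  have hK : IsCompact (Prod.fst '' tsupport H) := hc.isCompact.image continuous_fst
  have hK' : IsCompact (Prod.snd '' tsupport H) := hc.isCompact.image continuous_snd
  constructor
  · have h1 := continuous_parametric_integral_of_continuous (μ := (volume : Measure ℝ))
      (f := fun (z : V3) (s : ℝ) => H (s, z)) (by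
        show Continuous fun p : V3 × ℝ => H (p.2, p.1)
        fun_prop) hK
    convert h1 using 2 with z
    rw [setIntegral_eq_integral_of_forall_compl_eq_zero]
    intro s hs
    by_contra h0
    exact hs ⟨(s, z), subset_tsupport _ h0, rfl⟩
  · refine HasCompactSupport.intro hK' fun z hz => ?_
    have : ∀ s : ℝ, H (s, z) = 0 := by
      intro s
      by_contra h0
      exact hz ⟨(s, z), subset_tsupport _ h0, rfl⟩
    simp [this]

theorem continuous_pairDensity {F : Type*} [NormedAddCommGroup F] [NormedSpace ℝ F]
    (h₀ : GraphPatch 0 M₀ m₀)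
    (h₁ : GraphPatch 1 M₁ m₁) {K : V3 × V3 → F} {s : Set (V3 × V3)}
    (hK : ContinuousOn K (M₀ ×ˢ M₁)) (hs : IsCompact s) (hsM : s ⊆ M₀ ×ˢ M₁)
    (hK0 : ∀ p ∉ s, K p = 0) :
    Continuous (pairDensity M₀ M₁ K) ∧ HasCompactSupport (pairDensity M₀ M₁ K) := by
  obtain ⟨a, b⟩ := continuous_pairPush h₀ h₁ hK hs hsM hK0
  exact continuous_integral_left a b

/-- The weight function `w` as a density on the graph `M`. -/
noncomputable def graphWeight (M : Set V3) (w : V3 → ℝ) (x : V3) : ENNReal :=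
  M.indicator (fun x => ENNReal.ofReal (w x)) x

theorem measurable_indicator_of_continuousOn {α β : Type*} [TopologicalSpace α]
    [MeasurableSpace α] [OpensMeasurableSpace α] [TopologicalSpace β] [MeasurableSpace β]
    [BorelSpace β] [Zero β] {s : Set α}
    (hs : MeasurableSet s) {f : α → β} (hf : ContinuousOn f s) : Measurable (s.indicator f) := by
  classical
  have := hf.measurable_piecewise (continuousOn_const (c := (0 : β))) hs
  convert this using 1
  ext x
  by_cases hx : x ∈ s <;> simp [hx]

theorem measurable_graphWeight {i : Fin 3} {M : Set V3} {m : V3 → V3} (h : GraphPatch i M m)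
    {w : V3 → ℝ} (hw : ContinuousOn w M) : Measurable (graphWeight M w) :=
  measurable_indicator_of_continuousOn h.measurableSet
    (ENNReal.continuous_ofReal.comp_continuousOn hw)

/-- The density of the convolution of `f` and `g` with respect to the weighted graph measures. -/
noncomputable def convKernel (m₀ m₁ : V3 → V3) (w₀ w₁ : V3 → ℝ) (f g : V3 → ℂ) (p : V3 × V3) : ℂ :=
  (w₀ p.1 * w₁ p.2 / pairJacobian m₀ m₁ p : ℝ) • (f p.1 * g p.2)

theorem continuousOn_convKernel (h₀ : GraphPatch 0 M₀ m₀) (h₁ : GraphPatch 1 M₁ m₁)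
    {w₀ w₁ : V3 → ℝ} (hw₀ : ContinuousOn w₀ M₀) (hw₁ : ContinuousOn w₁ M₁) {f g : V3 → ℂ}
    (hf : ContinuousOn f M₀) (hg : ContinuousOn g M₁) :
    ContinuousOn (convKernel m₀ m₁ w₀ w₁ f g) (M₀ ×ˢ M₁) := by
  have a {R : Type} [TopologicalSpace R] {φ : V3 → R} (hφ : ContinuousOn φ M₀) :
      ContinuousOn (fun p : V3 × V3 => φ p.1) (M₀ ×ˢ M₁) :=
    hφ.comp continuousOn_fst fun p hp => hp.1
  have b {R : Type} [TopologicalSpace R] {φ : V3 → R} (hφ : ContinuousOn φ M₁) :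
      ContinuousOn (fun p : V3 × V3 => φ p.2) (M₀ ×ˢ M₁) :=
    hφ.comp continuousOn_snd fun p hp => hp.2
  refine ContinuousOn.smul (ContinuousOn.div ((a hw₀).mul (b hw₁)) ?_ fun p hp => ?_)
    ((a hf).mul (b hg))
  · exact continuousOn_const.sub (((continuous_apply 1).comp_continuousOn (a h₀.cont)).mul
      ((continuous_apply 0).comp_continuousOn (b h₁.cont)))
  · linarith [abs_one_sub_pairJacobian_le h₀ h₁ hp]

/-- Transport to the coordinates `(x 2, x + y)`, in which the test function depends on the second
variable only. Fubini's theorem then leaves the integral over the first variable, which is the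
density. -/
theorem integral_conv_eq (h₀ : GraphPatch 0 M₀ m₀) (h₁ : GraphPatch 1 M₁ m₁)
    {w₀ w₁ : V3 → ℝ} (hw₀ : ContinuousOn w₀ M₀) (hw₁ : ContinuousOn w₁ M₁)
    (hp₀ : ∀ x ∈ M₀, 0 < w₀ x) (hp₁ : ∀ x ∈ M₁, 0 < w₁ x) {f g : V3 → ℂ}
    (hf : ContinuousOn f M₀) (hg : ContinuousOn g M₁) {K₀ K₁ : Set V3} (hK₀ : IsCompact K₀)
    (hK₁ : IsCompact K₁) (hKM₀ : K₀ ⊆ M₀) (hKM₁ : K₁ ⊆ M₁) (hf0 : ∀ x ∉ K₀, f x = 0)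
    (hg0 : ∀ x ∉ K₁, g x = 0) {ψ : V3 → ℂ} (hψ : Continuous ψ) :
    ∫ x, ∫ y, f x * g y * ψ (x + y) ∂((graphMeasure 1 M₁).withDensity (graphWeight M₁ w₁))
      ∂((graphMeasure 0 M₀).withDensity (graphWeight M₀ w₀)) =
    ∫ z, pairDensity M₀ M₁ (convKernel m₀ m₁ w₀ w₁ f g) z * ψ z := by
  set μ₀ := graphMeasure 0 M₀
  set μ₁ := graphMeasure 1 M₁
  have hMm : MeasurableSet (M₀ ×ˢ M₁) := h₀.measurableSet.prod h₁.measurableSet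
  set κ := convKernel m₀ m₁ w₀ w₁ f g with hκ
  have hκc : ContinuousOn κ (M₀ ×ˢ M₁) := continuousOn_convKernel h₀ h₁ hw₀ hw₁ hf hg
  have hκ0 : ∀ p ∉ K₀ ×ˢ K₁, κ p = 0 := by
    intro p hp
    rw [Set.mem_prod, not_and_or] at hp
    rcases hp with hp | hp
    · simp [hκ, convKernel, hf0 _ hp]
    · simp [hκ, convKernel, hg0 _ hp]
  obtain ⟨hHc, hHs⟩ := continuous_pairPush h₀ h₁ hκc (hK₀.prod hK₁)
    (Set.prod_mono hKM₀ hKM₁) hκ0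
  set H := pairPush M₀ M₁ κ with hH
  have hJc : ContinuousOn (pairJacobian m₀ m₁) (M₀ ×ˢ M₁) := by
    refine continuousOn_const.sub (ContinuousOn.mul ?_ ?_)
    · exact (continuous_apply 1).comp_continuousOn
        (h₀.cont.comp continuousOn_fst fun p hp => hp.1)
    · exact (continuous_apply 0).comp_continuousOn
        (h₁.cont.comp continuousOn_snd fun p hp => hp.2)
  set J : V3 × V3 → ENNReal :=
    (M₀ ×ˢ M₁).indicator fun p => ENNReal.ofReal (pairJacobian m₀ m₁ p) with hJdef
  have hJ : Measurable J := measurable_indicator_of_continuousOn hMm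
    (ENNReal.continuous_ofReal.comp_continuousOn hJc)
  have hJtop : ∀ p, J p < ⊤ := by
    intro p
    by_cases hp : p ∈ M₀ ×ˢ M₁ <;> simp [hJdef, hp]
  have hJ' : ∀ p ∈ M₀ ×ˢ M₁, J p = ENNReal.ofReal (pairJacobian m₀ m₁ p) :=
    fun p hp => Set.indicator_of_mem hp _
  have hmap := map_prod_graphMeasure h₀ h₁ hJ hJ'
  have hW₀ := measurable_graphWeight h₀ hw₀
  have hW₁ := measurable_graphWeight h₁ hw₁
  have hΞ : Measurable fun p : V3 × V3 => (p.1 2, p.1 + p.2) := by fun_prop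
  set h : V3 × V3 → ℂ := fun p => f p.1 * g p.2 * ψ (p.1 + p.2) with hh
  have hprod : ((μ₀.withDensity (graphWeight M₀ w₀)).prod (μ₁.withDensity (graphWeight M₁ w₁))) =
      (μ₀.prod μ₁).withDensity fun p => graphWeight M₀ w₀ p.1 * graphWeight M₁ w₁ p.2 :=
    prod_withDensity hW₀ hW₁
  have hWtop (M : Set V3) (w : V3 → ℝ) (x : V3) : graphWeight M w x < ⊤ := by
    by_cases hx : x ∈ M <;> simp [graphWeight, hx]
  have hWm : Measurable fun p : V3 × V3 => graphWeight M₀ w₀ p.1 * graphWeight M₁ w₁ p.2 :=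
    (hW₀.comp measurable_fst).mul (hW₁.comp measurable_snd)
  have hWt : ∀ᵐ p ∂(μ₀.prod μ₁), graphWeight M₀ w₀ p.1 * graphWeight M₁ w₁ p.2 < ⊤ :=
    Filter.Eventually.of_forall fun p => ENNReal.mul_lt_top (hWtop _ _ _) (hWtop _ _ _)
  have hJt : ∀ᵐ p ∂(μ₀.prod μ₁), J p < ⊤ := Filter.Eventually.of_forall hJtop
  let Hψ : ℝ × V3 → ℂ := fun q => H q * ψ q.2
  have hHψc : Continuous Hψ := hHc.mul (hψ.comp continuous_snd)
  have hHψs : HasCompactSupport Hψ := hHs.mul_right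
  have hHψi : Integrable Hψ (volume : Measure (ℝ × V3)) := hHψc.integrable_of_hasCompactSupport hHψs
  -- The division by the Jacobian in `convKernel` is undone here: the weights times `f` and `g`
  -- equal the Jacobian times the transported kernel.
  have hae : (fun p => (graphWeight M₀ w₀ p.1 * graphWeight M₁ w₁ p.2).toReal • h p)
      =ᵐ[μ₀.prod μ₁] fun p => (J p).toReal • Hψ (p.1 2, p.1 + p.2) := by
    filter_upwards [ae_mem_prod h₀ h₁] with p hp
    have hj := abs_one_sub_pairJacobian_le h₀ h₁ hp
    have e1 : Hψ (p.1 2, p.1 + p.2) = κ p * ψ (p.1 + p.2) := by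
      simp only [Hψ, hH]
      rw [pairPush, Set.indicator_of_mem (mem_pairRegion hp.1 hp.2), Function.comp,
        pairInv_eq h₀ h₁ hp.1 hp.2]
    rw [e1, hJ' p hp, ENNReal.toReal_ofReal (by linarith), graphWeight, graphWeight,
      Set.indicator_of_mem hp.1, Set.indicator_of_mem hp.2, ENNReal.toReal_mul,
      ENNReal.toReal_ofReal (hp₀ _ hp.1).le, ENNReal.toReal_ofReal (hp₁ _ hp.2).le]
    simp only [hκ, convKernel, hh, Complex.real_smul]
    have : (pairJacobian m₀ m₁ p : ℂ) ≠ 0 := by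
      rw [Complex.ofReal_ne_zero]; linarith
    push_cast
    field_simp
  have hν : Integrable (fun p : V3 × V3 => Hψ (p.1 2, p.1 + p.2)) ((μ₀.prod μ₁).withDensity J) := by
    refine (integrable_map_measure (f := fun p : V3 × V3 => (p.1 2, p.1 + p.2)) (g := Hψ)
      hHψc.aestronglyMeasurable hΞ.aemeasurable).1 ?_
    rw [hmap]
    exact hHψi.restrict
  have hint : Integrable h ((μ₀.withDensity (graphWeight M₀ w₀)).prod
      (μ₁.withDensity (graphWeight M₁ w₁))) := by
    rw [hprod, integrable_withDensity_iff_integrable_smul' hWm hWt, integrable_congr hae]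
    exact (integrable_withDensity_iff_integrable_smul' hJ hJt).1 hν
  rw [← integral_prod h hint, hprod, integral_withDensity_eq_integral_toReal_smul hWm hWt,
    integral_congr_ae hae, ← integral_withDensity_eq_integral_toReal_smul hJ hJt,
    ← integral_map (f := Hψ) hΞ.aemeasurable hHψc.aestronglyMeasurable, hmap,
    setIntegral_eq_integral_of_forall_compl_eq_zero, Measure.volume_eq_prod,
    integral_prod_symm _ hHψi]
  · refine integral_congr_ae (Filter.Eventually.of_forall fun z => ?_)
    simp only [Hψ, pairDensity]
    rw [integral_mul_const]
  · intro q hq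
    simp only [Hψ, hH]
    rw [pairPush, Set.indicator_of_notMem hq, zero_mul]

end pair

section triple

variable {M₀ M₁ M₂ : Set V3} {m₀ m₁ m₂ : V3 → V3}

theorem integrable_left {F : Type*} [NormedAddCommGroup F]
    {H : ℝ × V3 → F} (hH : Continuous H) (hc : HasCompactSupport H) (z : V3) :
    Integrable fun s : ℝ => H (s, z) := by
  have hK : IsCompact (Prod.fst '' tsupport H) := hc.isCompact.image continuous_fst
  refine Continuous.integrable_of_hasCompactSupport (by fun_prop) ?_
  refine HasCompactSupport.intro hK fun s hs => ?_
  by_contra h0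
  exact hs ⟨(s, z), subset_tsupport _ h0, rfl⟩

/-- The convolution of two functions on graphs has a continuous density, whose trace on a third,
transversal graph is bounded in `L²`. -/
theorem exists_density_graph (h₀ : GraphPatch 0 M₀ m₀) (h₁ : GraphPatch 1 M₁ m₁)
    (h₂ : GraphPatch 2 M₂ m₂) {w₀ w₁ w₂ : V3 → ℝ} (hw₀ : ContinuousOn w₀ M₀)
    (hw₁ : ContinuousOn w₁ M₁) (hw₂ : ContinuousOn w₂ M₂)
    (hp₀ : ∀ x ∈ M₀, 0 < w₀ x) (hp₁ : ∀ x ∈ M₁, 0 < w₁ x)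
    {c : ℝ} (hc0 : 0 ≤ c) (hc : ∀ x ∈ M₀, ∀ y ∈ M₁, ∀ z ∈ M₂,
      w₀ x * w₁ y * w₂ z ≤ c * |(Matrix.of ![m₀ x, m₁ y, m₂ z]).det|) {f g : V3 → ℂ}
    (hf : ContinuousOn f M₀) (hg : ContinuousOn g M₁) {K₀ K₁ : Set V3} (hK₀ : IsCompact K₀)
    (hK₁ : IsCompact K₁) (hKM₀ : K₀ ⊆ M₀) (hKM₁ : K₁ ⊆ M₁) (hf0 : ∀ x ∉ K₀, f x = 0)
    (hg0 : ∀ x ∉ K₁, g x = 0) :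
    ∃ F : V3 → ℂ, Continuous F ∧ HasCompactSupport F ∧ (∀ ψ : V3 → ℂ, Continuous ψ →
      ∫ x, ∫ y, f x * g y * ψ (x + y) ∂((graphMeasure 1 M₁).withDensity (graphWeight M₁ w₁))
        ∂((graphMeasure 0 M₀).withDensity (graphWeight M₀ w₀)) = ∫ z, F z * ψ z) ∧
      ∫⁻ z, ‖F z‖ₑ ^ 2 ∂((graphMeasure 2 M₂).withDensity (graphWeight M₂ w₂)) ≤
        ENNReal.ofReal c *
          ((∫⁻ x, ‖f x‖ₑ ^ 2 ∂((graphMeasure 0 M₀).withDensity (graphWeight M₀ w₀))) *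
          ∫⁻ y, ‖g y‖ₑ ^ 2 ∂((graphMeasure 1 M₁).withDensity (graphWeight M₁ w₁))) := by
  set κ := convKernel m₀ m₁ w₀ w₁ f g with hκ
  have hκc : ContinuousOn κ (M₀ ×ˢ M₁) := continuousOn_convKernel h₀ h₁ hw₀ hw₁ hf hg
  have hκ0 : ∀ p ∉ K₀ ×ˢ K₁, κ p = 0 := by
    intro p hp
    rw [Set.mem_prod, not_and_or] at hp
    rcases hp with hp | hp
    · simp [hκ, convKernel, hf0 _ hp]
    · simp [hκ, convKernel, hg0 _ hp]
  have hKK := hK₀.prod hK₁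
  have hKM := Set.prod_mono hKM₀ hKM₁
  obtain ⟨hFc, hFs⟩ := continuous_pairDensity h₀ h₁ hκc hKK hKM hκ0
  refine ⟨pairDensity M₀ M₁ κ, hFc, hFs, fun ψ hψ => integral_conv_eq h₀ h₁ hw₀ hw₁ hp₀ hp₁ hf hg
    hK₀ hK₁ hKM₀ hKM₁ hf0 hg0 hψ, ?_⟩
  obtain ⟨hGc, hGs⟩ := continuous_pairDensity (K := fun p => ‖κ p‖) h₀ h₁ hκc.norm hKK hKM
    fun p hp => by simp [hκ0 p hp]
  obtain ⟨hHc, hHs⟩ := continuous_pairPush (K := fun p => ‖κ p‖) h₀ h₁ hκc.norm hKK hKM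
    fun p hp => by simp [hκ0 p hp]
  have hHn (q : ℝ × V3) : pairPush M₀ M₁ (fun p => ‖κ p‖) q = ‖pairPush M₀ M₁ κ q‖ := by
    by_cases hq : q ∈ pairRegion M₀ M₁ <;> simp [pairPush, hq]
  -- The trilinear estimate is for nonnegative functions. It is applied to `‖f‖` and `‖g‖`, whose
  -- density `a` dominates the norm of the complex density.
  set a : V3 → NNReal := fun z => Real.toNNReal (pairDensity M₀ M₁ (fun p => ‖κ p‖) z) with ha
  have hau : UniformContinuous a := by
    refine HasCompactSupport.uniformContinuous_of_continuous ?_ (by fun_prop)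
    exact hGs.comp_left Real.toNNReal_zero
  set k : V3 × V3 → ENNReal := (M₀ ×ˢ M₁).indicator fun p => ‖κ p‖ₑ with hk
  have hkm : Measurable k := measurable_indicator_of_continuousOn
    (h₀.measurableSet.prod h₁.measurableSet) hκc.enorm
  have hW₀ := measurable_graphWeight h₀ hw₀
  have hW₁ := measurable_graphWeight h₁ hw₁
  have hW₂ := measurable_graphWeight h₂ hw₂
  have hpush (q : ℝ × V3) : pairPush M₀ M₁ k q =
      ENNReal.ofReal (pairPush M₀ M₁ (fun p => ‖κ p‖) q) := by
    by_cases hq : q ∈ pairRegion M₀ M₁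
    · simp only [pairPush, Set.indicator_of_mem hq, Function.comp, hk]
      rw [Set.indicator_of_mem (Set.mk_mem_prod (pairInv_mem hq).1 (pairInv_mem hq).2),
        ofReal_norm]
    · simp [pairPush, hq]
  have hnn (z : V3) : 0 ≤ pairDensity M₀ M₁ (fun p => ‖κ p‖) z :=
    integral_nonneg fun s => by rw [hHn]; exact norm_nonneg _
  have hka (z : V3) : ∫⁻ s, pairPush M₀ M₁ k (s, z) = a z := by
    simp_rw [hpush]
    rw [← ofReal_integral_eq_lintegral_ofReal (integrable_left hHc hHs z)]
    · rfl
    · exact Filter.Eventually.of_forall fun s => by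
        simp only [hHn, Pi.zero_apply]; exact norm_nonneg _
  have hFa (z : V3) : ‖pairDensity M₀ M₁ κ z‖ₑ ≤ a z := by
    rw [← ofReal_norm]
    refine ENNReal.ofReal_le_ofReal ?_
    refine (norm_integral_le_integral_norm _).trans_eq ?_
    simp only [pairDensity, hHn]
  have hfm : Measurable fun x => ‖f x‖ₑ := by
    have := measurable_indicator_of_continuousOn h₀.measurableSet hf
    rw [Set.indicator_eq_self.2] at this
    · exact this.enorm
    · exact fun x hx => hKM₀ (by_contra fun h => hx (hf0 x h))
  have hgm : Measurable fun x => ‖g x‖ₑ := by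
    have := measurable_indicator_of_continuousOn h₁.measurableSet hg
    rw [Set.indicator_eq_self.2] at this
    · exact this.enorm
    · exact fun x hx => hKM₁ (by_contra fun h => hx (hg0 x h))
  have hk' : ∀ x ∈ M₀, ∀ y ∈ M₁,
      ENNReal.ofReal (pairJacobian m₀ m₁ (x, y)) * k (x, y) =
        graphWeight M₀ w₀ x * graphWeight M₁ w₁ y * (‖f x‖ₑ * ‖g y‖ₑ) := by
    intro x hx y hy
    have hj := abs_one_sub_pairJacobian_le h₀ h₁ (p := (x, y)) ⟨hx, hy⟩
    have hj0 : 0 ≤ pairJacobian m₀ m₁ (x, y) := by linarith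
    rw [hk, Set.indicator_of_mem (Set.mk_mem_prod hx hy), graphWeight, graphWeight,
      Set.indicator_of_mem hx, Set.indicator_of_mem hy, ← ofReal_norm,
      ← ofReal_norm, ← ofReal_norm, ← ENNReal.ofReal_mul hj0,
      ← ENNReal.ofReal_mul (hp₀ x hx).le, ← ENNReal.ofReal_mul (norm_nonneg _),
      ← ENNReal.ofReal_mul (mul_nonneg (hp₀ x hx).le (hp₁ y hy).le)]
    congr 1
    simp only [hκ, convKernel, norm_smul, norm_mul, Real.norm_eq_abs]
    rw [abs_of_nonneg (div_nonneg (mul_nonneg (hp₀ x hx).le (hp₁ y hy).le) hj0)]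
    have : pairJacobian m₀ m₁ (x, y) ≠ 0 := by linarith
    field_simp
  have hc' : ∀ x ∈ M₀, ∀ y ∈ M₁, ∀ z ∈ M₂,
      graphWeight M₀ w₀ x * graphWeight M₁ w₁ y * graphWeight M₂ w₂ z ≤
        ENNReal.ofReal c * ENNReal.ofReal |(Matrix.of ![m₀ x, m₁ y, m₂ z]).det| := by
    intro x hx y hy z hz
    rw [graphWeight, graphWeight, graphWeight, Set.indicator_of_mem hx, Set.indicator_of_mem hy,
      Set.indicator_of_mem hz, ← ENNReal.ofReal_mul (hp₀ x hx).le,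
      ← ENNReal.ofReal_mul (mul_nonneg (hp₀ x hx).le (hp₁ y hy).le), ← ENNReal.ofReal_mul hc0]
    exact ENNReal.ofReal_le_ofReal (hc x hx y hy z hz)
  have main := lintegral_density_sq_le h₀ h₁ h₂ hW₀ hW₁ hW₂ hc' hfm hgm hkm hk' hau hka
  rw [lintegral_withDensity_eq_lintegral_mul _ hW₂ (by fun_prop),
    lintegral_withDensity_eq_lintegral_mul _ hW₀ (by fun_prop),
    lintegral_withDensity_eq_lintegral_mul _ hW₁ (by fun_prop)]
  refine le_trans (lintegral_mono fun z => ?_) main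
  simp only [Pi.mul_apply]
  gcongr
  exact hFa z

end triple

/-! ### The area formula for swept surfaces -/

theorem euclideanHausdorffMeasure_image_le {X Y : Type*} [MetricSpace X] [MeasurableSpace X]
    [BorelSpace X] [MetricSpace Y] [MeasurableSpace Y] [BorelSpace Y] {f : X → Y} {s : Set X}
    {K : NNReal} (h : LipschitzOnWith K f s) :
    (μHE[2] : Measure Y) (f '' s) ≤ K ^ 2 * (μHE[2] : Measure X) s := by
  simp only [Measure.euclideanHausdorffMeasure_def, Measure.smul_apply, ENNReal.smul_def,
    smul_eq_mul]
  have := h.hausdorffMeasure_image_le (d := 2) (by norm_num)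
  rw [ENNReal.rpow_two] at this
  calc _ ≤ _ := mul_le_mul_right this _
    _ = _ := mul_left_comm _ _ _

theorem euclideanHausdorffMeasure_le_image {X Y : Type*} [MetricSpace X] [MeasurableSpace X]
    [BorelSpace X] [MetricSpace Y] [MeasurableSpace Y] [BorelSpace Y] {f : X → Y} {s : Set X}
    {K : NNReal} (h : ∀ x ∈ s, ∀ y ∈ s, dist x y ≤ K * dist (f x) (f y)) :
    (μHE[2] : Measure X) s ≤ K ^ 2 * (μHE[2] : Measure Y) (f '' s) := by
  rcases s.eq_empty_or_nonempty with rfl | ⟨x₀, -⟩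
  · simp
  have : Nonempty X := ⟨x₀⟩
  have hi : Set.InjOn f s := by
    intro x hx y hy hxy
    have := h x hx y hy
    rw [hxy, dist_self, mul_zero] at this
    exact dist_le_zero.1 this
  have e : Function.invFunOn f s '' (f '' s) = s := hi.invFunOn_image subset_rfl
  have hL : LipschitzOnWith K (Function.invFunOn f s) (f '' s) := by
    refine LipschitzOnWith.of_dist_le_mul ?_
    rintro _ ⟨x, hx, rfl⟩ _ ⟨y, hy, rfl⟩
    rw [hi.leftInvOn_invFunOn hx, hi.leftInvOn_invFunOn hy]
    exact h x hx y hy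
  have := euclideanHausdorffMeasure_image_le hL
  rwa [e] at this

/-- The union of the segments `[a, a + v)`, `a ∈ A`. -/
def sweep (A : Set E3) (v : E3) : Set E3 :=
  (fun p : E3 × ℝ => p.1 + p.2 • v) '' (A ×ˢ Set.Ico 0 1)

theorem mem_sweep {A : Set E3} {v z : E3} :
    z ∈ sweep A v ↔ ∃ a ∈ A, ∃ t ∈ Set.Ico (0 : ℝ) 1, a + t • v = z := by
  simp [sweep, and_assoc]

theorem injOn_sweep {M : Set E3} {v : E3} (inj : ∀ x ∈ M, ∀ t : ℝ, x + t • v ∈ M → t = 0) :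
    Set.InjOn (fun p : E3 × ℝ => p.1 + p.2 • v) (M ×ˢ Set.univ) := by
  rintro ⟨x, s⟩ ⟨hx, -⟩ ⟨y, t⟩ ⟨hy, -⟩ h
  simp only at h hx hy
  have e : x + (s - t) • v = y := by
    rw [sub_smul, ← add_sub_assoc, h]; abel
  have h0 := inj x hx (s - t) (by rwa [e])
  rw [h0, zero_smul, add_zero] at e
  exact Prod.ext e (by simpa [sub_eq_zero] using h0)

theorem measurableSet_sweep {M A : Set E3} {v : E3}
    (inj : ∀ x ∈ M, ∀ t : ℝ, x + t • v ∈ M → t = 0) (hA : MeasurableSet A) (hAM : A ⊆ M) :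
    MeasurableSet (sweep A v) :=
  (hA.prod measurableSet_Ico).image_of_continuousOn_injOn
    (Continuous.continuousOn (by fun_prop))
    ((injOn_sweep inj).mono (Set.prod_mono hAM (Set.subset_univ _)))

section flat

variable {A : Set E3} {N v : E3}

/-- The part of `A` over which the segment `[a, a + v)` meets the plane at height `x`. -/
def sliceBase (A : Set E3) (N v : E3) (x : ℝ) : Set E3 :=
  {a | a ∈ A ∧ (x - inner ℝ N a) / inner ℝ N v ∈ Set.Ico (0 : ℝ) 1}

/-- The projection along `v` to the plane orthogonal to `N` at height `x`. -/
noncomputable def planeProj (N v : E3) (x : ℝ) (a : E3) : E3 :=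
  a + ((x - inner ℝ N a) / inner ℝ N v) • v

theorem sweep_inter_plane (hv : inner ℝ N v ≠ 0) (hN : ‖N‖ = 1) (x : ℝ) :
    sweep A v ∩ AffineSubspace.mk' (x • N +ᵥ (0 : E3)) (ℝ ∙ N)ᗮ =
      planeProj N v x '' sliceBase A N v x := by
  have hmem (z : E3) : z ∈ (AffineSubspace.mk' (x • N +ᵥ (0 : E3)) (ℝ ∙ N)ᗮ : Set E3) ↔
      inner ℝ N z = x := by
    rw [SetLike.mem_coe, AffineSubspace.mem_mk', Submodule.mem_orthogonal_singleton_iff_inner_right]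
    simp only [vadd_eq_add, add_zero, vsub_eq_sub, inner_sub_right, inner_smul_right,
      real_inner_self_eq_norm_sq, hN]
    constructor <;> intro h <;> linarith
  ext z
  rw [Set.mem_inter_iff, hmem, mem_sweep]
  constructor
  · rintro ⟨⟨a, ha, t, ht, rfl⟩, hx⟩
    have e : (x - inner ℝ N a) / inner ℝ N v = t := by
      rw [← hx, inner_add_right, inner_smul_right, add_sub_cancel_left, mul_div_cancel_right₀ _ hv]
    exact ⟨a, ⟨ha, by rwa [e]⟩, by rw [planeProj, e]⟩
  · rintro ⟨a, ⟨ha, ht⟩, rfl⟩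
    refine ⟨⟨a, ha, _, ht, rfl⟩, ?_⟩
    rw [planeProj, inner_add_right, inner_smul_right, div_mul_cancel₀ _ hv]
    ring

/-- Cavalieri's principle: the volume is the integral of the areas of the slices orthogonal to `N`,
and each slice is the projection along `v` of the points whose segment reaches that plane. -/
theorem volume_sweep_eq (hv : inner ℝ N v ≠ 0) (hN : ‖N‖ = 1) (hs : MeasurableSet (sweep A v)) :
    volume (sweep A v) = ∫⁻ x, (μHE[2] : Measure E3) (planeProj N v x '' sliceBase A N v x) := by
  have hN0 : N ≠ 0 := by
    intro h; simp [h] at hN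
  have h1 := EuclideanGeometry.euclideanHausdorffMeasure_eq_lintegral (0 : E3) hN0 hs
  rw [finrank_euclideanSpace_fin, EuclideanSpace.euclideanHausdorffMeasure_eq_volume] at h1
  rw [h1, ← ofReal_norm, hN, ENNReal.ofReal_one, one_mul]
  exact lintegral_congr fun x => by rw [sweep_inter_plane hv hN]

theorem abs_norm_planeProj_sub_le {ε : ℝ}
    (hflat : ∀ x ∈ A, ∀ y ∈ A, |inner ℝ N (x - y)| ≤ ε * ‖x - y‖) (s : ℝ)
    {x y : E3} (hx : x ∈ A) (hy : y ∈ A) :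
    ‖(planeProj N v s x - planeProj N v s y) - (x - y)‖ ≤
      ε * ‖v‖ / |inner ℝ N v| * ‖x - y‖ := by
  have e : (planeProj N v s x - planeProj N v s y) - (x - y) =
      (-(inner ℝ N (x - y) / inner ℝ N v)) • v := by
    simp only [planeProj, inner_sub_right]
    have : -((inner ℝ N x - inner ℝ N y) / inner ℝ N v) =
      (s - inner ℝ N x) / inner ℝ N v - (s - inner ℝ N y) / inner ℝ N v := by ring
    rw [this, sub_smul]
    abel
  rw [e, norm_smul, norm_neg, norm_div, Real.norm_eq_abs, Real.norm_eq_abs]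
  calc |inner ℝ N (x - y)| / |inner ℝ N v| * ‖v‖ ≤ ε * ‖x - y‖ / |inner ℝ N v| * ‖v‖ := by
        gcongr
        exact hflat x hx y hy
    _ = _ := by ring

/-- Tonelli's theorem: for a fixed `a`, the heights of the planes met by its segment form an
interval of length `|⟪N, v⟫|`. Finiteness of the area of `A` is what makes Tonelli applicable. -/
theorem lintegral_sliceBase (hv : inner ℝ N v ≠ 0)
    (hfin : (μHE[2] : Measure E3) A ≠ ⊤) :
    ∫⁻ x, (μHE[2] : Measure E3) (sliceBase A N v x) =
      ENNReal.ofReal |inner ℝ N v| * (μHE[2] : Measure E3) A := by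
  set b := inner ℝ N v with hb
  have : Fact ((μHE[2] : Measure E3) A < ⊤) := ⟨lt_top_iff_ne_top.2 hfin⟩
  let S : Set (ℝ × E3) := {p | (p.1 - inner ℝ N p.2) / b ∈ Set.Ico (0 : ℝ) 1}
  have hS : MeasurableSet S := by
    have : Measurable fun p : ℝ × E3 => (p.1 - inner ℝ N p.2) / b :=
      Continuous.measurable (by fun_prop)
    exact this measurableSet_Ico
  have h1 (x : ℝ) : (μHE[2] : Measure E3) (sliceBase A N v x) =
      ∫⁻ a in A, S.indicator 1 (x, a) ∂μHE[2] := by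
    have hm : MeasurableSet {a | (x, a) ∈ S} := measurable_prodMk_left hS
    have e : (fun a => S.indicator (1 : ℝ × E3 → ENNReal) (x, a)) =
        {a | (x, a) ∈ S}.indicator 1 := by
      ext a; rfl
    rw [e, lintegral_indicator_one hm, Measure.restrict_apply hm, Set.inter_comm]
    rfl
  simp_rw [h1]
  rw [lintegral_lintegral_swap (f := fun x a => S.indicator 1 (x, a))
    (measurable_one.indicator hS).aemeasurable]
  have h2 (a : E3) : ∫⁻ x, S.indicator (1 : ℝ × E3 → ENNReal) (x, a) = ENNReal.ofReal |b| := by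
    have hm : MeasurableSet {x | (x, a) ∈ S} := measurable_prodMk_right hS
    have e : (fun x => S.indicator (1 : ℝ × E3 → ENNReal) (x, a)) =
        {x | (x, a) ∈ S}.indicator 1 := by
      ext x; rfl
    have e2 : {x | (x, a) ∈ S} =
        (fun x : ℝ => x + -inner ℝ N a) ⁻¹' ((fun x => x * b⁻¹) ⁻¹' Set.Ico 0 1) := by
      ext x
      simp only [S, Set.mem_ofPred_eq, Set.mem_preimage, div_eq_mul_inv, sub_eq_add_neg]
    rw [e, lintegral_indicator_one hm, e2, measure_preimage_add_right,
      Real.volume_preimage_mul_right (inv_ne_zero hv)]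
    simp
  simp_rw [h2]
  simp

/-- The projection is a bounded subset of a plane, where two-dimensional Hausdorff measure is
locally finite. Through the comparison below, this shows that flat bounded pieces have finite area.
-/
theorem measure_planeProj_image_lt_top (hN : ‖N‖ = 1) (hv : inner ℝ N v ≠ 0)
    (hA : Bornology.IsBounded A) : (μHE[2] : Measure E3) (planeProj N v 0 '' A) < ⊤ := by
  have hN0 : N ≠ 0 := by
    intro h; simp [h] at hN
  let s : Submodule ℝ E3 := (ℝ ∙ N)ᗮ
  have hr : Module.finrank ℝ s = 2 := by
    have : Fact (Module.finrank ℝ E3 = 2 + 1) := ⟨by simp⟩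
    exact Submodule.finrank_orthogonal_span_singleton hN0
  have hsub : planeProj N v 0 '' A ⊆ Set.range (Subtype.val : s → E3) := by
    rintro _ ⟨a, -, rfl⟩
    refine ⟨⟨_, ?_⟩, rfl⟩
    rw [Submodule.mem_orthogonal_singleton_iff_inner_right]
    show inner ℝ N (a + ((0 - inner ℝ N a) / inner ℝ N v) • v) = 0
    rw [inner_add_right, inner_smul_right, div_mul_cancel₀ _ hv]
    ring
  have hb : Bornology.IsBounded (planeProj N v 0 '' A) := by
    obtain ⟨K, hK⟩ : ∃ K, LipschitzWith K (planeProj N v 0) := by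
      let L : E3 →L[ℝ] E3 := ContinuousLinearMap.id ℝ E3 -
        ((inner ℝ N v)⁻¹ • innerSL ℝ N).smulRight v
      have e : planeProj N v 0 = L := by
        ext1 a
        simp [planeProj, L, sub_eq_add_neg, neg_smul, div_eq_inv_mul]
      exact ⟨‖L‖₊, e ▸ L.lipschitz⟩
    exact hK.isBounded_image hA
  have e : planeProj N v 0 '' A = Subtype.val '' (Subtype.val ⁻¹' (planeProj N v 0 '' A) : Set s) := by
    rw [Set.image_preimage_eq_inter_range, Set.inter_eq_left.2 hsub]
  rw [e, isometry_subtype_coe.euclideanHausdorffMeasure_image]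
  have h2 : (μHE[2] : Measure s) = μHE[Module.finrank ℝ s] := by rw [hr]
  rw [h2]
  exact (isometry_subtype_coe.antilipschitz.isBounded_preimage hb).measure_lt_top

/-- On a set nearly orthogonal to `N` the projection changes differences by at most the fraction
`η`. It is bi-Lipschitz with constants `1 + η` and `(1 - η)⁻¹`, and areas change by at most their
squares. -/
theorem planeProj_bounds {η : NNReal} (hη : η < 1)
    (hflat : ∀ x ∈ A, ∀ y ∈ A, |inner ℝ N (x - y)| ≤ η * |inner ℝ N v| / ‖v‖ * ‖x - y‖)
    (hv : inner ℝ N v ≠ 0) (s : ℝ) {B : Set E3} (hB : B ⊆ A) :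
    (μHE[2] : Measure E3) (planeProj N v s '' B) ≤
      ((1 + η : NNReal) : ENNReal) ^ 2 * (μHE[2] : Measure E3) B ∧
    (μHE[2] : Measure E3) B ≤
      (((1 - η)⁻¹ : NNReal) : ENNReal) ^ 2 * (μHE[2] : Measure E3) (planeProj N v s '' B) := by
  have hv0 : 0 < ‖v‖ := norm_pos_iff.2 (by rintro rfl; simp at hv)
  have hb0 : 0 < |inner ℝ N v| := abs_pos.2 hv
  have key {x y : E3} (hx : x ∈ B) (hy : y ∈ B) :
      ‖(planeProj N v s x - planeProj N v s y) - (x - y)‖ ≤ η * ‖x - y‖ := by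
    refine (abs_norm_planeProj_sub_le hflat s (hB hx) (hB hy)).trans_eq ?_
    field_simp
  constructor
  · refine euclideanHausdorffMeasure_image_le (LipschitzOnWith.of_dist_le_mul ?_)
    intro x hx y hy
    rw [dist_eq_norm, dist_eq_norm, NNReal.coe_add, NNReal.coe_one]
    have := norm_le_norm_add_norm_sub (x - y) (planeProj N v s x - planeProj N v s y)
    rw [norm_sub_rev (x - y)] at this
    linarith [key hx hy]
  · refine euclideanHausdorffMeasure_le_image ?_
    intro x hx y hy
    rw [dist_eq_norm, dist_eq_norm, NNReal.coe_inv, NNReal.coe_sub hη.le, NNReal.coe_one]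
    have h1 : (0 : ℝ) < 1 - η := by
      have : (η : ℝ) < 1 := by exact_mod_cast hη
      linarith
    rw [inv_mul_eq_div, le_div_iff₀ h1]
    have := norm_le_norm_add_norm_sub (planeProj N v s x - planeProj N v s y) (x - y)
    linarith [key hx hy]

theorem measure_lt_top_of_flat {η : NNReal} (hη : η < 1)
    (hflat : ∀ x ∈ A, ∀ y ∈ A, |inner ℝ N (x - y)| ≤ η * |inner ℝ N v| / ‖v‖ * ‖x - y‖)
    (hN : ‖N‖ = 1) (hv : inner ℝ N v ≠ 0) (hA : Bornology.IsBounded A) :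
    (μHE[2] : Measure E3) A < ⊤ := by
  refine (planeProj_bounds hη hflat hv 0 subset_rfl).2.trans_lt ?_
  exact ENNReal.mul_lt_top (ENNReal.pow_lt_top ENNReal.coe_lt_top)
    (measure_planeProj_image_lt_top hN hv hA)

theorem volume_sweep_bounds {η : NNReal} (hη : η < 1)
    (hflat : ∀ x ∈ A, ∀ y ∈ A, |inner ℝ N (x - y)| ≤ η * |inner ℝ N v| / ‖v‖ * ‖x - y‖)
    (hN : ‖N‖ = 1) (hv : inner ℝ N v ≠ 0) (hA : Bornology.IsBounded A)
    (hs : MeasurableSet (sweep A v)) :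
    volume (sweep A v) ≤ ((1 + η : NNReal) : ENNReal) ^ 2 *
      (ENNReal.ofReal |inner ℝ N v| * (μHE[2] : Measure E3) A) ∧
    ENNReal.ofReal |inner ℝ N v| * (μHE[2] : Measure E3) A ≤
      (((1 - η)⁻¹ : NNReal) : ENNReal) ^ 2 * volume (sweep A v) := by
  have hfin := (measure_lt_top_of_flat hη hflat hN hv hA).ne
  rw [volume_sweep_eq hv hN hs, ← lintegral_sliceBase hv hfin]
  have hsub (x : ℝ) : sliceBase A N v x ⊆ A := fun a ha => ha.1
  rw [← lintegral_const_mul' _ _ (ENNReal.pow_ne_top ENNReal.coe_ne_top),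
    ← lintegral_const_mul' _ _ (ENNReal.pow_ne_top ENNReal.coe_ne_top)]
  exact ⟨lintegral_mono fun x => (planeProj_bounds hη hflat hv x (hsub x)).1,
    lintegral_mono fun x => (planeProj_bounds hη hflat hv x (hsub x)).2⟩

end flat

/-- `n` is a unit normal field on `M` along which `M` is strictly differentiable, and `M` is a
graph in the direction `v` transversal to it. -/
structure FlatGraph (M : Set E3) (n : E3 → E3) (v : E3) : Prop where
  measurableSet : MeasurableSet M
  norm_eq : ∀ p ∈ M, ‖n p‖ = 1
  cont : ContinuousOn n M
  transversal : ∀ p ∈ M, inner ℝ (n p) v ≠ 0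
  flat : ∀ p ∈ M, ∀ ε > (0 : ℝ), ∃ W ∈ 𝓝 p, ∀ x ∈ M ∩ W, ∀ y ∈ M ∩ W,
    |inner ℝ (n p) (x - y)| ≤ ε * ‖x - y‖
  inj : ∀ x ∈ M, ∀ t : ℝ, x + t • v ∈ M → t = 0

theorem FlatGraph.exists_local_bounds {M : Set E3} {n : E3 → E3} {v : E3} (h : FlatGraph M n v)
    {τ : NNReal} (hτ : 0 < τ) {p : E3} (hp : p ∈ M) :
    ∃ W ∈ 𝓝 p, IsOpen W ∧ ∀ A ⊆ M ∩ W, MeasurableSet A →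
      volume (sweep A v) ≤ ((1 + τ : NNReal) : ENNReal) ^ 3 *
        ∫⁻ x in A, ENNReal.ofReal |inner ℝ (n x) v| ∂μHE[2] ∧
      ∫⁻ x in A, ENNReal.ofReal |inner ℝ (n x) v| ∂μHE[2] ≤
        ((1 + τ : NNReal) : ENNReal) ^ 3 * volume (sweep A v) := by
  have hv := h.transversal p hp
  have hv0 : 0 < ‖v‖ := norm_pos_iff.2 (by rintro rfl; simp at hv)
  have hb0 : 0 < |inner ℝ (n p) v| := abs_pos.2 hv
  -- Chosen so that `(1 - η)⁻¹ = 1 + τ` and `η ≤ τ`: both area distortions are then at most `(1 + τ)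
  -- ^ 2`. A third factor `1 + τ` pays for freezing the normal at `p`.
  set η : NNReal := τ / (1 + τ) with hη
  have hη1 : η < 1 := by
    rw [hη, div_lt_one (by positivity)]; exact lt_add_of_pos_left _ one_pos
  have hη2 : (1 - η)⁻¹ = 1 + τ := by
    have : 1 - η = (1 + τ)⁻¹ := by
      rw [hη, tsub_eq_iff_eq_add_of_le (by rw [← hη]; exact hη1.le)]
      field_simp
    rw [this, inv_inv]
  have hη3 : η ≤ τ := by
    rw [hη]; exact div_le_self zero_le (by simp)
  have hη0 : 0 < η := by positivity
  obtain ⟨W₁, hW₁, hflat⟩ := h.flat p hp (η * |inner ℝ (n p) v| / ‖v‖) (by positivity)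
  have hc : ContinuousOn (fun x => |inner ℝ (n x) v|) M :=
    (h.cont.inner continuousOn_const).abs
  have hlim := hc p hp
  have hτ' : (0 : ℝ) < τ := hτ
  have hW₂ : {x | |inner ℝ (n p) v| < (1 + τ) * |inner ℝ (n x) v| ∧
      |inner ℝ (n x) v| < (1 + τ) * |inner ℝ (n p) v|} ∈ 𝓝[M] p := by
    have e1 := (hlim.const_mul ((1 : ℝ) + τ)).eventually_const_lt
      (u := |inner ℝ (n p) v|) (by nlinarith)
    have e2 := hlim.eventually_lt_const (u := (1 + τ) * |inner ℝ (n p) v|) (by nlinarith)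
    filter_upwards [e1, e2] with x h1 h2 using ⟨h1, h2⟩
  rw [mem_nhdsWithin_iff_exists_mem_nhds_inter] at hW₂
  obtain ⟨W₂, hW₂, hsub⟩ := hW₂
  obtain ⟨W, hWsub, hWo, hpW⟩ := mem_nhds_iff.1
    (Filter.inter_mem (Filter.inter_mem hW₁ hW₂) (Metric.ball_mem_nhds p one_pos))
  refine ⟨W, hWo.mem_nhds hpW, hWo, fun A hA hAm => ?_⟩
  have hAM : A ⊆ M := fun x hx => (hA hx).1
  have hflatA : ∀ x ∈ A, ∀ y ∈ A,
      |inner ℝ (n p) (x - y)| ≤ η * |inner ℝ (n p) v| / ‖v‖ * ‖x - y‖ := fun x hx y hy =>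
    hflat x ⟨hAM hx, (hWsub (hA hx).2).1.1⟩ y ⟨hAM hy, (hWsub (hA hy).2).1.1⟩
  have hAb : Bornology.IsBounded A := Metric.isBounded_ball.subset fun x hx => (hWsub (hA hx).2).2
  obtain ⟨b1, b2⟩ := volume_sweep_bounds hη1 hflatA (h.norm_eq p hp) hv hAb
    (measurableSet_sweep h.inj hAm hAM)
  have hb (x) (hx : x ∈ A) := hsub ⟨(hWsub (hA hx).2).1.2, hAM hx⟩
  have c1 : ENNReal.ofReal |inner ℝ (n p) v| * (μHE[2] : Measure E3) A ≤
      ((1 + τ : NNReal) : ENNReal) * ∫⁻ x in A, ENNReal.ofReal |inner ℝ (n x) v| ∂μHE[2] := by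
    rw [← setLIntegral_const, ← lintegral_const_mul' _ _ ENNReal.coe_ne_top]
    refine setLIntegral_mono' hAm fun x hx => ?_
    rw [← ENNReal.ofReal_coe_nnreal, ← ENNReal.ofReal_mul (by positivity)]
    exact ENNReal.ofReal_le_ofReal (by simpa using (hb x hx).1.le)
  have c2 : ∫⁻ x in A, ENNReal.ofReal |inner ℝ (n x) v| ∂μHE[2] ≤
      ((1 + τ : NNReal) : ENNReal) *
        (ENNReal.ofReal |inner ℝ (n p) v| * (μHE[2] : Measure E3) A) := by
    rw [← setLIntegral_const, ← lintegral_const_mul' _ _ ENNReal.coe_ne_top]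
    refine setLIntegral_mono' hAm fun x hx => ?_
    rw [← ENNReal.ofReal_coe_nnreal, ← ENNReal.ofReal_mul (by positivity)]
    exact ENNReal.ofReal_le_ofReal (by simpa using (hb x hx).2.le)
  constructor
  · calc _ ≤ _ := b1
      _ ≤ ((1 + τ : NNReal) : ENNReal) ^ 2 * (((1 + τ : NNReal) : ENNReal) *
          ∫⁻ x in A, ENNReal.ofReal |inner ℝ (n x) v| ∂μHE[2]) := by
          gcongr
      _ = _ := by ring
  · rw [hη2] at b2
    calc _ ≤ _ := c2
      _ ≤ ((1 + τ : NNReal) : ENNReal) * (((1 + τ : NNReal) : ENNReal) ^ 2 *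
          volume (sweep A v)) := by gcongr
      _ = _ := by ring

/-- The area formula: the volume swept out by moving a piece of surface along `v`. -/
theorem FlatGraph.volume_sweep {M : Set E3} {n : E3 → E3} {v : E3} (h : FlatGraph M n v)
    {A : Set E3} (hA : MeasurableSet A) (hAM : A ⊆ M) :
    volume (sweep A v) = ∫⁻ x in A, ENNReal.ofReal |inner ℝ (n x) v| ∂μHE[2] := by
  have main (τ : NNReal) (hτ : 0 < τ) : volume (sweep A v) ≤ ((1 + τ : NNReal) : ENNReal) ^ 3 *
        ∫⁻ x in A, ENNReal.ofReal |inner ℝ (n x) v| ∂μHE[2] ∧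
      ∫⁻ x in A, ENNReal.ofReal |inner ℝ (n x) v| ∂μHE[2] ≤
        ((1 + τ : NNReal) : ENNReal) ^ 3 * volume (sweep A v) := by
    choose! W hW hWo hWb using fun p (hp : p ∈ M) => h.exists_local_bounds hτ hp
    obtain ⟨t, htM, htc, hcov⟩ := TopologicalSpace.countable_cover_nhdsWithin
      (fun p hp => mem_nhdsWithin_of_mem_nhds (hW p hp))
    rcases t.eq_empty_or_nonempty with rfl | htn
    · have : A = ∅ := by
        rw [← Set.subset_empty_iff]
        exact hAM.trans (hcov.trans (by simp))
      simp [this, sweep]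
    obtain ⟨q, rfl⟩ := htc.exists_eq_range htn
    -- A countable cover by good neighbourhoods is made disjoint. The sweeps of the disjoint pieces
    -- are disjoint too, since the surface is a graph along `v`, so the local bounds add up.
    set B : ℕ → Set E3 := fun k => A ∩ disjointed (fun k => W (q k)) k with hB
    have hBm (k) : MeasurableSet (B k) :=
      hA.inter (MeasurableSet.disjointed (fun k => (hWo _ (htM ⟨k, rfl⟩)).measurableSet) k)
    have hBd : Pairwise (Function.onFun Disjoint B) := fun i j hij =>
      ((disjoint_disjointed _) hij).mono Set.inter_subset_right Set.inter_subset_right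
    have hBA : ⋃ k, B k = A := by
      rw [hB, ← Set.inter_iUnion, iUnion_disjointed, Set.inter_eq_left]
      refine hAM.trans (hcov.trans ?_)
      simp
    have hBM (k) : B k ⊆ M := Set.inter_subset_left.trans hAM
    have hsw : sweep A v = ⋃ k, sweep (B k) v := by
      rw [← hBA]
      simp only [sweep, Set.iUnion_prod_const, Set.image_iUnion]
    have hswd : Pairwise (Function.onFun Disjoint fun k => sweep (B k) v) := by
      intro i j hij
      refine Set.disjoint_left.2 ?_
      rintro _ ⟨p, hp, rfl⟩ ⟨p', hp', e⟩
      have := injOn_sweep h.inj ⟨hBM j hp'.1, trivial⟩ ⟨hBM i hp.1, trivial⟩ e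
      rw [this] at hp'
      exact Set.disjoint_left.1 (hBd hij) hp.1 hp'.1
    have hvol : volume (sweep A v) = ∑' k, volume (sweep (B k) v) := by
      rw [hsw, measure_iUnion hswd fun k => measurableSet_sweep h.inj (hBm k) (hBM k)]
    have hint : ∫⁻ x in A, ENNReal.ofReal |inner ℝ (n x) v| ∂μHE[2] =
        ∑' k, ∫⁻ x in B k, ENNReal.ofReal |inner ℝ (n x) v| ∂μHE[2] := by
      conv_lhs => rw [← hBA]
      exact lintegral_iUnion hBm hBd _
    have hb (k) := hWb (q k) (htM ⟨k, rfl⟩) (B k)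
      (fun x hx => ⟨hBM k hx, disjointed_subset (fun k => W (q k)) k hx.2⟩) (hBm k)
    rw [hvol, hint, ← ENNReal.tsum_mul_left, ← ENNReal.tsum_mul_left]
    exact ⟨ENNReal.tsum_le_tsum fun k => (hb k).1, ENNReal.tsum_le_tsum fun k => (hb k).2⟩
  have hlim (X : ENNReal) : Filter.Tendsto (fun k : ℕ =>
      ((1 + 1 / ((k : NNReal) + 1) : NNReal) : ENNReal) ^ 3 * X) Filter.atTop (𝓝 X) := by
    have h2 : Filter.Tendsto (fun n : ℕ => 1 / ((n : NNReal) + 1)) Filter.atTop (𝓝 0) := by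
      rw [← NNReal.tendsto_coe]
      simpa using tendsto_one_div_add_atTop_nhds_zero_nat (𝕜 := ℝ)
    have h3 : Filter.Tendsto (fun n : ℕ => 1 + 1 / ((n : NNReal) + 1)) Filter.atTop (𝓝 1) := by
      simpa using h2.const_add 1
    have h4 := ENNReal.Tendsto.mul_const (b := X)
      (ENNReal.Tendsto.pow (n := 3) ((ENNReal.continuous_coe.tendsto _).comp h3)) (Or.inl (by simp))
    simpa using h4
  exact le_antisymm
    (ge_of_tendsto' (hlim _) fun k => (main _ (by positivity)).1)
    (ge_of_tendsto' (hlim _) fun k => (main _ (by positivity)).2)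

/-! ### Surfaces with Hölder normals as level sets -/

/-- A surface with a Hölder continuous unit normal field `n`. -/
structure HolderSurface (β : ℝ) (S : Set E3) (n : E3 → E3) : Prop where
  isBounded : Bornology.IsBounded S
  isLocallyClosed : IsLocallyClosed S
  norm_eq : ∀ σ ∈ S, ‖n σ‖ = 1
  holder : ∀ σ ∈ S, ∀ τ ∈ S, ‖n σ - n τ‖ ≤ ‖σ - τ‖ ^ β
  flat : ∀ σ ∈ S, ∀ τ ∈ S, |inner ℝ (n σ) (σ - τ)| ≤ ‖σ - τ‖ ^ β * ‖σ - τ‖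
  normal : ∀ σ ∈ S, ∀ w ∈ tangentConeAt ℝ S σ, inner ℝ (n σ) w = 0
  tangent : ∀ σ ∈ S, ∀ w, inner ℝ (n σ) w = 0 → w ∈ tangentConeAt ℝ S σ
  exists_nhds : ∀ σ ∈ S, ∀ v, inner ℝ (n σ) v ≠ 0 → ∀ W ∈ 𝓝 σ,
    {x | ∃ t : ℝ, x - t • v ∈ S ∩ W} ∈ 𝓝 σ

section levelSet

variable {E : Type*} [NormedAddCommGroup E] [NormedSpace ℝ E] [CompleteSpace E]
  {Φ : E → ℝ} {Φ' : E →L[ℝ] ℝ} {p : E}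

/-- The implicit function theorem parametrizes the level set by the kernel of the derivative, and
the parametrization is differentiable at 0 with derivative the inclusion. -/
theorem mem_tangentConeAt_levelSet (h : HasStrictFDerivAt Φ Φ' p) (h0 : Φ' ≠ 0) {V : Set E}
    (hV : V ∈ 𝓝 p) {w : E} (hw : Φ' w = 0) : w ∈ tangentConeAt ℝ ({x | Φ x = Φ p} ∩ V) p := by
  have hr : Φ'.range = ⊤ := by
    rw [LinearMap.range_eq_top]
    exact LinearMap.surjective fun h1 => h0 (ContinuousLinearMap.ext fun x =>
      LinearMap.congr_fun h1 x)
  set g := h.implicitFunction Φ Φ' hr (Φ p) with hg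
  have hd : HasStrictFDerivAt g Φ'.ker.subtypeL 0 := h.to_implicitFunction hr
  have hg0 : g 0 = p := h.implicitFunction_apply_image hr
  have e1 : ∀ᶠ z in 𝓝 (0 : Φ'.ker), Φ (g z) = Φ p := by
    have h1 := h.map_implicitFunction_eq hr
    have h2 : Filter.Tendsto (fun z : Φ'.ker => (Φ p, z)) (𝓝 0) (𝓝 (Φ p, 0)) :=
      Continuous.tendsto (by fun_prop) 0
    exact h2.eventually h1
  have e2 : ∀ᶠ z in 𝓝 (0 : Φ'.ker), g z ∈ V :=
    hd.continuousAt.eventually (by rw [hg0]; exact hV)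
  have hmem := e1.and e2
  have := hd.hasFDerivAt.hasFDerivWithinAt.mapsTo_tangent_cone
    (s := {z | Φ (g z) = Φ p ∧ g z ∈ V})
  rw [tangentConeAt_of_mem_nhds hmem, hg0] at this
  refine tangentConeAt_mono ?_ (this (Set.mem_univ (⟨w, hw⟩ : Φ'.ker)))
  rintro _ ⟨z, hz, rfl⟩
  exact hz

/-- Every point near `p` can be moved along a transversal direction onto the level set. The map `(t,
x) ↦ (Φ (x - t • v), x)` has surjective derivative, so it attains all nearby values with first entry
`Φ p`. -/
theorem exists_sub_smul_mem_levelSet (h : HasStrictFDerivAt Φ Φ' p) {v : E} (hv : Φ' v ≠ 0)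
    {V : Set E} (hV : V ∈ 𝓝 p) : {x | ∃ t : ℝ, x - t • v ∈ {x | Φ x = Φ p} ∩ V} ∈ 𝓝 p := by
  let Θ : ℝ × E → ℝ × E := fun q => (Φ (q.2 - q.1 • v), q.2)
  let D : ℝ × E →L[ℝ] ℝ × E :=
    (Φ'.comp (ContinuousLinearMap.snd ℝ ℝ E - (ContinuousLinearMap.fst ℝ ℝ E).smulRight v)).prod
      (ContinuousLinearMap.snd ℝ ℝ E)
  have h1 : HasStrictFDerivAt (fun q : ℝ × E => q.2 - q.1 • v)
      (ContinuousLinearMap.snd ℝ ℝ E - (ContinuousLinearMap.fst ℝ ℝ E).smulRight v) (0, p) :=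
    hasStrictFDerivAt_snd.sub
      ((ContinuousLinearMap.fst ℝ ℝ E).smulRight v).hasStrictFDerivAt
  have hD : HasStrictFDerivAt Θ D (0, p) := by
    refine HasStrictFDerivAt.prodMk (HasStrictFDerivAt.comp (0, p)
      (f := fun q : ℝ × E => q.2 - q.1 • v) ?_ h1) hasStrictFDerivAt_snd
    simpa using h
  have hs : D.range = ⊤ := by
    rw [LinearMap.range_eq_top]
    rintro ⟨a, x⟩
    refine ⟨((Φ' x - a) / Φ' v, x), ?_⟩
    simp only [D, ContinuousLinearMap.coe_coe, ContinuousLinearMap.prod_apply,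
      ContinuousLinearMap.comp_apply, sub_apply, ContinuousLinearMap.coe_snd',
      ContinuousLinearMap.smulRight_apply, ContinuousLinearMap.coe_fst', map_sub, map_smul,
      smul_eq_mul]
    rw [div_mul_cancel₀ _ hv, sub_sub_cancel]
  have hmap := hD.map_nhds_eq_of_surj hs
  have hN : {q : ℝ × E | q.2 - q.1 • v ∈ V} ∈ 𝓝 ((0 : ℝ), p) := by
    refine h1.continuousAt ?_
    simpa using hV
  have hI := Filter.image_mem_map (m := Θ) hN
  have hΘ : Θ (0, p) = (Φ p, p) := by simp [Θ]
  rw [hmap, hΘ] at hI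
  have hc : Filter.Tendsto (fun x : E => (Φ p, x)) (𝓝 p) (𝓝 (Φ p, p)) :=
    Continuous.tendsto (by fun_prop) p
  filter_upwards [hc hI] with x hx
  obtain ⟨q, hq, hqx⟩ := hx
  simp only [Θ, Prod.mk.injEq] at hqx
  refine ⟨q.1, ?_, ?_⟩
  · rw [← hqx.2]; exact hqx.1
  · rw [← hqx.2]; exact hq

end levelSet

/-- The defining function is used here only: the implicit function theorem supplies the full tangent
plane and the graph property. All later estimates use the normal field alone. -/
theorem SurfaceAssumptionWith.holderSurface {β θ : ℝ} {S Sstar U : Fin 3 → Set E3}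
    {Φ : Fin 3 → E3 → ℝ} {n : Fin 3 → E3 → E3} (h : SurfaceAssumptionWith β 1 θ S Sstar U Φ n)
    (i : Fin 3) : HolderSurface β (S i) (n i) := by
  obtain ⟨O, hO, hSO⟩ := h.relOpen i
  have hsub : S i ⊆ Sstar i := by rw [hSO]; exact Set.inter_subset_left
  have hU := h.isOpen_domain i
  have hmemU {σ} (hσ : σ ∈ S i) : σ ∈ U i ∧ Φ i σ = 0 := by
    have := hsub hσ
    rwa [h.star_eq i] at this
  have hC := (h.regular i).1
  have hstrict {σ} (hσ : σ ∈ S i) : HasStrictFDerivAt (Φ i) (fderiv ℝ (Φ i) σ) σ :=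
    (hC.contDiffAt (hU.mem_nhds (hmemU hσ).1)).hasStrictFDerivAt (by norm_num)
  have hlevel {σ} (hσ : σ ∈ S i) : {x | Φ i x = Φ i σ} ∩ (U i ∩ O) = S i := by
    rw [hSO, h.star_eq i, (hmemU hσ).2]
    ext x
    simp only [Set.mem_inter_iff, Set.mem_ofPred_eq]
    tauto
  have hnhds {σ} (hσ : σ ∈ S i) : U i ∩ O ∈ 𝓝 σ := by
    refine (hU.inter hO).mem_nhds ⟨(hmemU hσ).1, ?_⟩
    rw [hSO] at hσ; exact hσ.2
  have hne {σ} (hσ : σ ∈ S i) := h.gradient_ne_zero i σ (hsub hσ)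
  have htan {σ} (hσ : σ ∈ S i) {w : E3} (hw : fderiv ℝ (Φ i) σ w = 0) :
      w ∈ tangentConeAt ℝ (S i) σ := by
    have := mem_tangentConeAt_levelSet (hstrict hσ) (hne hσ) (hnhds hσ) hw
    rwa [hlevel hσ] at this
  have hker {σ} (hσ : σ ∈ S i) {w : E3} (hw : fderiv ℝ (Φ i) σ w = 0) :
      inner ℝ (n i σ) w = 0 :=
    (h.normal i σ (hsub hσ)).2 w (tangentConeAt_mono hsub (htan hσ hw))
  have hnorm {σ} (hσ : σ ∈ S i) : ‖n i σ‖ = 1 := (h.normal i σ (hsub hσ)).1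
  -- The functional given by the normal vanishes on the kernel of the derivative of `Φ`, hence is a
  -- multiple of it. The multiple is nonzero because the normal is a unit vector, so the two kernels
  -- coincide.
  have hker' {σ} (hσ : σ ∈ S i) {w : E3} (hw : inner ℝ (n i σ) w = 0) :
      fderiv ℝ (Φ i) σ w = 0 := by
    obtain ⟨u, hu⟩ : ∃ u, fderiv ℝ (Φ i) σ u ≠ 0 := by
      by_contra! hc
      exact hne hσ (ContinuousLinearMap.ext hc)
    have key (x : E3) : inner ℝ (n i σ) x =
        fderiv ℝ (Φ i) σ x / fderiv ℝ (Φ i) σ u * inner ℝ (n i σ) u := by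
      have := hker hσ (w := x - (fderiv ℝ (Φ i) σ x / fderiv ℝ (Φ i) σ u) • u) (by
        rw [map_sub, map_smul, smul_eq_mul, div_mul_cancel₀ _ hu, sub_self])
      rw [inner_sub_right, inner_smul_right] at this
      linarith
    have hu' : inner ℝ (n i σ) u ≠ 0 := by
      intro h0
      have := key (n i σ)
      rw [h0, mul_zero, real_inner_self_eq_norm_sq, hnorm hσ] at this
      norm_num at this
    have := key w
    rw [hw] at this
    have h2 := (mul_eq_zero.1 this.symm).resolve_right hu'
    exact (div_eq_zero_iff.1 h2).resolve_right hu
  have hhol {σ τ} (hσ : σ ∈ S i) (hτ : τ ∈ S i) (hne : σ ≠ τ) :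
      ‖n i σ - n i τ‖ / ‖σ - τ‖ ^ β ≤ 1 ∧
        |inner ℝ (n i σ) (σ - τ)| / ‖σ - τ‖ ^ (1 + β) ≤ 1 := by
    have := h.holder i σ (hsub hσ) τ (hsub hτ) hne
    have a : 0 ≤ ‖n i σ - n i τ‖ / ‖σ - τ‖ ^ β := by positivity
    have b : 0 ≤ |inner ℝ (n i σ) (σ - τ)| / ‖σ - τ‖ ^ (1 + β) := by positivity
    constructor <;> linarith
  refine ⟨h.isBounded i, ?_, fun σ hσ => hnorm hσ, fun σ hσ τ hτ => ?_, fun σ hσ τ hτ => ?_,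
    fun σ hσ w hw => (h.normal i σ (hsub hσ)).2 w (tangentConeAt_mono hsub hw),
    fun σ hσ w hw => htan hσ (hker' hσ hw), fun σ hσ v hv W hW => ?_⟩
  · have e : S i = (U i ∩ Φ i ⁻¹' {0}) ∩ O := by
      rw [hSO, h.star_eq i]; rfl
    rw [e]
    refine IsLocallyClosed.inter ?_ hO.isLocallyClosed
    obtain ⟨F, hF, hF'⟩ := (continuousOn_iff_isClosed.1 hC.continuousOn) {0} isClosed_singleton
    rw [Set.inter_comm, hF']
    exact hF.isLocallyClosed.inter hU.isLocallyClosed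
  · by_cases hne : σ = τ
    · simp [hne]; positivity
    · have hp : 0 < ‖σ - τ‖ := norm_sub_pos_iff.2 hne
      have := (hhol hσ hτ hne).1
      rwa [div_le_one (by positivity)] at this
  · by_cases hne : σ = τ
    · simp [hne]
    · have hp : 0 < ‖σ - τ‖ := norm_sub_pos_iff.2 hne
      have := (hhol hσ hτ hne).2
      rw [div_le_one (by positivity), Real.rpow_add hp, Real.rpow_one] at this
      rwa [mul_comm]
  · have hv' : fderiv ℝ (Φ i) σ v ≠ 0 := fun h0 => hv (hker hσ h0)
    have := exists_sub_smul_mem_levelSet (hstrict hσ) hv' (Filter.inter_mem (hnhds hσ) hW)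
    rwa [← Set.inter_assoc, hlevel hσ] at this

/-! ### The frame of normals, and small pieces as graphs -/

theorem abs_apply_le_norm (x : E3) (i : Fin 3) : |x i| ≤ ‖x‖ := by
  simpa using EuclideanSpace.norm_eq x ▸ Real.abs_le_sqrt (by
    simpa using Finset.single_le_sum (f := fun i => ‖x i‖ ^ 2) (fun _ _ => sq_nonneg _)
      (Finset.mem_univ i))

theorem norm_le_two_mul {x : E3} {r : ℝ} (hr : 0 ≤ r) (h : ∀ i, |x i| ≤ r) : ‖x‖ ≤ 2 * r := by
  rw [EuclideanSpace.norm_eq, Real.sqrt_le_left (by positivity)]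
  simp only [Fin.sum_univ_three, Real.norm_eq_abs]
  have := fun i => pow_le_pow_left₀ (abs_nonneg _) (h i) 2
  nlinarith [this 0, this 1, this 2]

theorem inner_eq_sum (x y : E3) : inner ℝ x y = x 0 * y 0 + x 1 * y 1 + x 2 * y 2 := by
  simp [PiLp.inner_apply, Fin.sum_univ_three, mul_comm]

/-- Cramer's rule: the two-by-two minors of unit vectors are at most 2 and the determinant is at
least 1/2, so each coordinate is at most `12 * r`; the Euclidean norm costs a further factor 2. -/
theorem norm_le_of_det {N : Fin 3 → E3} (hN : ∀ i, ‖N i‖ = 1)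
    (hdet : 1 / 2 ≤ (columnMatrix N).det) (x : E3) {r : ℝ} (hr : ∀ i, |inner ℝ (N i) x| ≤ r) :
    ‖x‖ ≤ 24 * r := by
  have hr0 : 0 ≤ r := (abs_nonneg _).trans (hr 0)
  have ha (i k) : |N i k| ≤ 1 := hN i ▸ abs_apply_le_norm (N i) k
  have hminor (i k j l) : |N i k * N j l - N i l * N j k| ≤ 2 := by
    refine (abs_sub _ _).trans ?_
    rw [abs_mul, abs_mul]
    have h1 := mul_le_one₀ (ha i k) (abs_nonneg _) (ha j l)
    have h2 := mul_le_one₀ (ha i l) (abs_nonneg _) (ha j k)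
    linarith
  have hd : (columnMatrix N).det ≠ 0 := by linarith
  have key {k : Fin 3} {a b c : ℝ} (ha : |a| ≤ 2) (hb : |b| ≤ 2) (hc : |c| ≤ 2)
      (h : (columnMatrix N).det * x k =
        a * inner ℝ (N 0) x + b * inner ℝ (N 1) x + c * inner ℝ (N 2) x) : |x k| ≤ 12 * r := by
    have h1 : |(columnMatrix N).det * x k| ≤ 6 * r := by
      rw [h]
      refine (abs_add_three _ _ _).trans ?_
      simp only [abs_mul]
      have e0 := mul_le_mul ha (hr 0) (abs_nonneg _) zero_le_two
      have e1 := mul_le_mul hb (hr 1) (abs_nonneg _) zero_le_two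
      have e2 := mul_le_mul hc (hr 2) (abs_nonneg _) zero_le_two
      linarith
    rw [abs_mul, abs_of_pos (by linarith)] at h1
    nlinarith [abs_nonneg (x k)]
  have := norm_le_two_mul (x := x) (r := 12 * r) (by positivity) fun k => by
    fin_cases k
    · refine key (hminor 1 1 2 2) (hminor 2 1 0 2) (hminor 0 1 1 2) ?_
      simp only [columnMatrix, Matrix.det_fin_three, Matrix.of_apply, inner_eq_sum, Fin.zero_eta,
        Fin.isValue]
      ring
    · refine key (hminor 1 2 2 0) (hminor 2 2 0 0) (hminor 0 2 1 0) ?_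
      simp only [columnMatrix, Matrix.det_fin_three, Matrix.of_apply, inner_eq_sum, Fin.mk_one,
        Fin.isValue]
      ring
    · refine key (hminor 1 0 2 1) (hminor 2 0 0 1) (hminor 0 0 1 1) ?_
      simp only [columnMatrix, Matrix.det_fin_three, Matrix.of_apply, inner_eq_sum,
        Fin.reduceFinMk, Fin.isValue]
      ring
  linarith

theorem exists_frame {N : Fin 3 → E3} (hN : ∀ i, ‖N i‖ = 1)
    (hdet : 1 / 2 ≤ (columnMatrix N).det) :
    ∃ L : E3 ≃L[ℝ] V3, (∀ x i, L x i = inner ℝ (N i) x) ∧ ∀ x, ‖x‖ ≤ 24 * ‖L x‖ := by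
  let L₀ : E3 →ₗ[ℝ] V3 := LinearMap.pi fun i => (innerSL ℝ (N i) : E3 →ₗ[ℝ] ℝ)
  have h0 (x i) : L₀ x i = inner ℝ (N i) x := rfl
  have hb (x) : ‖x‖ ≤ 24 * ‖L₀ x‖ := norm_le_of_det hN hdet x fun i => norm_le_pi_norm (L₀ x) i
  have hinj : Function.Injective L₀ := by
    rw [injective_iff_map_eq_zero]
    intro x hx
    simpa [hx] using hb x
  exact ⟨(LinearEquiv.ofInjectiveOfFinrankEq L₀ hinj (by simp)).toContinuousLinearEquiv, h0, hb⟩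

namespace HolderSurface

variable {β : ℝ} {S : Set E3} {n : E3 → E3}

theorem continuousOn (h : HolderSurface β S n) (hβ : 0 < β) : ContinuousOn n S := by
  intro σ hσ
  rw [ContinuousWithinAt, tendsto_iff_norm_sub_tendsto_zero]
  refine squeeze_zero' (Filter.Eventually.of_forall fun _ => norm_nonneg _)
    (eventually_mem_nhdsWithin.mono fun τ hτ => h.holder τ hτ σ hσ) ?_
  have : ContinuousAt (fun τ => ‖τ - σ‖ ^ β) σ :=
    ContinuousAt.rpow_const (by fun_prop) (Or.inr hβ.le)
  have h2 := this.tendsto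
  rw [sub_self, norm_zero, Real.zero_rpow hβ.ne'] at h2
  exact h2.mono_left nhdsWithin_le_nhds

/-- Replace the normal at `ρ` by the normal at `σ`: the Hölder bound controls the change and
flatness the rest. The bound is uniform over pairs near `ρ`, which is the strict form of
differentiability. -/
theorem abs_inner_sub_le (h : HolderSurface β S n) {ρ σ τ : E3} (hρ : ρ ∈ S) (hσ : σ ∈ S)
    (hτ : τ ∈ S) : |inner ℝ (n ρ) (σ - τ)| ≤ (‖ρ - σ‖ ^ β + ‖σ - τ‖ ^ β) * ‖σ - τ‖ := by
  have e : inner ℝ (n ρ) (σ - τ) = inner ℝ (n ρ - n σ) (σ - τ) + inner ℝ (n σ) (σ - τ) := by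
    rw [inner_sub_left]; ring
  rw [e, add_mul]
  refine (abs_add_le _ _).trans (add_le_add ?_ (h.flat σ hσ τ hτ))
  exact (abs_real_inner_le_norm _ _).trans
    (mul_le_mul_of_nonneg_right (h.holder ρ hρ σ hσ) (norm_nonneg _))

/-- The normal at `ρ` is dual to the frame vectors, and these have length at most 24. A change of
the normal by at most 1/400 therefore changes the pairings by at most 24/400. -/
theorem abs_inner_frame_sub_le (h : HolderSurface β S n) {L : E3 ≃L[ℝ] V3}
    {i : Fin 3} {ρ σ : E3} (hρ : ρ ∈ S) (hσ : σ ∈ S) (hL : ∀ x, L x i = inner ℝ (n ρ) x)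
    (hK : ∀ x, ‖x‖ ≤ 24 * ‖L x‖) (hsmall : ‖σ - ρ‖ ^ β ≤ 1 / 400) (j : Fin 3) :
    |inner ℝ (n σ) (L.symm (Pi.single j 1)) - (Pi.single j 1 : V3) i| ≤ 3 / 50 := by
  have h1 : (Pi.single j 1 : V3) i = inner ℝ (n ρ) (L.symm (Pi.single j 1)) := by
    rw [← hL, L.apply_symm_apply]
  rw [h1, ← inner_sub_left]
  refine (abs_real_inner_le_norm _ _).trans ?_
  have h2 := hK (L.symm (Pi.single j 1))
  rw [L.apply_symm_apply, Pi.norm_single, norm_one, mul_one] at h2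
  have h3 := (h.holder σ hσ ρ hρ).trans hsmall
  calc _ ≤ 1 / 400 * (24 : ℝ) := mul_le_mul h3 h2 (norm_nonneg _) (by norm_num)
    _ = _ := by norm_num

/-- The size 1/400 is adjusted to the frame bound 24: the slope is at most 24 · 2/400 = 3/25 < 1/8,
and the entries of the conormal off the diagonal are at most (3/50)/(47/50) < 1/4. The conormal is
the normal in frame coordinates, divided by its `i`-th entry. -/
theorem graphPatch (h : HolderSurface β S n) (hβ : 0 < β) {B : Set E3} (hB : IsOpen B)
    {L : E3 ≃L[ℝ] V3} {i : Fin 3} {ρ : E3} (hρ : ρ ∈ S ∩ B)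
    (hL : ∀ x, L x i = inner ℝ (n ρ) x) (hK : ∀ x, ‖x‖ ≤ 24 * ‖L x‖)
    (hsmall : ∀ σ ∈ S ∩ B, ∀ τ ∈ S ∩ B, ‖σ - τ‖ ^ β ≤ 1 / 400) :
    GraphPatch i (L '' (S ∩ B)) (fun x j => inner ℝ (n (L.symm x)) (L.symm (Pi.single j 1)) /
      inner ℝ (n (L.symm x)) (L.symm (Pi.single i 1))) := by
  have hc (σ) (hσ : σ ∈ S ∩ B) (j) := h.abs_inner_frame_sub_le hρ.1 hσ.1 hL hK
    (hsmall σ hσ ρ hρ) j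
  have hi (σ) (hσ : σ ∈ S ∩ B) : 47 / 50 ≤ inner ℝ (n σ) (L.symm (Pi.single i 1)) := by
    have := hc σ hσ i
    rw [Pi.single_eq_same] at this
    linarith [(abs_le.1 this).1]
  refine ⟨?_, ?_, ?_, ?_, ?_, ?_⟩
  · rintro _ ⟨σ, hσ, rfl⟩ _ ⟨τ, hτ, rfl⟩
    rw [hL, hL, ← inner_sub_right, ← map_sub]
    have h1 := h.abs_inner_sub_le hρ.1 hσ.1 hτ.1
    have h2 := hsmall ρ hρ σ hσ
    have h3 := hsmall σ hσ τ hτ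
    have h4 := hK (σ - τ)
    have h5 : (‖ρ - σ‖ ^ β + ‖σ - τ‖ ^ β) * ‖σ - τ‖ ≤ (1 / 400 + 1 / 400) * ‖σ - τ‖ := by
      gcongr
    linarith [norm_nonneg (L (σ - τ))]
  · rintro _ ⟨σ, hσ, rfl⟩
    simp only [L.symm_apply_apply]
    exact div_self (by linarith [hi σ hσ])
  · rintro _ ⟨σ, hσ, rfl⟩ j hj
    simp only [L.symm_apply_apply]
    have h1 := hc σ hσ j
    rw [Pi.single_eq_of_ne hj.symm, sub_zero] at h1
    have h2 := hi σ hσ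
    rw [abs_div, abs_of_pos (a := inner ℝ (n σ) (L.symm (Pi.single i 1))) (by linarith),
      div_le_iff₀ (by linarith)]
    linarith
  · have hn : ContinuousOn (fun x => n (L.symm x)) (L '' (S ∩ B)) := by
      refine ContinuousOn.comp (t := S ∩ B)
        ((h.continuousOn hβ).mono Set.inter_subset_left)
        L.symm.continuous.continuousOn ?_
      rintro _ ⟨σ, hσ, rfl⟩
      simpa using hσ
    refine continuousOn_pi.2 fun j => ?_
    refine (hn.inner continuousOn_const).div (hn.inner continuousOn_const) ?_
    rintro _ ⟨σ, hσ, rfl⟩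
    rw [L.symm_apply_apply]
    linarith [hi σ hσ]
  · rintro _ ⟨σ, hσ, rfl⟩
    set b := inner ℝ (n σ) (L.symm (Pi.single i 1)) with hb
    have hb0 : 0 < b := by linarith [hi σ hσ]
    have e (x : V3) : (fun j => inner ℝ (n (L.symm (L σ))) (L.symm (Pi.single j 1)) /
        inner ℝ (n (L.symm (L σ))) (L.symm (Pi.single i 1))) ⬝ᵥ x =
        inner ℝ (n σ) (L.symm x) / b := by
      have hx : x = ∑ j, x j • (Pi.single j 1 : V3) := by
        conv_lhs => rw [← Finset.univ_sum_single x]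
        refine Finset.sum_congr rfl fun j _ => ?_
        rw [← Pi.single_smul, smul_eq_mul, mul_one]
      conv_rhs => rw [hx]
      simp only [map_sum, map_smul, inner_sum, inner_smul_right, L.symm_apply_apply,
        dotProduct, Finset.sum_div]
      exact Finset.sum_congr rfl fun j _ => by ring
    simp only [e]
    rw [Asymptotics.isLittleO_iff]
    intro ε hε
    have hlim : Filter.Tendsto (fun x => ‖σ - L.symm x‖ ^ β) (𝓝[L '' (S ∩ B)] (L σ)) (𝓝 0) := by
      have : ContinuousAt (fun x => ‖σ - L.symm x‖ ^ β) (L σ) :=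
        ContinuousAt.rpow_const (by fun_prop) (Or.inr hβ.le)
      have h2 := this.tendsto
      rw [L.symm_apply_apply, sub_self, norm_zero, Real.zero_rpow hβ.ne'] at h2
      exact h2.mono_left nhdsWithin_le_nhds
    set C := ‖(L.symm : V3 →L[ℝ] E3)‖ with hC
    have hC0 : 0 ≤ C := norm_nonneg _
    filter_upwards [eventually_mem_nhdsWithin,
      hlim.eventually_lt_const (show 0 < ε * b / (C + 1) by positivity)] with x hx hx2
    obtain ⟨τ, hτ, rfl⟩ := hx
    rw [L.symm_apply_apply] at hx2
    have h1 := h.flat σ hσ.1 τ hτ.1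
    have h2 : ‖σ - τ‖ ≤ C * ‖L τ - L σ‖ := by
      have := (L.symm : V3 →L[ℝ] E3).le_opNorm (L τ - L σ)
      simp only [map_sub, ContinuousLinearEquiv.coe_coe, L.symm_apply_apply] at this
      rwa [norm_sub_rev]
    rw [map_sub, L.symm_apply_apply, L.symm_apply_apply, norm_div, Real.norm_eq_abs,
      Real.norm_eq_abs, abs_of_pos hb0, div_le_iff₀ hb0, ← abs_neg, ← inner_neg_right, neg_sub]
    refine h1.trans ?_
    calc _ ≤ ε * b / (C + 1) * (C * ‖L τ - L σ‖) :=
          mul_le_mul hx2.le h2 (norm_nonneg _) (by positivity)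
      _ ≤ ε * b / (C + 1) * ((C + 1) * ‖L τ - L σ‖) := by gcongr; linarith
      _ = _ := by field_simp
  · rw [isOpen_iff_mem_nhds]
    rintro u ⟨t, σ, hσ, hu⟩
    have h1 := h.exists_nhds σ hσ.1 (L.symm (Pi.single i 1)) (by linarith [hi σ hσ]) B
      (hB.mem_nhds hσ.2)
    have hc : ContinuousAt (fun u => L.symm (u - t • Pi.single i 1)) u := by fun_prop
    have hu2 : L.symm (u - t • Pi.single i 1) = σ := by rw [← hu, L.symm_apply_apply]
    filter_upwards [hc.preimage_mem_nhds (by rw [hu2]; exact h1)] with y hy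
    obtain ⟨s, hs⟩ := hy
    refine ⟨t + s, _, hs, ?_⟩
    rw [map_sub, map_smul, L.apply_symm_apply, L.apply_symm_apply, add_smul]
    abel

end HolderSurface

/-! ### Normals of linear images -/

/-- The unit normal field, on the image under `T` of a surface with normal field `n`. -/
noncomputable def imageNormal (T : E3 ≃L[ℝ] E3) (n : E3 → E3) (y : E3) : E3 :=
  ‖(T.symm : E3 →L[ℝ] E3).adjoint (n (T.symm y))‖⁻¹ •
    (T.symm : E3 →L[ℝ] E3).adjoint (n (T.symm y))

theorem adjoint_symm_ne_zero (T : E3 ≃L[ℝ] E3) {x : E3} (hx : x ≠ 0) :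
    (T.symm : E3 →L[ℝ] E3).adjoint x ≠ 0 := by
  intro h
  have := ContinuousLinearMap.adjoint_inner_left (T.symm : E3 →L[ℝ] E3) (T x) x
  rw [h, inner_zero_left, ContinuousLinearEquiv.coe_coe, T.symm_apply_apply] at this
  exact hx (inner_self_eq_zero.1 this.symm)

theorem norm_imageNormal (T : E3 ≃L[ℝ] E3) {n : E3 → E3} {σ : E3} (h : ‖n σ‖ = 1) :
    ‖imageNormal T n (T σ)‖ = 1 := by
  have h0 : n σ ≠ 0 := by intro h0; simp [h0] at h
  rw [imageNormal, T.symm_apply_apply, norm_smul, norm_inv, norm_norm,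
    inv_mul_cancel₀ (norm_ne_zero_iff.2 (adjoint_symm_ne_zero T h0))]

/-- Normals transform by the inverse adjoint, so pairings with transported vectors change only by
the normalizing factor. That factor cancels in the quotients defining the conormals. -/
theorem inner_imageNormal (T : E3 ≃L[ℝ] E3) (n : E3 → E3) (σ x : E3) :
    inner ℝ (imageNormal T n (T σ)) (T x) =
      ‖(T.symm : E3 →L[ℝ] E3).adjoint (n σ)‖⁻¹ * inner ℝ (n σ) x := by
  rw [imageNormal, T.symm_apply_apply, inner_smul_left, ContinuousLinearMap.adjoint_inner_left,
    ContinuousLinearEquiv.coe_coe, T.symm_apply_apply]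
  rfl

/-- Flatness survives with an arbitrary small `ε` in place of the Hölder bound, because the norm of
the inverse of `T` enters only through the size of the neighbourhood. Such qualitative flatness
suffices for the area formula, so no constant depends on `T`. -/
theorem HolderSurface.flatGraph_image {β : ℝ} {S : Set E3} {n : E3 → E3}
    (h : HolderSurface β S n) (hβ : 0 < β) (T : E3 ≃L[ℝ] E3) {P : Set E3} (hP : P ⊆ S)
    (hPm : MeasurableSet P) {u : E3} (hu : ∀ σ ∈ P, inner ℝ (n σ) u ≠ 0)
    (hinj : ∀ x ∈ P, ∀ t : ℝ, x + t • u ∈ P → t = 0) :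
    FlatGraph (T '' P) (imageNormal T n) (T u) := by
  have hn0 {σ} (hσ : σ ∈ P) : n σ ≠ 0 := by
    intro h0
    have := h.norm_eq σ (hP hσ)
    simp [h0] at this
  have hA0 {σ} (hσ : σ ∈ P) : 0 < ‖(T.symm : E3 →L[ℝ] E3).adjoint (n σ)‖ :=
    norm_pos_iff.2 (adjoint_symm_ne_zero T (hn0 hσ))
  refine ⟨T.toHomeomorph.measurableEmbedding.measurableSet_image.2 hPm, ?_, ?_, ?_, ?_, ?_⟩
  · rintro _ ⟨σ, hσ, rfl⟩
    exact norm_imageNormal T (h.norm_eq σ (hP hσ))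
  · have hn : ContinuousOn (fun y => (T.symm : E3 →L[ℝ] E3).adjoint (n (T.symm y))) (T '' P) := by
      refine (ContinuousLinearMap.continuous _).comp_continuousOn
        (((h.continuousOn hβ).mono hP).comp T.symm.continuous.continuousOn ?_)
      rintro _ ⟨σ, hσ, rfl⟩
      simpa using hσ
    refine (hn.norm.inv₀ ?_).smul hn
    rintro _ ⟨σ, hσ, rfl⟩
    rw [T.symm_apply_apply]
    exact (hA0 hσ).ne'
  · rintro _ ⟨σ, hσ, rfl⟩
    rw [inner_imageNormal]
    exact mul_ne_zero (inv_ne_zero (hA0 hσ).ne') (hu σ hσ)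
  · rintro _ ⟨σ, hσ, rfl⟩ ε hε
    set a := ‖(T.symm : E3 →L[ℝ] E3).adjoint (n σ)‖ with ha
    have ha0 : 0 < a := hA0 hσ
    set C := ‖(T.symm : E3 →L[ℝ] E3)‖ with hC
    have hC0 : 0 ≤ C := norm_nonneg _
    have hlim : Filter.Tendsto (fun p : E3 × E3 =>
        ‖σ - T.symm p.1‖ ^ β + ‖T.symm p.1 - T.symm p.2‖ ^ β) (𝓝 (T σ, T σ)) (𝓝 0) := by
      have : ContinuousAt (fun p : E3 × E3 =>
          ‖σ - T.symm p.1‖ ^ β + ‖T.symm p.1 - T.symm p.2‖ ^ β) (T σ, T σ) :=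
        (ContinuousAt.rpow_const (by fun_prop) (Or.inr hβ.le)).add
          (ContinuousAt.rpow_const (by fun_prop) (Or.inr hβ.le))
      have h2 := this.tendsto
      simpa [hβ.ne'] using h2
    have hev := hlim.eventually_lt_const (show 0 < ε * a / (C + 1) by positivity)
    rw [nhds_prod_eq] at hev
    obtain ⟨W, hW, hWb⟩ := Filter.mem_prod_same_iff.1 hev
    refine ⟨W, hW, ?_⟩
    rintro _ ⟨⟨x, hx, rfl⟩, hxW⟩ _ ⟨⟨y, hy, rfl⟩, hyW⟩
    have h1 := hWb (Set.mk_mem_prod hxW hyW)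
    simp only [T.symm_apply_apply, Set.mem_ofPred_eq] at h1
    have h2 := h.abs_inner_sub_le (hP hσ) (hP hx) (hP hy)
    have h3 : ‖x - y‖ ≤ C * ‖T x - T y‖ := by
      have := (T.symm : E3 →L[ℝ] E3).le_opNorm (T x - T y)
      simpa only [map_sub, ContinuousLinearEquiv.coe_coe, T.symm_apply_apply] using this
    rw [← map_sub, inner_imageNormal, ← ha, abs_mul, abs_of_pos (inv_pos.2 ha0),
      inv_mul_le_iff₀ ha0, map_sub]
    refine h2.trans ?_
    calc _ ≤ ε * a / (C + 1) * (C * ‖T x - T y‖) :=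
          mul_le_mul h1.le h3 (norm_nonneg _) (by positivity)
      _ ≤ ε * a / (C + 1) * ((C + 1) * ‖T x - T y‖) := by gcongr; linarith
      _ = _ := by field_simp
  · rintro _ ⟨x, hx, rfl⟩ t ht
    rw [← map_smul, ← map_add] at ht
    obtain ⟨y, hy, hyx⟩ := ht
    rw [T.injective hyx] at hy
    exact hinj x hx t hy

/-! ### Surface measure and the estimate in linear coordinates -/

/-- The determinant of a linear map from coordinate space to Euclidean space. -/
noncomputable def coordDet (A : V3 ≃L[ℝ] E3) : ℝ :=
  (columnMatrix fun j => A (Pi.single j 1)).det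

theorem volume_image_coord (A : V3 ≃L[ℝ] E3) (s : Set V3) :
    volume (A '' s) = ENNReal.ofReal |coordDet A| * volume s := by
  let f : V3 →ₗ[ℝ] V3 := (WithLp.linearEquiv 2 ℝ V3).toLinearMap ∘ₗ (A : V3 →L[ℝ] E3).toLinearMap
  have hdet : LinearMap.det f = coordDet A := by
    rw [← LinearMap.det_toMatrix', coordDet]
    rfl
  rw [← hdet, ← Measure.addHaar_image_linearMap]
  have e : A '' s = (MeasurableEquiv.toLp 2 V3).symm ⁻¹' (f '' s) := by
    ext z
    constructor
    · rintro ⟨x, hx, rfl⟩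
      exact ⟨x, hx, rfl⟩
    · rintro ⟨x, hx, h⟩
      exact ⟨x, hx, (MeasurableEquiv.toLp 2 V3).symm.injective h⟩
  rw [e]
  exact (EuclideanSpace.volume_preserving_symm_measurableEquiv_toLp (Fin 3)).measure_preimage_equiv _

theorem coordDet_ne_zero (A : V3 ≃L[ℝ] E3) : coordDet A ≠ 0 := by
  intro h
  have := volume_image_coord A Set.univ
  rw [h, Set.image_univ, A.surjective.range_eq] at this
  simp at this

theorem volume_eq_smul_map (A : V3 ≃L[ℝ] E3) :
    (volume : Measure E3) = ENNReal.ofReal |coordDet A| • (volume : Measure V3).map A := by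
  ext s hs
  rw [Measure.smul_apply, smul_eq_mul, Measure.map_apply A.continuous.measurable hs,
    ← volume_image_coord, Set.image_preimage_eq _ A.surjective]

theorem integral_eq_abs_coordDet_mul (A : V3 ≃L[ℝ] E3) (f : E3 → ℂ) :
    ∫ z, f z = |coordDet A| * ∫ x, f (A x) := by
  have hemb : MeasurableEmbedding A := A.toHomeomorph.measurableEmbedding
  rw [volume_eq_smul_map A, integral_smul_measure, hemb.integral_map,
    ENNReal.toReal_ofReal (abs_nonneg _),
    Complex.real_smul]

theorem sweep_image {i : Fin 3} {M : Set V3} {m : V3 → V3} (h : GraphPatch i M m)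
    (A : V3 ≃L[ℝ] E3) (B : Set E3) : sweep (B ∩ A '' M) (A (Pi.single i 1)) =
      A '' (foot i M ⁻¹' (A ⁻¹' B) ∩ (tube i M ∩ height i M ⁻¹' Set.Ico 0 1)) := by
  ext z
  rw [mem_sweep]
  constructor
  · rintro ⟨_, ⟨hB, x, hx, rfl⟩, t, ht, rfl⟩
    have hx' : x + t • Pi.single i 1 - t • Pi.single i 1 ∈ M := by rwa [add_sub_cancel_right]
    refine ⟨x + t • Pi.single i 1, ⟨?_, ⟨t, hx'⟩, ?_⟩, by rw [map_add, map_smul]⟩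
    · rw [Set.mem_preimage, h.foot_eq hx', add_sub_cancel_right]; exact hB
    · rw [Set.mem_preimage, h.height_eq hx']; exact ht
  · rintro ⟨u, ⟨hB, hu, ht⟩, rfl⟩
    refine ⟨A (foot i M u), ⟨hB, _, foot_mem hu, rfl⟩, height i M u, ht, ?_⟩
    rw [← map_smul, ← map_add, foot_add_height]

/-- The volume swept by moving a piece along `A (e i)` is computed twice: by the area formula, and
as the image under `A` of a slab over the graph. This identifies surface measure with density `|⟪n,
A (e i)⟫|` and graph measure with factor `|det A|`; transversality permits division by the density.
-/
theorem surfaceMeasure_image {i : Fin 3} {M : Set V3} {m : V3 → V3} (h : GraphPatch i M m)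
    (A : V3 ≃L[ℝ] E3) {n : E3 → E3} (h' : FlatGraph (A '' M) n (A (Pi.single i 1))) :
    surfaceMeasure (A '' M) = ((graphMeasure i M).withDensity (graphWeight M fun x =>
      |coordDet A| / |inner ℝ (n (A x)) (A (Pi.single i 1))|)).map A := by
  set v := A (Pi.single i 1) with hv
  set c := |coordDet A| with hc
  have hc0 : 0 < c := abs_pos.2 (coordDet_ne_zero A)
  set ν := surfaceMeasure (A '' M) with hν
  set G : E3 → ENNReal := (A '' M).indicator fun y => ENNReal.ofReal |inner ℝ (n y) v| with hG
  have hcont : ContinuousOn (fun y => |inner ℝ (n y) v|) (A '' M) :=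
    (h'.cont.inner continuousOn_const).abs
  have hGm : Measurable G := measurable_indicator_of_continuousOn h'.measurableSet
    (ENNReal.continuous_ofReal.comp_continuousOn hcont)
  have hAm : Measurable A := A.continuous.measurable
  have hemb : MeasurableEmbedding A := A.toHomeomorph.measurableEmbedding
  have step1 : ν.withDensity G = ENNReal.ofReal c • (graphMeasure i M).map A := by
    ext B hB
    rw [withDensity_apply _ hB, Measure.smul_apply, smul_eq_mul, Measure.map_apply hAm hB,
      graphMeasure, Measure.map_apply h.measurable_foot (hAm hB),
      Measure.restrict_apply (h.measurable_foot (hAm hB)), hc, ← volume_image_coord,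
      ← sweep_image h, h'.volume_sweep (hB.inter h'.measurableSet) Set.inter_subset_right,
      hν, surfaceMeasure, Measure.restrict_restrict hB]
    refine setLIntegral_congr_fun (hB.inter h'.measurableSet) fun y hy => ?_
    simp only [hG, Set.indicator_of_mem hy.2]
  have hmem : ∀ᵐ y ∂ν, y ∈ A '' M := ae_restrict_mem h'.measurableSet
  have step2 : (ν.withDensity G).withDensity G⁻¹ = ν := by
    refine withDensity_inv_same₀ hGm.aemeasurable ?_ ?_
    · filter_upwards [hmem] with y hy
      rw [hG, Set.indicator_of_mem hy]
      simpa using h'.transversal y hy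
    · filter_upwards [hmem] with y hy
      rw [hG, Set.indicator_of_mem hy]
      exact ENNReal.ofReal_ne_top
  rw [← step2, step1]
  ext B hB
  rw [withDensity_apply _ hB, Measure.restrict_smul, lintegral_smul_measure,
    Measure.map_apply hAm hB, withDensity_apply _ (hAm hB), hemb.restrict_map, hemb.lintegral_map,
    smul_eq_mul, ← lintegral_const_mul' _ _ ENNReal.ofReal_ne_top]
  refine lintegral_congr_ae ?_
  filter_upwards [ae_restrict_of_ae h.ae_mem] with x hx
  have hp : 0 < |inner ℝ (n (A x)) v| := abs_pos.2 (h'.transversal _ ⟨x, hx, rfl⟩)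
  rw [Pi.inv_apply, hG, Set.indicator_of_mem (Set.mem_image_of_mem A hx), graphWeight, Set.indicator_of_mem hx,
    ENNReal.ofReal_div_of_pos hp, div_eq_mul_inv]

theorem columnMatrix_comp (A : V3 ≃L[ℝ] E3) (N : Fin 3 → E3) :
    (Matrix.of fun i j => inner ℝ (N i) (A (Pi.single j 1))).det =
      (columnMatrix N).det * coordDet A := by
  rw [coordDet, ← Matrix.det_transpose (columnMatrix N), ← Matrix.det_mul]
  congr 1
  ext i j
  simp [Matrix.mul_apply, columnMatrix, PiLp.inner_apply, mul_comm]

/-- The convolution of two functions on the images of graphs has a continuous density, whose trace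
on a third, transversal image is bounded in `L²`. -/
theorem exists_density_image (A : V3 ≃L[ℝ] E3) {M : Fin 3 → Set V3} {m : Fin 3 → V3 → V3}
    {n : Fin 3 → E3 → E3} (h : ∀ i, GraphPatch i (M i) (m i))
    (h' : ∀ i, FlatGraph (A '' M i) (n i) (A (Pi.single i 1)))
    (hm : ∀ i, ∀ x ∈ M i, ∀ j, m i x j =
      inner ℝ (n i (A x)) (A (Pi.single j 1)) / inner ℝ (n i (A x)) (A (Pi.single i 1)))
    {d : ℝ} (hd : 0 < d) (hdet : ∀ x : Fin 3 → V3, (∀ i, x i ∈ M i) →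
      d ≤ |(columnMatrix fun i => n i (A (x i))).det|) {f g : E3 → ℂ}
    (hf : ContinuousOn f (A '' M 0)) (hg : ContinuousOn g (A '' M 1)) {K₀ K₁ : Set E3}
    (hK₀ : IsCompact K₀) (hK₁ : IsCompact K₁) (hKM₀ : K₀ ⊆ A '' M 0) (hKM₁ : K₁ ⊆ A '' M 1)
    (hf0 : ∀ x ∉ K₀, f x = 0) (hg0 : ∀ x ∉ K₁, g x = 0) :
    ∃ F : E3 → ℂ, Continuous F ∧ HasCompactSupport F ∧ (∀ ψ : E3 → ℂ, Continuous ψ →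
      ∫ x, ∫ y, f x * g y * ψ (x + y) ∂(surfaceMeasure (A '' M 1)) ∂(surfaceMeasure (A '' M 0)) =
        ∫ z, F z * ψ z) ∧
      ∫⁻ z, ‖F z‖ₑ ^ 2 ∂(surfaceMeasure (A '' M 2)) ≤ ENNReal.ofReal (1 / d) *
        ((∫⁻ x, ‖f x‖ₑ ^ 2 ∂(surfaceMeasure (A '' M 0))) *
          ∫⁻ y, ‖g y‖ₑ ^ 2 ∂(surfaceMeasure (A '' M 1))) := by
  set c := |coordDet A| with hc
  have hc0 : 0 < c := abs_pos.2 (coordDet_ne_zero A)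
  set w : Fin 3 → V3 → ℝ := fun i x => c / |inner ℝ (n i (A x)) (A (Pi.single i 1))| with hw
  have hin (i) (x) (hx : x ∈ M i) : inner ℝ (n i (A x)) (A (Pi.single i 1)) ≠ 0 :=
    (h' i).transversal _ ⟨x, hx, rfl⟩
  have hwc (i) : ContinuousOn (w i) (M i) := by
    refine continuousOn_const.div ?_ fun x hx => abs_ne_zero.2 (hin i x hx)
    have : ContinuousOn (fun x => n i (A x)) (M i) :=
      (h' i).cont.comp A.continuous.continuousOn fun x hx => ⟨x, hx, rfl⟩
    exact (this.inner continuousOn_const).abs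
  have hwp (i) (x) (hx : x ∈ M i) : 0 < w i x := div_pos hc0 (abs_pos.2 (hin i x hx))
  have hs (i) := surfaceMeasure_image (h i) A (h' i)
  have hemb : MeasurableEmbedding A := A.toHomeomorph.measurableEmbedding
  have hsub {K M : Set _} (hK : K ⊆ A '' M) : A.symm '' K ⊆ M := by
    rintro _ ⟨y, hy, rfl⟩
    obtain ⟨x, hx, rfl⟩ := hK hy
    rwa [A.symm_apply_apply]
  have hcomp {f : E3 → ℂ} {M : Set V3} (hf : ContinuousOn f (A '' M)) :
      ContinuousOn (fun x => f (A x)) M :=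
    hf.comp A.continuous.continuousOn fun x hx => ⟨x, hx, rfl⟩
  have hzero {f : E3 → ℂ} {K : Set E3} (hf : ∀ x ∉ K, f x = 0) (x : V3) (hx : x ∉ A.symm '' K) :
      f (A x) = 0 := by
    refine hf _ fun h => hx ⟨_, h, A.symm_apply_apply x⟩
  -- With `c = |det A|` and `Q` the product of the inverse absolute pairings, the left side is `c ^
  -- 3 * Q`, while the determinant of the conormals has absolute value `Q * c` times that of the
  -- unit normals, which is at least `d`. The pairings cancel.
  have hdetw : ∀ x ∈ M 0, ∀ y ∈ M 1, ∀ z ∈ M 2,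
      w 0 x * w 1 y * w 2 z ≤ c ^ 2 / d * |(Matrix.of ![m 0 x, m 1 y, m 2 z]).det| := by
    intro x hx y hy z hz
    have hp : ∀ i, (![x, y, z] : Fin 3 → V3) i ∈ M i := by
      intro i; fin_cases i <;> assumption
    have h1 := hdet ![x, y, z] hp
    have e : (Matrix.of ![m 0 x, m 1 y, m 2 z]).det =
        (∏ i, (inner ℝ (n i (A (![x, y, z] i))) (A (Pi.single i 1)))⁻¹) *
          ((columnMatrix fun i => n i (A (![x, y, z] i))).det * coordDet A) := by
      rw [← columnMatrix_comp, ← Matrix.det_mul_column]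
      congr 1
      ext i j
      have := hm i _ (hp i) j
      rw [div_eq_inv_mul] at this
      rw [Matrix.of_apply, Matrix.of_apply, Matrix.of_apply, ← this]
      fin_cases i <;> rfl
    have e2 : w 0 x * w 1 y * w 2 z =
        ∏ i, (c * |(inner ℝ (n i (A (![x, y, z] i))) (A (Pi.single i 1)))⁻¹|) := by
      simp [Fin.prod_univ_three, hw, div_eq_mul_inv]
    rw [e, e2, Finset.prod_mul_distrib, abs_mul, abs_mul, Finset.abs_prod, ← hc]
    simp only [Finset.prod_const, Finset.card_univ, Fintype.card_fin]
    set Q := ∏ i, |(inner ℝ (n i (A (![x, y, z] i))) (A (Pi.single i 1)))⁻¹| with hQ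
    have hQ0 : 0 ≤ Q := Finset.prod_nonneg fun _ _ => abs_nonneg _
    calc c ^ 3 * Q = c ^ 3 * Q / d * d := by field_simp
      _ ≤ c ^ 3 * Q / d * _ := mul_le_mul_of_nonneg_left h1 (by positivity)
      _ = _ := by ring
  obtain ⟨F, hFc, hFs, hFi, hFb⟩ := exists_density_graph (h 0) (h 1) (h 2) (hwc 0) (hwc 1) (hwc 2)
    (hwp 0) (hwp 1) (c := c ^ 2 / d) (by positivity) hdetw (hcomp hf) (hcomp hg)
    (hK₀.image A.symm.continuous) (hK₁.image A.symm.continuous) (hsub hKM₀) (hsub hKM₁)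
    (hzero hf0) (hzero hg0)
  have hl (i) (u : E3 → ENNReal) : ∫⁻ z, u z ∂(surfaceMeasure (A '' M i)) =
      ∫⁻ x, u (A x) ∂((graphMeasure i (M i)).withDensity (graphWeight (M i) (w i))) := by
    rw [hs i, hemb.lintegral_map]
  have hi (i) (u : E3 → ℂ) : ∫ z, u z ∂(surfaceMeasure (A '' M i)) =
      ∫ x, u (A x) ∂((graphMeasure i (M i)).withDensity (graphWeight (M i) (w i))) := by
    rw [hs i, hemb.integral_map]
  -- A density with respect to Lebesgue measure is divided by `c` under the linear map. The square
  -- of this factor removes the `c ^ 2` of the graph estimate and leaves `1 / d`.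
  refine ⟨fun z => (c⁻¹ : ℝ) * F (A.symm z), by fun_prop, ?_, fun ψ hψ => ?_, ?_⟩
  · refine HasCompactSupport.mul_left ?_
    exact hFs.comp_homeomorph A.symm.toHomeomorph
  · simp only [hi]
    have := hFi (fun x => ψ (A x)) (by fun_prop)
    simp only [map_add] at this
    rw [this, integral_eq_abs_coordDet_mul A, ← integral_const_mul]
    congr 1
    ext x
    rw [A.symm_apply_apply, ← hc]
    have : (c : ℂ) ≠ 0 := by exact_mod_cast hc0.ne'
    push_cast
    field_simp
  · simp only [hl, A.symm_apply_apply, enorm_mul, mul_pow]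
    rw [lintegral_const_mul' _ _ (by simp)]
    refine (mul_le_mul_right hFb _).trans_eq ?_
    rw [← mul_assoc]
    congr 1
    have e : ‖((c⁻¹ : ℝ) : ℂ)‖ₑ = ENNReal.ofReal c⁻¹ := by
      rw [← ofReal_norm, Complex.norm_real, Real.norm_of_nonneg (by positivity)]
    rw [e, ← ENNReal.ofReal_pow (by positivity), ← ENNReal.ofReal_mul (by positivity)]
    congr 1
    field_simp

theorem HolderSurface.measurableSet_inter {β : ℝ} {S : Set E3} {n : E3 → E3}
    (h : HolderSurface β S n) {B : Set E3} (hB : IsOpen B) : MeasurableSet (S ∩ B) := by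
  obtain ⟨U, Z, hU, hZ, rfl⟩ := h.isLocallyClosed
  exact (hU.measurableSet.inter hZ.measurableSet).inter hB.measurableSet

/-! ### Small pieces of the surfaces -/

section triple

variable {β : ℝ} {S : Fin 3 → Set E3} {n : Fin 3 → E3 → E3}

/-- The frame is built from the normals of the original surfaces, whose determinant is at least 1/2,
and is followed by `T`. The pieces are therefore graphs with the same slopes for every `T`, and `T`
is felt only through `d`. -/
theorem exists_density_pieces (hβ : 0 < β) (h : ∀ i, HolderSurface β (S i) (n i))
    (hdet : ∀ σ : Fin 3 → E3, (∀ i, σ i ∈ S i) →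
      1 / 2 ≤ (columnMatrix fun i => n i (σ i)).det) (T : E3 ≃L[ℝ] E3) {d : ℝ} (hd : 0 < d)
    (hd' : ∀ σ : Fin 3 → E3, (∀ i, σ i ∈ S i) →
      d ≤ |(columnMatrix fun i => imageNormal T (n i) (T (σ i))).det|)
    {B : Fin 3 → Set E3} (hB : ∀ i, IsOpen (B i))
    (hsmall : ∀ i, ∀ σ ∈ S i ∩ B i, ∀ τ ∈ S i ∩ B i, ‖σ - τ‖ ^ β ≤ 1 / 400)
    (hne : ∀ i, (S i ∩ B i).Nonempty) {f g : E3 → ℂ}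
    (hf : ContinuousOn f (T '' (S 0 ∩ B 0))) (hg : ContinuousOn g (T '' (S 1 ∩ B 1)))
    {K₀ K₁ : Set E3} (hK₀ : IsCompact K₀) (hK₁ : IsCompact K₁)
    (hKM₀ : K₀ ⊆ T '' (S 0 ∩ B 0)) (hKM₁ : K₁ ⊆ T '' (S 1 ∩ B 1))
    (hf0 : ∀ x ∉ K₀, f x = 0) (hg0 : ∀ x ∉ K₁, g x = 0) :
    ∃ F : E3 → ℂ, Continuous F ∧ HasCompactSupport F ∧ (∀ ψ : E3 → ℂ, Continuous ψ →
      ∫ x, ∫ y, f x * g y * ψ (x + y) ∂(surfaceMeasure (T '' (S 1 ∩ B 1)))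
        ∂(surfaceMeasure (T '' (S 0 ∩ B 0))) = ∫ z, F z * ψ z) ∧
      ∫⁻ z, ‖F z‖ₑ ^ 2 ∂(surfaceMeasure (T '' (S 2 ∩ B 2))) ≤ ENNReal.ofReal (1 / d) *
        ((∫⁻ x, ‖f x‖ₑ ^ 2 ∂(surfaceMeasure (T '' (S 0 ∩ B 0)))) *
          ∫⁻ y, ‖g y‖ₑ ^ 2 ∂(surfaceMeasure (T '' (S 1 ∩ B 1)))) := by
  choose ρ hρ using hne
  obtain ⟨L, hL, hK⟩ := exists_frame (N := fun i => n i (ρ i))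
    (fun i => (h i).norm_eq _ (hρ i).1) (hdet ρ fun i => (hρ i).1)
  have hG (i) := (h i).graphPatch hβ (hB i) (hρ i) (fun x => hL x i) hK (hsmall i)
  set A : V3 ≃L[ℝ] E3 := L.symm.trans T with hA
  have hAL (P : Set E3) : A '' (L '' P) = T '' P := by
    rw [Set.image_image]
    simp [hA]
  have htr (i) (σ) (hσ : σ ∈ S i ∩ B i) : inner ℝ (n i σ) (L.symm (Pi.single i 1)) ≠ 0 := by
    intro h0
    have := (hG i).conormal_self (L σ) ⟨σ, hσ, rfl⟩
    simp [h0] at this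
  have hF (i) : FlatGraph (A '' (L '' (S i ∩ B i))) (imageNormal T (n i)) (A (Pi.single i 1)) := by
    rw [hAL]
    refine (h i).flatGraph_image hβ T Set.inter_subset_left ((h i).measurableSet_inter (hB i))
      (htr i) fun x hx t ht => ?_
    refine (hG i).eq_zero_of_add_mem ⟨x, hx, rfl⟩ ⟨_, ht, ?_⟩
    rw [map_add, map_smul]
    congr 2
    exact L.apply_symm_apply _
  have key := exists_density_image A hG hF ?_ hd ?_ (f := f) (g := g) (by rwa [hAL])
    (by rwa [hAL]) hK₀ hK₁ (by rwa [hAL]) (by rwa [hAL]) hf0 hg0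
  · simpa only [hAL] using key
  · rintro i _ ⟨σ, hσ, rfl⟩ j
    have hp : (‖(T.symm : E3 →L[ℝ] E3).adjoint (n i σ)‖⁻¹ : ℝ) ≠ 0 := by
      refine inv_ne_zero (norm_ne_zero_iff.2 (adjoint_symm_ne_zero T ?_))
      intro h0
      exact htr i σ hσ (by rw [h0, inner_zero_left])
    simp only [hA, ContinuousLinearEquiv.trans_apply, L.symm_apply_apply, inner_imageNormal]
    rw [mul_div_mul_left _ _ hp]
  · intro x hx
    choose σ hσ hx using hx
    refine (hd' σ fun i => (hσ i).1).trans_eq ?_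
    simp only [← hx, hA, ContinuousLinearEquiv.trans_apply, L.symm_apply_apply]

/-! ### The transversality constant of the image surfaces -/

theorem tangentConeAt_image (T : E3 ≃L[ℝ] E3) {S : Set E3} {σ w : E3}
    (hw : w ∈ tangentConeAt ℝ S σ) : T w ∈ tangentConeAt ℝ (T '' S) (T σ) :=
  (T.hasFDerivAt.hasFDerivWithinAt (s := S) (x := σ)).mapsTo_tangent_cone hw

theorem HolderSurface.isUnitNormalAt_imageNormal {S : Set E3} {n : E3 → E3}
    (h : HolderSurface β S n) (T : E3 ≃L[ℝ] E3) {σ : E3} (hσ : σ ∈ S) :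
    IsUnitNormalAt (T '' S) (T σ) (imageNormal T n (T σ)) := by
  refine ⟨norm_imageNormal T (h.norm_eq σ hσ), fun w hw => ?_⟩
  have h1 := tangentConeAt_image T.symm hw
  rw [T.symm_image_image, T.symm_apply_apply] at h1
  have h2 := inner_imageNormal T n σ (T.symm w)
  rwa [h.normal σ hσ _ h1, mul_zero, T.apply_symm_apply] at h2

/-- The tangent cone of the image contains the whole plane orthogonal to the image normal, so a unit
normal has no component in that plane. -/
theorem HolderSurface.exists_smul_imageNormal {S : Set E3} {n : E3 → E3}
    (h : HolderSurface β S n) (T : E3 ≃L[ℝ] E3) {σ v : E3} (hσ : σ ∈ S)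
    (hv : IsUnitNormalAt (T '' S) (T σ) v) :
    ∃ a : ℝ, |a| = 1 ∧ v = a • imageNormal T n (T σ) := by
  set N := imageNormal T n (T σ) with hN
  have hN1 : ‖N‖ = 1 := norm_imageNormal T (h.norm_eq σ hσ)
  have hort (w : E3) (hw : inner ℝ N w = 0) : inner ℝ v w = 0 := by
    have h1 := inner_imageNormal T n σ (T.symm w)
    rw [T.apply_symm_apply, ← hN, hw] at h1
    have h0 : n σ ≠ 0 := by
      intro h0
      have := h.norm_eq σ hσ
      simp [h0] at this
    have h2 := (mul_eq_zero.1 h1.symm).resolve_left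
      (inv_ne_zero (norm_ne_zero_iff.2 (adjoint_symm_ne_zero T h0)))
    have := hv.2 _ (tangentConeAt_image T (h.tangent σ hσ _ h2))
    rwa [T.apply_symm_apply] at this
  have e : v = inner ℝ N v • N := by
    have h1 : inner ℝ N (v - inner ℝ N v • N) = 0 := by
      rw [inner_sub_right, inner_smul_right, real_inner_self_eq_norm_sq, hN1]; ring
    have h2 : inner ℝ (v - inner ℝ N v • N) (v - inner ℝ N v • N) = 0 := by
      rw [inner_sub_left, hort _ h1, inner_smul_left, h1]; simp
    exact sub_eq_zero.1 (inner_self_eq_zero.1 h2)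
  refine ⟨inner ℝ N v, ?_, e⟩
  have := hv.1
  rw [e, norm_smul, hN1, mul_one] at this
  exact this

theorem det_columnMatrix_smul (a : Fin 3 → ℝ) (N : Fin 3 → E3) :
    (columnMatrix fun i => a i • N i).det = (∏ i, a i) * (columnMatrix N).det := by
  rw [← Matrix.det_mul_row]
  rfl

theorem columnMatrix_map (A : E3 →L[ℝ] E3) (N : Fin 3 → E3) :
    (columnMatrix fun i => A (N i)) =
      (columnMatrix fun j => A (EuclideanSpace.single j 1)) * columnMatrix N := by
  ext k i
  simp only [columnMatrix, Matrix.of_apply, Matrix.mul_apply]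
  have hx : N i = ∑ j, N i j • (EuclideanSpace.single j 1 : E3) := by
    ext k
    simp [Pi.single_apply]
  conv_lhs => rw [hx]
  simp [mul_comm]

/-- The determinant of the image normals is that of the original normals times a fixed nonzero
determinant, divided by three lengths which are at most the norm of the inverse adjoint. -/
theorem exists_pos_le_abs_det (h : ∀ i, HolderSurface β (S i) (n i))
    (hdet : ∀ σ : Fin 3 → E3, (∀ i, σ i ∈ S i) →
      1 / 2 ≤ (columnMatrix fun i => n i (σ i)).det) (T : E3 ≃L[ℝ] E3) :
    ∃ δ > 0, ∀ σ : Fin 3 → E3, (∀ i, σ i ∈ S i) →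
      δ ≤ |(columnMatrix fun i => imageNormal T (n i) (T (σ i))).det| := by
  set A := (T.symm : E3 →L[ℝ] E3).adjoint with hA
  set D := (columnMatrix fun j => A (EuclideanSpace.single j 1)).det with hD
  have hD0 : D ≠ 0 := by
    have e := columnMatrix_map A fun j =>
      (T : E3 →L[ℝ] E3).adjoint (EuclideanSpace.single j 1)
    have e2 (x : E3) : A ((T : E3 →L[ℝ] E3).adjoint x) = x := by
      refine ext_inner_right ℝ fun y => ?_
      rw [hA, ContinuousLinearMap.adjoint_inner_left, ContinuousLinearMap.adjoint_inner_left]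
      simp
    simp only [e2] at e
    have e3 : (columnMatrix fun j => EuclideanSpace.single j (1 : ℝ)) = 1 := by
      ext i j
      simp [columnMatrix, Matrix.one_apply]
    have := congrArg Matrix.det e
    rw [e3, Matrix.det_one, Matrix.det_mul] at this
    exact left_ne_zero_of_mul (this ▸ one_ne_zero)
  refine ⟨(‖A‖ + 1)⁻¹ ^ 3 * (|D| * (1 / 2)), by positivity, fun σ hσ => ?_⟩
  have e : (columnMatrix fun i => imageNormal T (n i) (T (σ i))).det =
      (∏ i, ‖A (n i (σ i))‖⁻¹) * (D * (columnMatrix fun i => n i (σ i)).det) := by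
    rw [hD, ← Matrix.det_mul, ← columnMatrix_map, ← det_columnMatrix_smul]
    simp only [imageNormal, T.symm_apply_apply, hA]
  rw [e, abs_mul, abs_mul, Finset.abs_prod]
  refine mul_le_mul ?_ ?_ (by positivity) (Finset.prod_nonneg fun _ _ => abs_nonneg _)
  · rw [show (‖A‖ + 1)⁻¹ ^ 3 = ∏ _i : Fin 3, (‖A‖ + 1)⁻¹ by simp]
    refine Finset.prod_le_prod (fun _ _ => by positivity) fun i _ => ?_
    have h1 := (h i).norm_eq _ (hσ i)
    have h0 : n i (σ i) ≠ 0 := by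
      intro h0
      simp [h0] at h1
    have hp : 0 < ‖A (n i (σ i))‖ := norm_pos_iff.2 (adjoint_symm_ne_zero T h0)
    rw [abs_of_pos (inv_pos.2 hp)]
    refine inv_anti₀ hp ?_
    have := A.le_opNorm (n i (σ i))
    rw [h1, mul_one] at this
    linarith
  · refine mul_le_mul_of_nonneg_left ?_ (abs_nonneg _)
    exact (hdet σ hσ).trans (le_abs_self _)

theorem transversalityInf_le (h : ∀ i, HolderSurface β (S i) (n i)) (T : E3 ≃L[ℝ] E3)
    {σ : Fin 3 → E3} (hσ : ∀ i, σ i ∈ S i) : transversalityInf (fun i => T '' S i) ≤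
      |(columnMatrix fun i => imageNormal T (n i) (T (σ i))).det| := by
  refine csInf_le ⟨0, ?_⟩ ⟨fun i => T (σ i), _, fun i => ⟨⟨_, hσ i, rfl⟩,
    (h i).isUnitNormalAt_imageNormal T (hσ i)⟩, rfl⟩
  rintro _ ⟨_, _, _, rfl⟩
  exact abs_nonneg _

/-- Since `1 / 0 = 0` for reals, the claimed bound would be useless at `d = 0`; this excludes it.
Every admissible normal is plus or minus the image normal, so the uniform lower bound applies to the
whole set. -/
theorem transversalityInf_pos (h : ∀ i, HolderSurface β (S i) (n i)) (hne : ∀ i, (S i).Nonempty)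
    (hdet : ∀ σ : Fin 3 → E3, (∀ i, σ i ∈ S i) →
      1 / 2 ≤ (columnMatrix fun i => n i (σ i)).det) (T : E3 ≃L[ℝ] E3) :
    0 < transversalityInf fun i => T '' S i := by
  obtain ⟨δ, hδ, hle⟩ := exists_pos_le_abs_det h hdet T
  refine hδ.trans_le (le_csInf ?_ ?_)
  · choose σ hσ using hne
    exact ⟨_, fun i => T (σ i), _, fun i => ⟨⟨_, hσ i, rfl⟩,
      (h i).isUnitNormalAt_imageNormal T (hσ i)⟩, rfl⟩
  · rintro _ ⟨x, v, hv, rfl⟩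
    choose σ hσ hx using fun i => (hv i).1
    choose a ha hav using fun i => (h i).exists_smul_imageNormal T (hσ i)
      (by rw [hx i]; exact (hv i).2)
    have e : v = fun i => a i • imageNormal T (n i) (T (σ i)) := funext hav
    rw [e, det_columnMatrix_smul, abs_mul, Finset.abs_prod]
    simpa [ha] using hle σ hσ

end triple

/-! ### Compactly supported functions, uniqueness and bilinearity of the density -/

theorem eLpNorm_two_sq {α : Type*} [MeasurableSpace α] (μ : Measure α) (f : α → ℂ) :
    eLpNorm f 2 μ ^ 2 = ∫⁻ x, ‖f x‖ₑ ^ 2 ∂μ := by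
  have := eLpNorm_nnreal_pow_eq_lintegral (f := f) (μ := μ) (p := 2) two_ne_zero
  simpa using this

theorem surfaceMeasure_restrict {P S : Set E3} (h : P ⊆ S) :
    (surfaceMeasure S).restrict P = surfaceMeasure P :=
  Measure.restrict_restrict_of_subset h

namespace IsCompactlySupportedOn

variable {S : Set E3} {f g : E3 → ℂ}

theorem exists_bound (h : IsCompactlySupportedOn S f) : ∃ C, ∀ x, ‖f x‖ ≤ C := by
  obtain ⟨hc, K, hKS, hK, h0⟩ := h
  obtain ⟨C, hC⟩ := hK.exists_bound_of_continuousOn (hc.mono hKS)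
  refine ⟨max C 0, fun x => ?_⟩
  by_cases hx : x ∈ K
  · exact (hC x hx).trans (le_max_left _ _)
  · simp [h0 x hx]

theorem memLp (h : IsCompactlySupportedOn S f) (hS : MeasurableSet S)
    [IsFiniteMeasure (surfaceMeasure S)] (p : ENNReal) : MemLp f p (surfaceMeasure S) := by
  obtain ⟨C, hC⟩ := h.exists_bound
  exact MemLp.of_bound (h.1.aestronglyMeasurable hS) C (Filter.Eventually.of_forall hC)

theorem integrable (h : IsCompactlySupportedOn S f) (hS : MeasurableSet S)
    [IsFiniteMeasure (surfaceMeasure S)] : Integrable f (surfaceMeasure S) :=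
  memLp_one_iff_integrable.1 (h.memLp hS 1)

theorem add (hf : IsCompactlySupportedOn S f) (hg : IsCompactlySupportedOn S g) :
    IsCompactlySupportedOn S (f + g) := by
  obtain ⟨hc, K, hKS, hK, h0⟩ := hf
  obtain ⟨hc', K', hKS', hK', h0'⟩ := hg
  refine ⟨hc.add hc', K ∪ K', Set.union_subset hKS hKS', hK.union hK', fun x hx => ?_⟩
  rw [Pi.add_apply, h0 x fun h => hx (Or.inl h), h0' x fun h => hx (Or.inr h), add_zero]

theorem smul (c : ℂ) (hf : IsCompactlySupportedOn S f) : IsCompactlySupportedOn S (c • f) := by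
  obtain ⟨hc, K, hKS, hK, h0⟩ := hf
  exact ⟨continuousOn_const.smul hc, K, hKS, hK, fun x hx => by simp [h0 x hx]⟩

theorem zero : IsCompactlySupportedOn S 0 :=
  ⟨continuousOn_const, ∅, Set.empty_subset _, isCompact_empty, fun _ _ => rfl⟩

end IsCompactlySupportedOn

section represents

variable {S₁ S₂ : Set E3} {f f' g g' F F' : E3 → ℂ}

theorem integrable_conv {μ ν : Measure E3} [SFinite μ] [SFinite ν] (hf : Integrable f μ)
    (hg : Integrable g ν) {ψ : E3 → ℂ} (hψ : Continuous ψ) (hs : HasCompactSupport ψ) :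
    Integrable (fun p : E3 × E3 => f p.1 * g p.2 * ψ (p.1 + p.2)) (μ.prod ν) := by
  obtain ⟨C, hC⟩ := hψ.bounded_above_of_compact_support hs
  refine (hf.mul_prod hg).mul_bdd (c := C) ?_ (Filter.Eventually.of_forall fun p => hC _)
  exact Continuous.aestronglyMeasurable (by fun_prop)

/-- A continuous density is determined everywhere by its integrals against test functions. This
allows densities found with different third pieces to be identified, and makes the trace bilinear.
-/
theorem RepresentsConvolution.eq (h : RepresentsConvolution S₁ S₂ f g F)
    (h' : RepresentsConvolution S₁ S₂ f g F') (hF : Continuous F) (hF' : Continuous F') :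
    F = F' := by
  have hc : Continuous fun z => F z - F' z := hF.sub hF'
  have h0 : ∀ᵐ z, F z - F' z = 0 := by
    refine ae_eq_zero_of_integral_contDiff_smul_eq_zero hc.locallyIntegrable fun ψ hψ hs => ?_
    have hψ' : ContDiff ℝ (⊤ : ℕ∞) fun z => (ψ z : ℂ) := Complex.ofRealCLM.contDiff.comp hψ
    have hs' : HasCompactSupport fun z => (ψ z : ℂ) := hs.comp_left (g := fun x : ℝ => (x : ℂ)) rfl
    have e := (h _ hψ' hs').symm.trans (h' _ hψ' hs')
    have hi {G : E3 → ℂ} (hG : Continuous G) : Integrable fun z => G z * (ψ z : ℂ) :=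
      (hG.mul hψ'.continuous).integrable_of_hasCompactSupport hs'.mul_left
    simp only [Complex.real_smul, mul_sub]
    simp only [mul_comm _ (F _), mul_comm _ (F' _)]
    rw [integral_sub (hi hF) (hi hF'), e, sub_self]
  funext z
  have := (hc.ae_eq_iff_eq volume continuous_const).1 h0
  exact sub_eq_zero.1 (congrFun this z)

theorem RepresentsConvolution.smul_left (c : ℂ) (h : RepresentsConvolution S₁ S₂ f g F) :
    RepresentsConvolution S₁ S₂ (c • f) g (c • F) := by
  intro ψ hψ hs
  simp only [Pi.smul_apply, smul_eq_mul, mul_assoc c, integral_const_mul]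
  rw [h ψ hψ hs]

theorem RepresentsConvolution.smul_right (c : ℂ) (h : RepresentsConvolution S₁ S₂ f g F) :
    RepresentsConvolution S₁ S₂ f (c • g) (c • F) := by
  intro ψ hψ hs
  simp only [Pi.smul_apply, smul_eq_mul, mul_left_comm _ c, mul_assoc c, integral_const_mul]
  rw [h ψ hψ hs]

variable [IsFiniteMeasure (surfaceMeasure S₁)] [IsFiniteMeasure (surfaceMeasure S₂)]

theorem RepresentsConvolution.sum {ι κ : Type*} {s : Finset ι} {t : Finset κ}
    {f : ι → E3 → ℂ} {g : κ → E3 → ℂ} {F : ι → κ → E3 → ℂ}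
    (hf : ∀ a ∈ s, Integrable (f a) (surfaceMeasure S₁))
    (hg : ∀ b ∈ t, Integrable (g b) (surfaceMeasure S₂))
    (hF : ∀ a ∈ s, ∀ b ∈ t, Continuous (F a b))
    (h : ∀ a ∈ s, ∀ b ∈ t, RepresentsConvolution S₁ S₂ (f a) (g b) (F a b)) :
    RepresentsConvolution S₁ S₂ (∑ a ∈ s, f a) (∑ b ∈ t, g b) (∑ a ∈ s, ∑ b ∈ t, F a b) := by
  intro ψ hψ hs
  have hi {a b} (ha : a ∈ s) (hb : b ∈ t) := integrable_conv (hf a ha) (hg b hb) hψ.continuous hs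
  have hi2 {a b} (ha : a ∈ s) (hb : b ∈ t) : Integrable fun z => F a b z * ψ z :=
    ((hF a ha b hb).mul hψ.continuous).integrable_of_hasCompactSupport hs.mul_left
  have hfs : Integrable (∑ a ∈ s, f a) (surfaceMeasure S₁) := integrable_finsetSum' _ hf
  have hgs : Integrable (∑ b ∈ t, g b) (surfaceMeasure S₂) := integrable_finsetSum' _ hg
  rw [integral_integral (f := fun x y => (∑ a ∈ s, f a) x * (∑ b ∈ t, g b) y * ψ (x + y))
    (integrable_conv hfs hgs hψ.continuous hs)]
  simp only [Finset.sum_apply, Finset.sum_mul_sum]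
  simp only [Finset.sum_mul]
  rw [integral_finsetSum _ fun a ha => integrable_finsetSum _ fun b hb => hi ha hb,
    integral_finsetSum _ fun a ha => integrable_finsetSum _ fun b hb => hi2 ha hb]
  refine Finset.sum_congr rfl fun a ha => ?_
  rw [integral_finsetSum _ fun b hb => hi ha hb, integral_finsetSum _ fun b hb => hi2 ha hb]
  refine Finset.sum_congr rfl fun b hb => ?_
  rw [← h a ha b hb ψ hψ hs,
    integral_integral (f := fun x y => f a x * g b y * ψ (x + y)) (hi ha hb)]

theorem RepresentsConvolution.add_left (hf : Integrable f (surfaceMeasure S₁))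
    (hf' : Integrable f' (surfaceMeasure S₁)) (hg : Integrable g (surfaceMeasure S₂))
    (hF : Continuous F) (hF' : Continuous F') (h : RepresentsConvolution S₁ S₂ f g F)
    (h' : RepresentsConvolution S₁ S₂ f' g F') :
    RepresentsConvolution S₁ S₂ (f + f') g (F + F') := by
  have := RepresentsConvolution.sum (s := Finset.univ) (t := Finset.univ) (f := ![f, f'])
    (g := fun _ : Unit => g) (F := fun a _ => ![F, F'] a) (S₁ := S₁) (S₂ := S₂)
    (by simp [Fin.forall_fin_two, hf, hf']) (by simp [hg]) (by simp [Fin.forall_fin_two, hF, hF'])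
    (by simp [Fin.forall_fin_two, h, h'])
  simpa using this

theorem RepresentsConvolution.add_right (hf : Integrable f (surfaceMeasure S₁))
    (hg : Integrable g (surfaceMeasure S₂)) (hg' : Integrable g' (surfaceMeasure S₂))
    (hF : Continuous F) (hF' : Continuous F') (h : RepresentsConvolution S₁ S₂ f g F)
    (h' : RepresentsConvolution S₁ S₂ f g' F') :
    RepresentsConvolution S₁ S₂ f (g + g') (F + F') := by
  have := RepresentsConvolution.sum (s := Finset.univ) (t := Finset.univ) (g := ![g, g'])
    (f := fun _ : Unit => f) (F := fun _ b => ![F, F'] b) (S₁ := S₁) (S₂ := S₂)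
    (by simp [hf]) (by simp [Fin.forall_fin_two, hg, hg']) (by simp [Fin.forall_fin_two, hF, hF'])
    (by simp [Fin.forall_fin_two, h, h'])
  simpa using this

end represents

/-! ### Finite covers and partitions of unity -/

theorem HolderSurface.measure_inter_lt_top {β : ℝ} {S : Set E3} {n : E3 → E3}
    (h : HolderSurface β S n) {B : Set E3}
    (hsmall : ∀ σ ∈ S ∩ B, ∀ τ ∈ S ∩ B, ‖σ - τ‖ ^ β ≤ 1 / 400) :
    (μHE[2] : Measure E3) (S ∩ B) < ⊤ := by
  rcases (S ∩ B).eq_empty_or_nonempty with he | ⟨ρ, hρ⟩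
  · simp [he]
  have hN := h.norm_eq ρ hρ.1
  -- The sweep direction is the normal at `ρ` itself; 1/200 is the sum of the two bounds 1/400 in
  -- `abs_inner_sub_le`.
  refine measure_lt_top_of_flat (η := 1 / 200) (N := n ρ) (v := n ρ) ?_ ?_ hN ?_
    (h.isBounded.subset Set.inter_subset_left)
  · rw [← NNReal.coe_lt_coe]; norm_num
  · intro x hx y hy
    refine (h.abs_inner_sub_le hρ.1 hx.1 hy.1).trans ?_
    rw [real_inner_self_eq_norm_sq, hN]
    have h1 := hsmall ρ hρ x hx
    have h2 := hsmall x hx y hy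
    refine mul_le_mul_of_nonneg_right ?_ (norm_nonneg _)
    norm_num
    linarith
  · rw [real_inner_self_eq_norm_sq, hN]; norm_num

theorem HolderSurface.isFiniteMeasure_image {β : ℝ} {S : Set E3} {n : E3 → E3}
    (h : HolderSurface β S n) {ι : Type*} {t : Finset ι} {B : ι → Set E3}
    (hcov : S ⊆ ⋃ c ∈ t, B c)
    (hsmall : ∀ c ∈ t, ∀ σ ∈ S ∩ B c, ∀ τ ∈ S ∩ B c, ‖σ - τ‖ ^ β ≤ 1 / 400) (T : E3 ≃L[ℝ] E3) :
    IsFiniteMeasure (surfaceMeasure (T '' S)) := by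
  refine ⟨?_⟩
  rw [surfaceMeasure, Measure.restrict_apply_univ]
  refine (euclideanHausdorffMeasure_image_le
    (T : E3 →L[ℝ] E3).lipschitz.lipschitzOnWith).trans_lt ?_
  refine ENNReal.mul_lt_top (ENNReal.pow_lt_top ENNReal.coe_lt_top) ?_
  have : S ⊆ ⋃ c ∈ t, S ∩ B c := by
    rw [← Set.inter_iUnion₂]
    exact Set.subset_inter subset_rfl hcov
  refine (measure_mono this).trans_lt ((measure_biUnion_finset_le _ _).trans_lt ?_)
  exact ENNReal.sum_lt_top.2 fun c hc => h.measure_inter_lt_top (hsmall c hc)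

/-- The partition of unity consists of the tent functions of radius `r`, divided by their sum, which
is positive on the surface. The closed support lies in a ball of radius `r`, and doubling the radius
gives an open ball containing it. -/
theorem exists_partition (T : E3 ≃L[ℝ] E3) {S : Set E3} {x : E3} {t : Finset E3} {r : ℝ}
    (hr : 0 < r) (hcov : S ⊆ ⋃ c ∈ t, Metric.ball (x + c) r) {f : E3 → ℂ}
    (hf : IsCompactlySupportedOn (T '' S) f) :
    ∃ u : E3 → E3 → ℂ, ∑ c ∈ t, u c = f ∧ ∀ c ∈ t, ContinuousOn (u c) (T '' S) ∧
      (∀ y, ‖u c y‖ ≤ ‖f y‖) ∧ ∃ K ⊆ T '' (S ∩ Metric.ball (x + c) (2 * r)), IsCompact K ∧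
        ∀ y ∉ K, u c y = 0 := by
  obtain ⟨hc, K, hKS, hK, h0⟩ := hf
  set q : E3 → E3 → ℝ := fun c y => max 0 (r - dist (T.symm y) (x + c)) with hq
  have hq0 (c y) : 0 ≤ q c y := le_max_left _ _
  have hqc (c) : Continuous (q c) := by fun_prop
  set Q : E3 → ℝ := fun y => ∑ c ∈ t, q c y with hQ
  have hQc : Continuous Q := by fun_prop
  have hQ0 (y) (hy : y ∈ T '' S) : 0 < Q y := by
    obtain ⟨σ, hσ, rfl⟩ := hy
    obtain ⟨c, hct, hσc⟩ := Set.mem_iUnion₂.1 (hcov hσ)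
    refine (Finset.sum_pos_iff_of_nonneg fun c _ => hq0 c _).2 ⟨c, hct, lt_max_of_lt_right ?_⟩
    rw [T.symm_apply_apply]
    linarith [Metric.mem_ball.1 hσc]
  refine ⟨fun c y => ((q c y / Q y : ℝ) : ℂ) * f y, ?_, fun c hct => ⟨?_, fun y => ?_, ?_⟩⟩
  · funext y
    simp only [Finset.sum_apply]
    by_cases hy : y ∈ K
    · rw [← Finset.sum_mul, ← Complex.ofReal_sum, ← Finset.sum_div,
        div_self (hQ0 y (hKS hy)).ne', Complex.ofReal_one, one_mul]
    · simp [h0 y hy]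
  · exact (Complex.continuous_ofReal.comp_continuousOn ((hqc c).continuousOn.div hQc.continuousOn
      fun y hy => (hQ0 y hy).ne')).mul hc
  · rw [norm_mul, Complex.norm_real]
    refine mul_le_of_le_one_left (norm_nonneg _) ?_
    have hle : q c y ≤ Q y := Finset.single_le_sum (f := fun c => q c y) (fun c _ => hq0 c y) hct
    rw [Real.norm_of_nonneg (div_nonneg (hq0 c y) ((hq0 c y).trans hle))]
    exact div_le_one_of_le₀ hle ((hq0 c y).trans hle)
  · refine ⟨K ∩ T.symm ⁻¹' Metric.closedBall (x + c) r, ?_, hK.inter_right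
      (Metric.isClosed_closedBall.preimage T.symm.continuous), fun y hy => ?_⟩
    · rintro y ⟨hyK, hyc⟩
      obtain ⟨σ, hσ, rfl⟩ := hKS hyK
      rw [Set.mem_preimage, T.symm_apply_apply] at hyc
      exact ⟨σ, ⟨hσ, Metric.closedBall_subset_ball (by linarith) hyc⟩, rfl⟩
    · by_cases hyK : y ∈ K
      · have : r < dist (T.symm y) (x + c) := by
          by_contra! hle
          exact hy ⟨hyK, hle⟩
        have : q c y = 0 := max_eq_left (by linarith)
        simp [this]
      · simp [h0 y hyK]

section triple

variable {β : ℝ} {S : Fin 3 → Set E3} {n : Fin 3 → E3 → E3}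

/-- The surface carrying the trace is also cut into pieces. The frame depends on the third piece,
but by uniqueness the density does not, so the squared `L²` bounds on the pieces may be added. -/
theorem exists_density_of_small_support (hβ : 0 < β) (h : ∀ i, HolderSurface β (S i) (n i))
    (hdet : ∀ σ : Fin 3 → E3, (∀ i, σ i ∈ S i) →
      1 / 2 ≤ (columnMatrix fun i => n i (σ i)).det) (hne : (S 2).Nonempty)
    (T : E3 ≃L[ℝ] E3) {d : ℝ} (hd : 0 < d)
    (hd' : ∀ σ : Fin 3 → E3, (∀ i, σ i ∈ S i) →
      d ≤ |(columnMatrix fun i => imageNormal T (n i) (T (σ i))).det|)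
    {t : Finset E3} {B : Fin 3 → E3 → Set E3} (hB : ∀ i c, IsOpen (B i c))
    (hsmall : ∀ i c, ∀ σ ∈ S i ∩ B i c, ∀ τ ∈ S i ∩ B i c, ‖σ - τ‖ ^ β ≤ 1 / 400)
    (hcov : S 2 ⊆ ⋃ c ∈ t, B 2 c) (a b : E3) {f g : E3 → ℂ}
    (hf : ContinuousOn f (T '' S 0)) (hg : ContinuousOn g (T '' S 1))
    {K₀ K₁ : Set E3} (hK₀ : IsCompact K₀) (hK₁ : IsCompact K₁)
    (hKM₀ : K₀ ⊆ T '' (S 0 ∩ B 0 a)) (hKM₁ : K₁ ⊆ T '' (S 1 ∩ B 1 b))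
    (hf0 : ∀ x ∉ K₀, f x = 0) (hg0 : ∀ x ∉ K₁, g x = 0) :
    ∃ F : E3 → ℂ, Continuous F ∧ HasCompactSupport F ∧
      RepresentsConvolution (T '' S 0) (T '' S 1) f g F ∧
      ∫⁻ z, ‖F z‖ₑ ^ 2 ∂(surfaceMeasure (T '' S 2)) ≤ t.card * (ENNReal.ofReal (1 / d) *
        ((∫⁻ x, ‖f x‖ₑ ^ 2 ∂(surfaceMeasure (T '' S 0))) *
          ∫⁻ y, ‖g y‖ₑ ^ 2 ∂(surfaceMeasure (T '' S 1)))) := by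
  have hsub (i c) : T '' (S i ∩ B i c) ⊆ T '' S i := Set.image_mono Set.inter_subset_left
  by_cases hne₀ : (S 0 ∩ B 0 a).Nonempty
  swap
  · have : K₀ = ∅ := by
      rw [Set.not_nonempty_iff_eq_empty.1 hne₀, Set.image_empty] at hKM₀
      exact Set.subset_empty_iff.1 hKM₀
    have hz : ∀ x, f x = 0 := fun x => hf0 x (by simp [this])
    exact ⟨0, continuous_const, HasCompactSupport.zero, fun ψ _ _ => by simp [hz], by simp⟩
  by_cases hne₁ : (S 1 ∩ B 1 b).Nonempty
  swap
  · have : K₁ = ∅ := by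
      rw [Set.not_nonempty_iff_eq_empty.1 hne₁, Set.image_empty] at hKM₁
      exact Set.subset_empty_iff.1 hKM₁
    have hz : ∀ x, g x = 0 := fun x => hg0 x (by simp [this])
    exact ⟨0, continuous_const, HasCompactSupport.zero, fun ψ _ _ => by simp [hz], by simp⟩
  have key (c) (hc : (S 2 ∩ B 2 c).Nonempty) : ∃ F : E3 → ℂ, Continuous F ∧ HasCompactSupport F ∧
      RepresentsConvolution (T '' S 0) (T '' S 1) f g F ∧
      ∫⁻ z, ‖F z‖ₑ ^ 2 ∂(surfaceMeasure (T '' (S 2 ∩ B 2 c))) ≤ ENNReal.ofReal (1 / d) *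
        ((∫⁻ x, ‖f x‖ₑ ^ 2 ∂(surfaceMeasure (T '' S 0))) *
          ∫⁻ y, ‖g y‖ₑ ^ 2 ∂(surfaceMeasure (T '' S 1))) := by
    obtain ⟨F, hFc, hFs, hFi, hFb⟩ := exists_density_pieces hβ h hdet T hd hd'
      (B := ![B 0 a, B 1 b, B 2 c]) (by intro i; fin_cases i <;> exact hB _ _)
      (by intro i; fin_cases i <;> exact hsmall _ _)
      (by intro i; fin_cases i <;> assumption) (hf.mono (hsub 0 a)) (hg.mono (hsub 1 b))
      hK₀ hK₁ hKM₀ hKM₁ hf0 hg0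
    refine ⟨F, hFc, hFs, fun ψ hψ _ => ?_, hFb.trans ?_⟩
    · rw [← hFi ψ hψ.continuous]
      simp only [Matrix.cons_val_zero, Matrix.cons_val_one]
      rw [← surfaceMeasure_restrict (hsub 0 a), ← surfaceMeasure_restrict (hsub 1 b),
        setIntegral_eq_integral_of_forall_compl_eq_zero]
      · refine integral_congr_ae (Filter.Eventually.of_forall fun x => ?_)
        refine (setIntegral_eq_integral_of_forall_compl_eq_zero fun y hy => ?_).symm
        rw [hg0 y fun h => hy (hKM₁ h), mul_zero, zero_mul]
      · intro x hx
        simp [hf0 x fun h => hx (hKM₀ h)]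
    · simp only [Matrix.cons_val_zero, Matrix.cons_val_one]
      rw [← surfaceMeasure_restrict (hsub 0 a), ← surfaceMeasure_restrict (hsub 1 b)]
      gcongr <;> exact Measure.restrict_le_self
  obtain ⟨σ, hσ⟩ := hne
  obtain ⟨c₀, -, hc₀⟩ := Set.mem_iUnion₂.1 (hcov hσ)
  obtain ⟨F, hFc, hFs, hFi, -⟩ := key c₀ ⟨σ, hσ, hc₀⟩
  refine ⟨F, hFc, hFs, hFi, ?_⟩
  have hcov' : T '' S 2 = ⋃ c : t, T '' (S 2 ∩ B 2 c) := by
    rw [← Set.image_iUnion, ← Set.inter_iUnion, Set.inter_eq_left.2]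
    refine hcov.trans (Set.iUnion₂_subset fun c hc => ?_)
    exact Set.subset_iUnion (fun c : t => B 2 c) ⟨c, hc⟩
  have hle : ∫⁻ z, ‖F z‖ₑ ^ 2 ∂(surfaceMeasure (T '' S 2)) ≤
      ∑ c : t, ∫⁻ z, ‖F z‖ₑ ^ 2 ∂(surfaceMeasure (T '' (S 2 ∩ B 2 c))) := by
    unfold surfaceMeasure
    conv_lhs => rw [hcov']
    exact (lintegral_iUnion_le _ _).trans_eq (tsum_fintype _)
  refine hle.trans ?_
  rw [← nsmul_eq_mul, ← Fintype.card_coe]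
  refine Finset.sum_le_card_nsmul _ _ _ fun c _ => ?_
  by_cases hc : (S 2 ∩ B 2 c).Nonempty
  · obtain ⟨F', hFc', -, hFi', hFb'⟩ := key c hc
    rwa [hFi.eq hFi' hFc hFc']
  · rw [Set.not_nonempty_iff_eq_empty.1 hc, Set.image_empty, surfaceMeasure]
    simp

/-- The number of pieces enters three times: once for cutting the third surface, and once for each
of the partitions of `f` and `g`. -/
theorem exists_density (hβ : 0 < β) (h : ∀ i, HolderSurface β (S i) (n i))
    (hdet : ∀ σ : Fin 3 → E3, (∀ i, σ i ∈ S i) →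
      1 / 2 ≤ (columnMatrix fun i => n i (σ i)).det) (hne : (S 2).Nonempty)
    (T : E3 ≃L[ℝ] E3) [∀ i, IsFiniteMeasure (surfaceMeasure (T '' S i))] {d : ℝ} (hd : 0 < d)
    (hd' : ∀ σ : Fin 3 → E3, (∀ i, σ i ∈ S i) →
      d ≤ |(columnMatrix fun i => imageNormal T (n i) (T (σ i))).det|)
    {t : Finset E3} {r : ℝ} (hr : 0 < r) (hrβ : (4 * r) ^ β ≤ 1 / 400) {x : Fin 3 → E3}
    (hcov : ∀ i, S i ⊆ ⋃ c ∈ t, Metric.ball (x i + c) r) {f g : E3 → ℂ}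
    (hf : IsCompactlySupportedOn (T '' S 0) f) (hg : IsCompactlySupportedOn (T '' S 1) g) :
    ∃ F : E3 → ℂ, Continuous F ∧ HasCompactSupport F ∧
      RepresentsConvolution (T '' S 0) (T '' S 1) f g F ∧
      eLpNorm F 2 (surfaceMeasure (T '' S 2)) ≤ ENNReal.ofReal (t.card ^ 3 / √d) *
        (eLpNorm f 2 (surfaceMeasure (T '' S 0)) * eLpNorm g 2 (surfaceMeasure (T '' S 1))) := by
  obtain ⟨u, hu, hu'⟩ := exists_partition T hr (hcov 0) hf
  obtain ⟨v, hv, hv'⟩ := exists_partition T hr (hcov 1) hg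
  have hsmall (i c) (σ) (hσ : σ ∈ S i ∩ Metric.ball (x i + c) (2 * r)) (τ)
      (hτ : τ ∈ S i ∩ Metric.ball (x i + c) (2 * r)) : ‖σ - τ‖ ^ β ≤ 1 / 400 := by
    refine (Real.rpow_le_rpow (norm_nonneg _) ?_ hβ.le).trans hrβ
    have := dist_triangle_right σ τ (x i + c)
    rw [← dist_eq_norm]
    linarith [Metric.mem_ball.1 hσ.2, Metric.mem_ball.1 hτ.2]
  have hcov2 : S 2 ⊆ ⋃ c ∈ t, Metric.ball (x 2 + c) (2 * r) :=
    (hcov 2).trans (Set.iUnion₂_mono fun c _ => Metric.ball_subset_ball (by linarith))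
  have key (a b) (ha : a ∈ t) (hb : b ∈ t) : ∃ F : E3 → ℂ, Continuous F ∧ HasCompactSupport F ∧
      RepresentsConvolution (T '' S 0) (T '' S 1) (u a) (v b) F ∧
      eLpNorm F 2 (surfaceMeasure (T '' S 2)) ≤ ENNReal.ofReal (t.card / √d) *
        (eLpNorm f 2 (surfaceMeasure (T '' S 0)) * eLpNorm g 2 (surfaceMeasure (T '' S 1))) := by
    obtain ⟨huc, hun, K₀, hKM₀, hK₀, hu0⟩ := hu' a ha
    obtain ⟨hvc, hvn, K₁, hKM₁, hK₁, hv0⟩ := hv' b hb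
    obtain ⟨F, hFc, hFs, hFi, hFb⟩ := exists_density_of_small_support hβ h hdet hne T hd hd'
      (t := t) (B := fun i c => Metric.ball (x i + c) (2 * r)) (fun _ _ => Metric.isOpen_ball)
      hsmall hcov2 a b huc hvc hK₀ hK₁ hKM₀ hKM₁ hu0 hv0
    refine ⟨F, hFc, hFs, hFi, ?_⟩
    rw [← ENNReal.pow_le_pow_left_iff two_ne_zero, mul_pow, mul_pow, eLpNorm_two_sq]
    refine hFb.trans ?_
    rw [← mul_assoc, ← eLpNorm_two_sq, ← eLpNorm_two_sq]
    -- The cut of the third surface costs only the square root of the number of pieces; it is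
    -- rounded up to the full number.
    have hcard : (t.card : ENNReal) * ENNReal.ofReal (1 / d) ≤
        ENNReal.ofReal (t.card / √d) ^ 2 := by
      rw [← ENNReal.ofReal_natCast, ← ENNReal.ofReal_mul (by positivity),
        ← ENNReal.ofReal_pow (by positivity)]
      refine ENNReal.ofReal_le_ofReal ?_
      rw [div_pow, Real.sq_sqrt hd.le, mul_one_div]
      gcongr
      have : t.card ≤ t.card ^ 2 := Nat.le_self_pow two_ne_zero _
      exact_mod_cast this
    have e1 := eLpNorm_mono (p := 2) (μ := surfaceMeasure (T '' S 0)) hun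
    have e2 := eLpNorm_mono (p := 2) (μ := surfaceMeasure (T '' S 1)) hvn
    gcongr
  choose! F hFc hFs hFi hFb using key
  have hS (i) : MeasurableSet (T '' S i) := by
    obtain ⟨U, Z, hU, hZ, e⟩ := (h i).isLocallyClosed
    refine T.toHomeomorph.measurableEmbedding.measurableSet_image.2 ?_
    rw [e]
    exact hU.measurableSet.inter hZ.measurableSet
  have hsub (i c) : T '' (S i ∩ Metric.ball (x i + c) (2 * r)) ⊆ T '' S i :=
    Set.image_mono Set.inter_subset_left
  refine ⟨∑ a ∈ t, ∑ b ∈ t, F a b, ?_, ?_, ?_, ?_⟩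
  · exact Finset.sum_induction _ _ (fun _ _ => Continuous.add) continuous_zero fun a ha =>
      Finset.sum_induction _ _ (fun _ _ => Continuous.add) continuous_zero (hFc a · ha)
  · exact Finset.sum_induction _ _ (fun _ _ => HasCompactSupport.add) .zero fun a ha =>
      Finset.sum_induction _ _ (fun _ _ => HasCompactSupport.add) .zero (hFs a · ha)
  · rw [← hu, ← hv]
    refine RepresentsConvolution.sum (fun a ha => ?_) (fun b hb => ?_)
      (fun a ha b hb => hFc a b ha hb) fun a ha b hb => hFi a b ha hb
    · obtain ⟨huc, hun, K₀, hKM₀, hK₀, hu0⟩ := hu' a ha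
      exact IsCompactlySupportedOn.integrable ⟨huc, K₀, hKM₀.trans (hsub 0 a), hK₀, hu0⟩ (hS 0)
    · obtain ⟨hvc, hvn, K₁, hKM₁, hK₁, hv0⟩ := hv' b hb
      exact IsCompactlySupportedOn.integrable ⟨hvc, K₁, hKM₁.trans (hsub 1 b), hK₁, hv0⟩ (hS 1)
  · have hm (a b) (ha : a ∈ t) (hb : b ∈ t) :
        AEStronglyMeasurable (F a b) (surfaceMeasure (T '' S 2)) :=
      (hFc a b ha hb).aestronglyMeasurable
    set X := eLpNorm f 2 (surfaceMeasure (T '' S 0)) * eLpNorm g 2 (surfaceMeasure (T '' S 1))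
    have hsum (a) (ha : a ∈ t) : eLpNorm (∑ b ∈ t, F a b) 2 (surfaceMeasure (T '' S 2)) ≤
        t.card • (ENNReal.ofReal (t.card / √d) * X) :=
      (eLpNorm_sum_le (fun b hb => hm a b ha hb) one_le_two).trans
        (Finset.sum_le_card_nsmul _ _ _ fun b hb => hFb a b ha hb)
    refine (eLpNorm_sum_le (fun a ha => ?_) one_le_two).trans
      ((Finset.sum_le_card_nsmul _ _ _ hsum).trans_eq ?_)
    · exact Finset.aestronglyMeasurable_sum _ fun b hb => hm a b ha hb
    · rw [nsmul_eq_mul, nsmul_eq_mul, ← mul_assoc, ← mul_assoc, ← ENNReal.ofReal_natCast,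
        ← ENNReal.ofReal_mul (by positivity), ← ENNReal.ofReal_mul (by positivity)]
      congr 2
      ring

end triple

/-! ### Extension from continuous functions to `L²` -/

theorem exists_bilinear_extension {E₀ E₁ X Y Z : Type*} [AddCommGroup E₀] [Module ℂ E₀]
    [AddCommGroup E₁] [Module ℂ E₁] [NormedAddCommGroup X] [NormedSpace ℂ X]
    [NormedAddCommGroup Y] [NormedSpace ℂ Y] [NormedAddCommGroup Z] [NormedSpace ℂ Z]
    [CompleteSpace Z] {e₀ : E₀ →ₗ[ℂ] X} {e₁ : E₁ →ₗ[ℂ] Y} (h₀ : DenseRange e₀)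
    (h₁ : DenseRange e₁) (b : E₀ →ₗ[ℂ] E₁ →ₗ[ℂ] Z) {C : ℝ} (hC : 0 ≤ C)
    (hb : ∀ f g, ‖b f g‖ ≤ C * ‖e₀ f‖ * ‖e₁ g‖) :
    ∃ B : X →L[ℂ] Y →L[ℂ] Z, (∀ f g, B (e₀ f) (e₁ g) = b f g) ∧
      ∀ x y, ‖B x y‖ ≤ C * ‖x‖ * ‖y‖ := by
  have hB (f) (g) : (b f).extendOfNorm e₁ (e₁ g) = b f g :=
    LinearMap.extendOfNorm_eq h₁ ⟨_, hb f⟩ g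
  have hext {u v : Y →L[ℂ] Z} (h : ∀ g, u (e₁ g) = v (e₁ g)) : u = v :=
    ContinuousLinearMap.coeFn_injective
      (h₁.equalizer u.continuous v.continuous (funext h))
  -- The second variable is extended first. Linearity in the first variable passes to the extensions
  -- because operators agreeing on a dense range are equal.
  let b' : E₀ →ₗ[ℂ] Y →L[ℂ] Z :=
    { toFun := fun f => (b f).extendOfNorm e₁
      map_add' := fun f f' => hext fun g => (hB _ g).trans (by simp [hB])
      map_smul' := fun c f => hext fun g => (hB _ g).trans (by simp [hB]) }
  have hb' (f) : ‖b' f‖ ≤ C * ‖e₀ f‖ :=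
    LinearMap.opNorm_extendOfNorm_le h₁ (by positivity) (hb f)
  refine ⟨b'.extendOfNorm e₀, fun f g => ?_, fun x y => ?_⟩
  · rw [LinearMap.extendOfNorm_eq h₀ ⟨_, hb'⟩]
    exact hB f g
  · exact ((b'.extendOfNorm e₀ x).le_opNorm y).trans (mul_le_mul_of_nonneg_right
      (LinearMap.norm_extendOfNorm_apply_le h₀ _ hb' x) (norm_nonneg _))

/-- A locally closed subset is a locally compact space in its own right, on which compactly
supported continuous functions are dense in `L²`. The approximant is extended by zero. -/
theorem exists_isCompactlySupportedOn_eLpNorm_sub_le {S : Set E3} (hS : IsLocallyClosed S)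
    (hm : MeasurableSet S) [hfin : IsFiniteMeasure (surfaceMeasure S)] {f : E3 → ℂ}
    (hf : MemLp f 2 (surfaceMeasure S)) {ε : ENNReal} (hε : ε ≠ 0) :
    ∃ g, IsCompactlySupportedOn S g ∧ eLpNorm (f - g) 2 (surfaceMeasure S) ≤ ε := by
  have : LocallyCompactSpace S := hS.locallyCompactSpace
  set ν : Measure S := (μHE[2] : Measure E3).comap Subtype.val with hν
  have hemb : MeasurableEmbedding (Subtype.val : S → E3) := MeasurableEmbedding.subtype_coe hm
  have hmap : ν.map Subtype.val = surfaceMeasure S := map_comap_subtype_coe hm _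
  have : IsFiniteMeasure ν := by
    refine ⟨?_⟩
    have := measure_lt_top (surfaceMeasure S) Set.univ
    rwa [← hmap, hemb.map_apply, Set.preimage_univ] at this
  rw [← hmap, hemb.memLp_map_measure_iff] at hf
  obtain ⟨g, hgs, hg, hgc, -⟩ := hf.exists_hasCompactSupport_eLpNorm_sub_le (by simp) hε
  have hx (x : S) : Function.extend Subtype.val g 0 (x : E3) = g x :=
    Subtype.val_injective.extend_apply g 0 x
  refine ⟨Function.extend Subtype.val g 0, ⟨?_, Subtype.val '' tsupport g, ?_,
    hgs.isCompact.image continuous_subtype_val, fun x hx' => ?_⟩, ?_⟩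
  · rw [continuousOn_iff_continuous_domRestrict]
    convert hgc using 1
    exact funext hx
  · rintro _ ⟨x, -, rfl⟩
    exact x.2
  · by_cases hxS : x ∈ S
    · rw [hx ⟨x, hxS⟩]
      by_contra h0
      exact hx' ⟨⟨x, hxS⟩, subset_tsupport _ h0, rfl⟩
    · refine Function.extend_apply' _ _ _ ?_
      rintro ⟨y, rfl⟩
      exact hxS y.2
  · rw [← hmap, hemb.eLpNorm_map_measure]
    convert hg using 2
    funext x
    simp

/-- The space of continuous functions with compact support on `S`. -/
def surfaceCc (S : Set E3) : Submodule ℂ (E3 → ℂ) where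
  carrier := {f | IsCompactlySupportedOn S f}
  add_mem' hf hg := hf.add hg
  zero_mem' := .zero
  smul_mem' c _ hf := hf.smul c

/-- The class in `L²(S)` of a continuous function with compact support. -/
noncomputable def surfaceCcToL2 {S : Set E3} (hm : MeasurableSet S)
    [IsFiniteMeasure (surfaceMeasure S)] : surfaceCc S →ₗ[ℂ] SurfaceL2 S where
  toFun f := (f.2.memLp hm 2).toLp f
  map_add' _ _ := rfl
  map_smul' _ _ := rfl

theorem ofReal_norm_surfaceCcToL2 {S : Set E3} (hm : MeasurableSet S)
    [IsFiniteMeasure (surfaceMeasure S)] (f : surfaceCc S) :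
    ENNReal.ofReal ‖surfaceCcToL2 hm f‖ = eLpNorm f.1 2 (surfaceMeasure S) :=
  (congrArg ENNReal.ofReal (Lp.norm_toLp _ (f.2.memLp hm 2))).trans
    (ENNReal.ofReal_toReal (f.2.memLp hm 2).eLpNorm_ne_top)

theorem denseRange_surfaceCcToL2 {S : Set E3} (hS : IsLocallyClosed S)
    (hm : MeasurableSet S) [IsFiniteMeasure (surfaceMeasure S)] :
    DenseRange (surfaceCcToL2 hm) := by
  intro f
  rw [EMetric.mem_closure_iff]
  intro ε hε
  obtain ⟨ε', hε', hlt⟩ := exists_between hε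
  obtain ⟨g, hg, hle⟩ := exists_isCompactlySupportedOn_eLpNorm_sub_le hS hm (Lp.memLp f) hε'.ne'
  refine ⟨_, ⟨⟨g, hg⟩, rfl⟩, lt_of_le_of_lt ?_ hlt⟩
  rw [Lp.edist_def]
  refine (eLpNorm_congr_ae ?_).trans_le hle
  exact (Filter.EventuallyEq.refl _ _).sub (MemLp.coeFn_toLp (hg.memLp hm 2))

theorem exists_isConvolutionRestriction {S₀ S₁ S₂ : Set E3} (h₀ : IsLocallyClosed S₀)
    (h₁ : IsLocallyClosed S₁) (hm₀ : MeasurableSet S₀) (hm₁ : MeasurableSet S₁)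
    [IsFiniteMeasure (surfaceMeasure S₀)] [IsFiniteMeasure (surfaceMeasure S₁)]
    [IsFiniteMeasure (surfaceMeasure S₂)] {C : ℝ} (hC : 0 ≤ C)
    (hex : ∀ f g : E3 → ℂ, IsCompactlySupportedOn S₀ f → IsCompactlySupportedOn S₁ g →
      ∃ F : E3 → ℂ, Continuous F ∧ HasCompactSupport F ∧ RepresentsConvolution S₀ S₁ f g F ∧
        eLpNorm F 2 (surfaceMeasure S₂) ≤ ENNReal.ofReal C *
          (eLpNorm f 2 (surfaceMeasure S₀) * eLpNorm g 2 (surfaceMeasure S₁))) :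
    ∃ B : SurfaceL2 S₀ →L[ℂ] SurfaceL2 S₁ →L[ℂ] SurfaceL2 S₂,
      IsConvolutionRestriction S₀ S₁ S₂ B ∧
      (∀ B' : SurfaceL2 S₀ →L[ℂ] SurfaceL2 S₁ →L[ℂ] SurfaceL2 S₂,
        IsConvolutionRestriction S₀ S₁ S₂ B' → B' = B) ∧
      ∀ f g, ‖B f g‖ ≤ C * ‖f‖ * ‖g‖ := by
  have hex' (f : surfaceCc S₀) (g : surfaceCc S₁) := hex f g f.2 g.2
  choose F hFc hFs hFi hFb using hex'
  have hFm (f g) : MemLp (F f g) 2 (surfaceMeasure S₂) := by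
    obtain ⟨K, hK⟩ := (hFc f g).bounded_above_of_compact_support (hFs f g)
    exact MemLp.of_bound (hFc f g).aestronglyMeasurable K (Filter.Eventually.of_forall hK)
  have hi₀ (f : surfaceCc S₀) : Integrable f.1 (surfaceMeasure S₀) := f.2.integrable hm₀
  have hi₁ (g : surfaceCc S₁) : Integrable g.1 (surfaceMeasure S₁) := g.2.integrable hm₁
  let b : surfaceCc S₀ →ₗ[ℂ] surfaceCc S₁ →ₗ[ℂ] SurfaceL2 S₂ :=
    LinearMap.mk₂ ℂ (fun f g => (hFm f g).toLp (F f g))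
      (fun f f' g => by
        rw [← MemLp.toLp_add]
        congr 1
        exact (hFi _ _).eq ((hFi f g).add_left (hi₀ f) (hi₀ f') (hi₁ g) (hFc _ _) (hFc _ _)
          (hFi f' g)) (hFc _ _) ((hFc _ _).add (hFc _ _)))
      (fun c f g => by
        rw [← MemLp.toLp_const_smul]
        congr 1
        exact (hFi _ _).eq ((hFi f g).smul_left c) (hFc _ _) ((hFc _ _).const_smul c))
      (fun f g g' => by
        rw [← MemLp.toLp_add]
        congr 1
        exact (hFi _ _).eq ((hFi f g).add_right (hi₀ f) (hi₁ g) (hi₁ g') (hFc _ _) (hFc _ _)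
          (hFi f g')) (hFc _ _) ((hFc _ _).add (hFc _ _)))
      (fun c f g => by
        rw [← MemLp.toLp_const_smul]
        congr 1
        exact (hFi _ _).eq ((hFi f g).smul_right c) (hFc _ _) ((hFc _ _).const_smul c))
  have hb (f g) : b f g = (hFm f g).toLp (F f g) := rfl
  set e₀ := surfaceCcToL2 hm₀ with he₀
  set e₁ := surfaceCcToL2 hm₁ with he₁
  have hd₀ : DenseRange e₀ := denseRange_surfaceCcToL2 h₀ hm₀
  have hd₁ : DenseRange e₁ := denseRange_surfaceCcToL2 h₁ hm₁
  obtain ⟨B, hB, hBn⟩ := exists_bilinear_extension hd₀ hd₁ b hC fun f g => by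
    rw [hb, Lp.norm_toLp, mul_assoc]
    refine ENNReal.toReal_le_of_le_ofReal (by positivity) ((hFb f g).trans_eq ?_)
    rw [ENNReal.ofReal_mul hC, ENNReal.ofReal_mul (norm_nonneg _)]
    rw [he₀, he₁, ofReal_norm_surfaceCcToL2, ofReal_norm_surfaceCcToL2]
  refine ⟨B, fun f g hf hg => ?_, fun B' hB' => ?_, hBn⟩
  · refine ⟨hf.memLp hm₀ 2, hg.memLp hm₁ 2, F ⟨f, hf⟩ ⟨g, hg⟩, hFc _ _, hFs _ _,
      hFi ⟨f, hf⟩ ⟨g, hg⟩, ?_⟩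
    have := hB ⟨f, hf⟩ ⟨g, hg⟩
    rw [hb] at this
    exact (congrArg (fun u : SurfaceL2 S₂ => (u : E3 → ℂ)) this).eventuallyEq.trans
      (MemLp.coeFn_toLp _)
  · have key (f : surfaceCc S₀) (g : surfaceCc S₁) :
        B' (e₀ f) (e₁ g) = B (e₀ f) (e₁ g) := by
      obtain ⟨_, _, F', hFc', -, hFi', hF'⟩ := hB' f g f.2 g.2
      rw [hB, hb]
      refine Lp.ext (hF'.trans ?_)
      rw [hFi'.eq (hFi f g) hFc' (hFc f g)]
      exact (MemLp.coeFn_toLp _).symm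
    refine ContinuousLinearMap.coeFn_injective
      (hd₀.equalizer B'.continuous B.continuous (funext fun f => ?_))
    exact ContinuousLinearMap.coeFn_injective
      (hd₁.equalizer (B' (e₀ f)).continuous (B (e₀ f)).continuous (funext (key f)))

/-! ### The cover depending only on β, and the conclusion -/

theorem exists_ball_cover {β : ℝ} (hβ : 0 < β) : ∃ (r : ℝ) (t : Finset E3), 0 < r ∧
    (4 * r) ^ β ≤ 1 / 400 ∧ Metric.closedBall 0 1 ⊆ ⋃ c ∈ t, Metric.ball c r := by
  -- Two points of a ball of radius `2 * r` are less than `4 * r` apart, and `(4 * r) ^ β = 1 / 400`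
  -- is the smallness demanded of the pieces.
  set r : ℝ := (1 / 400) ^ β⁻¹ / 4 with hr
  have hr0 : 0 < r := by positivity
  obtain ⟨t, -, htf, ht⟩ := (isCompact_closedBall (0 : E3) 1).finite_cover_balls hr0
  refine ⟨r, htf.toFinset, hr0, ?_, by simpa using ht⟩
  rw [hr, mul_div_cancel₀ _ four_ne_zero, ← Real.rpow_mul (by norm_num), inv_mul_cancel₀ hβ.ne',
    Real.rpow_one]

theorem subset_translated_cover {S : Set E3} (hb : Bornology.IsBounded S)
    (hd : Metric.diam S ≤ 1) {x : E3} (hx : x ∈ S) {t : Finset E3} {r : ℝ}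
    (ht : Metric.closedBall 0 1 ⊆ ⋃ c ∈ t, Metric.ball c r) :
    S ⊆ ⋃ c ∈ t, Metric.ball (x + c) r := by
  intro σ hσ
  have h1 : σ - x ∈ Metric.closedBall (0 : E3) 1 := by
    rw [mem_closedBall_zero_iff, ← dist_eq_norm]
    exact (Metric.dist_le_diam_of_mem hb hσ hx).trans hd
  obtain ⟨c, hc, hcr⟩ := Set.mem_iUnion₂.1 (ht h1)
  refine Set.mem_iUnion₂.2 ⟨c, hc, ?_⟩
  rw [Metric.mem_ball, dist_eq_norm] at hcr ⊢
  rwa [← sub_sub]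

theorem mainTheorem4 (β : ℝ) (hβ₀ : 0 < β) (hβ₁ : β ≤ 1) :
    ∃ C : ℝ, 0 < C ∧
      ∀ S : Fin 3 → Set E3, (∀ i, (S i).Nonempty) →
        SurfaceAssumption β 1 (1 / 2) S → (∀ i, Metric.diam (S i) ≤ 1) →
        ∀ T : E3 ≃ₗ[ℝ] E3,
          ∃ B : SurfaceL2 (T '' S 0) →L[ℂ] SurfaceL2 (T '' S 1) →L[ℂ] SurfaceL2 (T '' S 2),
            IsConvolutionRestriction (T '' S 0) (T '' S 1) (T '' S 2) B ∧
            (∀ B' : SurfaceL2 (T '' S 0) →L[ℂ] SurfaceL2 (T '' S 1) →L[ℂ] SurfaceL2 (T '' S 2),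
              IsConvolutionRestriction (T '' S 0) (T '' S 1) (T '' S 2) B' → B' = B) ∧
            ∀ (f : SurfaceL2 (T '' S 0)) (g : SurfaceL2 (T '' S 1)),
              ‖B f g‖ ≤ C / √(transversalityInf fun i => T '' S i) * ‖f‖ * ‖g‖ := by
  obtain ⟨r, t, hr, hrβ, ht⟩ := exists_ball_cover hβ₀
  -- The cover `t` of the unit ball was fixed before the surfaces and `T`; its translates cover
  -- every surface of diameter at most 1. The summand 1 makes positivity immediate.
  refine ⟨t.card ^ 3 + 1, by positivity, fun S hne hS hdiam T' => ?_⟩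
  obtain ⟨Sstar, U, Φ, n, hA⟩ := hS
  have h (i) := hA.holderSurface i
  have hdet (σ : Fin 3 → E3) (hσ : ∀ i, σ i ∈ S i) :
      1 / 2 ≤ (columnMatrix fun i => n i (σ i)).det := by
    refine (hA.transversal σ fun i => ?_).1
    obtain ⟨O, -, hO⟩ := hA.relOpen i
    exact (hO ▸ hσ i : σ i ∈ Sstar i ∩ O).1
  obtain ⟨T, rfl⟩ : ∃ T : E3 ≃L[ℝ] E3, T' = T.toLinearEquiv := ⟨T'.toContinuousLinearEquiv, rfl⟩
  simp only [ContinuousLinearEquiv.coe_toLinearEquiv]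
  choose x hx using hne
  have hcov (i) := subset_translated_cover (h i).isBounded (hdiam i) (hx i) ht
  have hloc (i) : IsLocallyClosed (T '' S i) := by
      rw [T.image_eq_preimage_symm]
      exact (h i).isLocallyClosed.preimage T.symm.continuous
  have hm (i) : MeasurableSet (T '' S i) := by
    obtain ⟨U, Z, hU, hZ, e⟩ := hloc i
    rw [e]
    exact hU.measurableSet.inter hZ.measurableSet
  have hfin (i) : IsFiniteMeasure (surfaceMeasure (T '' S i)) := by
    refine (h i).isFiniteMeasure_image (hcov i) (fun c _ σ hσ τ hτ => ?_) T
    refine (Real.rpow_le_rpow (norm_nonneg _) ?_ hβ₀.le).trans hrβ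
    have := dist_triangle_right σ τ (x i + c)
    rw [← dist_eq_norm]
    linarith [Metric.mem_ball.1 hσ.2, Metric.mem_ball.1 hτ.2]
  have hd := transversalityInf_pos h (fun i => ⟨x i, hx i⟩) hdet T
  refine exists_isConvolutionRestriction (hloc 0) (hloc 1) (hm 0) (hm 1) (by positivity)
    fun f g hf hg => ?_
  obtain ⟨F, hFc, hFs, hFi, hFb⟩ := exists_density hβ₀ h hdet ⟨x 2, hx 2⟩ T hd
    (fun σ hσ => transversalityInf_le h T hσ) hr hrβ hcov hf hg
  refine ⟨F, hFc, hFs, hFi, hFb.trans (mul_le_mul_left (ENNReal.ofReal_le_ofReal ?_) _)⟩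
  gcongr
  linarith
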